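/- **Conventions.** Let $\mathbb R^m_s$ be $\mathbb R^m$ with $\langle x,x\rangle=\sum_{i\le m-s}x_i^2-\sum_{i>m-s}x_i^2$; $\langle\cdot,\cdot\rangle$ is extended complex bilinearly to $\mathbb C^m$. Let $r\ge 0$, $n\ge r+2$, and let $Q^n_r$ be the projectivized light cone of $\mathbb R^{n+2}_{r+1}$. Let $M$ be a connected smooth surface (Hausdorff, second countable). For a spacelike surface $y:M\to Q^n_r$ with complex coordinate $z$, a canonical lift $Y$ is a smooth lift of $y$ to the light cone with $|dY|^2=|dz|^2$; $V=\mathrm{Span}\{Y,\mathrm{Re}\,Y_z,\mathrm{Im}\,Y_z,Y_{z\bar z}\}$; $D$ is the normal connection on the conformal normal bundle $V^\perp$; the conformal Hopf differential $\kappa$ is defined by $Y_{zz}=-\frac s2Y+\kappa$, $\kappa\in V^\perp\otimes\mathbb C$. The conformally invariant metric is $\langle\kappa,\bar\kappa\rangle|dz|^2$, and for closed $M$ the Willmore functional is $W(y)=2i\int_M\langle\kappa,\bar\kappa\rangle\,dz\wedge d\bar z$. The surface $y$ is *isothermic* if around each point there is a complex coordinate $z$ (an *adapted coordinate*) for which $\kappa$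 is real-valued. It is *full* if no nonempty open piece of it is contained in a hyperplane $v^\perp$, $0\ne v\in\mathbb R^{n+2}_{r+1}$. For $c\in\mathbb R$, let $N_c=\{x\in\mathbb R^{n+2}_{r+1}:\langle x,x\rangle=c\}$ if $c\neq0$ (a pseudo-sphere for $c>0$, a pseudo-hyperbolic space for $c<0$), and $N_0=\mathbb R^{n+2}_{r+1}$. A *$c$-polar transform* of an isothermic $y$ is a smooth nowhere vanishing parallel section $\psi:M\to\mathbb R^{n+2}_{r+1}$ of $V^\perp$ with $\langle\psi,\psi\rangle=c$. It is regarded as a map to $N_c$; its conformal class is $[\psi]:M\to Q^n_r$ if $c=0$, $[(\psi,\sqrt c)]:M\to Q^{n+1}_{r+1}$ if $c>0$, and $[(\sqrt{-c},\psi)]:M\to Q^{n+1}_{r}$ if $c<0$. A spacelike surface $f$ in $N_c$ is isothermic, with adapted coordinate $z$, if its vector-valued Hopf differential $\Omega$, the normal component of $f_{zz}$, is real-valued. A *parallel isoperimetric section* of $f$ is a nowhere vanishing parallel normal field $\xi$ (possibly null) with $\langle\xi,H\rangle$ constant, $H$ being the mean curvature vector; it is *minimal* if $\langle\xi,H\rangle=0$.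 **Theorem.** Let $y:M\to Q^n_r$ be a full spacelike isothermic surface. 1. Let $\psi$ be a $c$-polar transform of $y$, and let $M_0\subseteq M$ be the set of points at which $\psi$ is an immersion. Then $M_0$ is open and dense. On $M_0$, $\psi$ is a spacelike isothermic surface in $N_c$ and its conformal class is a spacelike isothermic surface; every adapted coordinate of $y$ with domain in $M_0$ is an adapted coordinate of both. On the domain in $M_0$ of any adapted coordinate $z$ with canonical lift $Y$, we have $\langle\psi,\kappa\rangle\neq0$, and $Y^\psi=Y/\langle\psi,\kappa\rangle$ is a lift of $y$ which is a null parallel minimal section of $\psi$ (so $\psi$ is there a generalized $H$-surface in $N_c$) and is dual to $\psi$: $Y^\psi_z=\lambda\,\psi_{\bar z}$ with $\lambda\ne0$. 2. In every such adapted coordinate, the conformally invariant metric of (the conformal class of) $\psi$ is $$g^\psi=\Big(\langle\kappa,\kappa\rangle+\Big(\frac{\langle\psi,D_z\kappa\rangle}{\langle\psi,\kappa\rangle}\Big)_{\bar z}\Big)|dz|^2 .$$ If $M$ is closed and $\psi$ is globally immersed ($M_0=M$), then $W(\psi)=W(y)$. 3. Two $c$-polar transforms $\psi,\tilde\psi$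 of $y$ are isometric, i.e. induce the same metric on $M$, if and only if $\tilde\psi=\pm\psi$. If $M$ is simply connected, there is a linear isometry $\Phi$ of $\mathbb R^{n-2}_r$ onto the space of all parallel sections of $V^\perp$. For each $c$ it restricts to a bijection of $\{x\in\mathbb R^{n-2}_r\setminus\{0\}:\langle x,x\rangle=c\}$ (the pseudo-sphere $S^{n-3}_r(c)$ for $c>0$, the null cone without its vertex for $c=0$, the pseudo-hyperbolic space $H^{n-3}_{r-1}(c)$ for $c<0$) onto the set of $c$-polar transforms of $y$, and it induces a bijection of $\{x\in\mathbb R^{n-2}_r\setminus\{0\}:\langle x,x\rangle=c\}/\{\pm1\}$ onto the set of $c$-polar transforms modulo isometry. -/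

import Mathlib

open Set MeasureTheory
open scoped Manifold ContDiff LinearAlgebra.Projectivization

noncomputable section

namespace Polar

/-! ### Pseudo-Euclidean spaces and the projectivized light cone -/

/-- The bilinear form of index `s` on `K ^ m` (`K` is `ℝ`, or `ℂ` for the complex bilinear
extension): the first `m - s` coordinates count positively, the last `s` negatively. -/
def ip {K : Type*} [CommRing K] {m : ℕ} (s : ℕ) (x y : Fin m → K) : K :=
  ∑ i : Fin m, (if (i : ℕ) + s < m then 1 else -1) * x i * y i

/-- The inclusion of `ℝ ^ m` into `ℂ ^ m`. -/
def toC {m : ℕ} (x : Fin m → ℝ) : Fin m → ℂ := fun i => (x i : ℂ)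

/-- `Q^n_r`: the projectivized light cone of the space `ℝ ^ (n + 2)` of index `r + 1`. -/
def Quadric (n r : ℕ) : Type :=
  {q : ℙ ℝ (Fin (n + 2) → ℝ) // ip (r + 1) q.rep q.rep = 0}

lemma ip_smul_smul {m : ℕ} (s : ℕ) (a : ℝ) (x : Fin m → ℝ) :
    ip s (a • x) (a • x) = a ^ 2 * ip s x x := by
  simp only [ip, Finset.mul_sum, Pi.smul_apply, smul_eq_mul]
  exact Finset.sum_congr rfl fun i _ => by ring

/-- The point `[v]` of `Q^n_r` given by a nonzero null vector `v`. -/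
def Quadric.mk {n r : ℕ} (v : Fin (n + 2) → ℝ) (h0 : v ≠ 0) (hv : ip (r + 1) v v = 0) :
    Quadric n r :=
  ⟨Projectivization.mk ℝ v h0, by
    obtain ⟨a, ha⟩ := Projectivization.exists_smul_eq_mk_rep ℝ v h0
    rw [← ha, Units.smul_def, ip_smul_smul, hv, mul_zero]⟩

section Surfaces

variable {M : Type*} [TopologicalSpace M] [ChartedSpace ℂ M]

/-! ### Coordinate derivatives -/

/-- `∂F/∂z` for the coordinate `z = φ`, at points of `φ.source`. -/
def dz {V : Type*} [NormedAddCommGroup V] [NormedSpace ℂ V]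
    (φ : OpenPartialHomeomorph M ℂ) (F : M → V) (p : M) : V :=
  (1 / 2 : ℂ) • (fderiv ℝ (F ∘ φ.symm) (φ p) 1 - Complex.I • fderiv ℝ (F ∘ φ.symm) (φ p) Complex.I)

/-- `∂F/∂z̄` for the coordinate `z = φ`, at points of `φ.source`. -/
def dzb {V : Type*} [NormedAddCommGroup V] [NormedSpace ℂ V]
    (φ : OpenPartialHomeomorph M ℂ) (F : M → V) (p : M) : V :=
  (1 / 2 : ℂ) • (fderiv ℝ (F ∘ φ.symm) (φ p) 1 + Complex.I • fderiv ℝ (F ∘ φ.symm) (φ p) Complex.I)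

/-! ### Normal components -/

/-- The orthogonal complement of `T` for the complex bilinear form of index `s`. -/
def perp {m : ℕ} (s : ℕ) (T : Submodule ℂ (Fin m → ℂ)) : Set (Fin m → ℂ) :=
  {w | ∀ v ∈ T, ip s w v = 0}

open Classical in
/-- The normal component of `v`: the vector `w` orthogonal to `T` with `v - w ∈ T`. It exists and
is unique if the form is nondegenerate on `T`, which holds wherever it is used below. -/
def normalPart {m : ℕ} (s : ℕ) (T : Submodule ℂ (Fin m → ℂ)) (v : Fin m → ℂ) : Fin m → ℂ :=
  if h : ∃ w, w ∈ perp s T ∧ v - w ∈ T then h.choose else 0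

/-! ### Conformal geometry of spacelike surfaces in `Q^n_r` -/

section Conformal

variable {n : ℕ} (r : ℕ)

/-- `Y` is a smooth lift to the light cone, on the open set `U`, of the map `y`. -/
structure IsLiftOn (y : M → Quadric n r) (U : Set M) (Y : M → Fin (n + 2) → ℝ) : Prop where
  smooth : ContMDiffOn 𝓘(ℝ, ℂ) 𝓘(ℝ, Fin (n + 2) → ℝ) ∞ Y U
  lift : ∀ p ∈ U, ∃ h : Y p ≠ 0, Projectivization.mk ℝ (Y p) h = (y p).1

/-- `z = φ` is a complex coordinate of the spacelike surface `y`, and `Y` is a canonical lift of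
`y` with respect to it: `|dY|² = |dz|²`. -/
structure IsCanonicalLift (y : M → Quadric n r) (φ : OpenPartialHomeomorph M ℂ)
    (Y : M → Fin (n + 2) → ℝ) : Prop where
  chart : φ ∈ IsManifold.maximalAtlas 𝓘(ℝ, ℂ) ∞ M
  lift : IsLiftOn r y φ.source Y
  isometric : ∀ p ∈ φ.source, ∀ v : ℂ,
    ip (r + 1) (fderiv ℝ (Y ∘ φ.symm) (φ p) v) (fderiv ℝ (Y ∘ φ.symm) (φ p) v) = ‖v‖ ^ 2

/-- The complexified conformal tangent space `V ⊗ ℂ` at `p`, spanned by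
`Y, Y_z, Y_z̄, Y_{z z̄}`. -/
def confTangent (φ : OpenPartialHomeomorph M ℂ) (Y : M → Fin (n + 2) → ℝ) (p : M) :
    Submodule ℂ (Fin (n + 2) → ℂ) :=
  Submodule.span ℂ {toC (Y p), dz φ (toC ∘ Y) p, dzb φ (toC ∘ Y) p, dzb φ (dz φ (toC ∘ Y)) p}

/-- The conformal Hopf differential `κ`: the normal component in
`Y_{zz} = - (s / 2) Y + κ`, `κ ∈ V^⊥ ⊗ ℂ`. -/
def hopf (φ : OpenPartialHomeomorph M ℂ) (Y : M → Fin (n + 2) → ℝ) (p : M) : Fin (n + 2) → ℂ :=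
  normalPart (r + 1) (confTangent φ Y p) (dz φ (dz φ (toC ∘ Y)) p)

/-- The normal connection `D_z ξ` of the conformal normal bundle `V^⊥`. -/
def normalDz (φ : OpenPartialHomeomorph M ℂ) (Y : M → Fin (n + 2) → ℝ)
    (ξ : M → Fin (n + 2) → ℂ) (p : M) : Fin (n + 2) → ℂ :=
  normalPart (r + 1) (confTangent φ Y p) (dz φ ξ p)

/-- `z = φ` is an adapted coordinate of `y` (with canonical lift `Y`): `κ` is real-valued. -/
def IsAdapted (y : M → Quadric n r) (φ : OpenPartialHomeomorph M ℂ)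
    (Y : M → Fin (n + 2) → ℝ) : Prop :=
  IsCanonicalLift r y φ Y ∧ ∀ p ∈ φ.source, ∀ i, (hopf r φ Y p i).im = 0

/-- On the open set `S`, `y` is a spacelike isothermic surface. -/
def IsIsothermicOn (y : M → Quadric n r) (S : Set M) : Prop :=
  ∀ p ∈ S, ∃ φ Y, p ∈ φ.source ∧ φ.source ⊆ S ∧ IsAdapted r y φ Y

/-- `y` is full: no nonempty open piece of the surface lies in a hyperplane. -/
def IsFull (y : M → Quadric n r) : Prop :=
  ∀ U : Set M, IsOpen U → U.Nonempty → ∀ v : Fin (n + 2) → ℝ, v ≠ 0 →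
    ∃ p ∈ U, ip (r + 1) v (y p).1.rep ≠ 0

/-- `⟨κ, κ̄⟩`, the coefficient of the conformally invariant metric `⟨κ, κ̄⟩ |dz|²`. -/
def confMetric (φ : OpenPartialHomeomorph M ℂ) (Y : M → Fin (n + 2) → ℝ) (p : M) : ℂ :=
  ip (r + 1) (hopf r φ Y p) (star (hopf r φ Y p))

/-- A finite cover of the surface by complex coordinates of `y` with canonical lifts, and a
subordinate partition of unity. -/
structure CoordCover (y : M → Quadric n r) where
  k : ℕ
  φ : Fin k → OpenPartialHomeomorph M ℂ
  Y : Fin k → M → Fin (n + 2) → ℝ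
  canonical : ∀ i, IsCanonicalLift r y (φ i) (Y i)
  ρ : SmoothPartitionOfUnity (Fin k) 𝓘(ℝ, ℂ) M univ
  subordinate : ρ.IsSubordinate fun i => (φ i).source

/-- The integral `2i ∫_M ⟨κ, κ̄⟩ dz ∧ dz̄ = 4 ∫_M ⟨κ, κ̄⟩ du dv`, `z = u + iv`, computed from a
cover. (`⟨κ, κ̄⟩` is a real number.) -/
def CoordCover.willmore {y : M → Quadric n r} (C : CoordCover r y) : ℝ :=
  ∑ i, 4 * ∫ w in (C.φ i).target,
    C.ρ i ((C.φ i).symm w) * (confMetric r (C.φ i) (C.Y i) ((C.φ i).symm w)).re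

/-- The Willmore functional of the closed surface `y` exists and equals `w`: there are covers, and
each of them computes the value `w`. -/
def HasWillmore (y : M → Quadric n r) (w : ℝ) : Prop :=
  Nonempty (CoordCover r y) ∧ ∀ C : CoordCover r y, C.willmore = w

/-! ### Polar transforms -/

/-- `ψ` is a parallel section of the conformal normal bundle of `y`. -/
structure IsParallelSection (y : M → Quadric n r) (ψ : M → Fin (n + 2) → ℝ) : Prop where
  smooth : ContMDiff 𝓘(ℝ, ℂ) 𝓘(ℝ, Fin (n + 2) → ℝ) ∞ ψ
  normal : ∀ φ Y, IsCanonicalLift r y φ Y → ∀ p ∈ φ.source,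
    toC (ψ p) ∈ perp (r + 1) (confTangent φ Y p)
  parallel : ∀ φ Y, IsCanonicalLift r y φ Y → ∀ p ∈ φ.source, normalDz r φ Y (toC ∘ ψ) p = 0

/-- `ψ` is a `c`-polar transform of `y`. (For `c = 0`, `ψ` has to have no zeros for `[ψ]` to be
defined; for `c ≠ 0` this is automatic.) -/
structure IsPolar (y : M → Quadric n r) (c : ℝ) (ψ : M → Fin (n + 2) → ℝ) : Prop where
  section_ : IsParallelSection r y ψ
  length : ∀ p, ip (r + 1) (ψ p) (ψ p) = c
  ne_zero : ∀ p, ψ p ≠ 0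

variable {r}

/-- The map `[ψ] : M → Q^n_r` of a `0`-polar transform. -/
def IsPolar.conf0 {y : M → Quadric n r} {c : ℝ} {ψ : M → Fin (n + 2) → ℝ}
    (h : IsPolar r y c ψ) (hc : c = 0) : M → Quadric n r :=
  fun p => Quadric.mk (ψ p) (h.ne_zero p) ((h.length p).trans hc)

/-- For `c > 0`, the pseudo-sphere `{⟨x, x⟩ = c}` of `ℝ ^ (n + 2)` (index `r + 1`) is conformally
embedded in `Q^{n+1}_{r+1}` by `x ↦ [(x, √c)]`; this is `ψ` as a map to `Q^{n+1}_{r+1}`. -/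
def IsPolar.confPos {y : M → Quadric n r} {c : ℝ} {ψ : M → Fin (n + 2) → ℝ}
    (h : IsPolar r y c ψ) (hc : 0 < c) : M → Quadric (n + 1) (r + 1) :=
  fun p => Quadric.mk (Fin.snoc (α := fun _ => ℝ) (ψ p) (Real.sqrt c) : Fin (n + 2 + 1) → ℝ)
    (by
      intro h0
      have := congrFun h0 (Fin.last (n + 2))
      simp only [Fin.snoc_last, Pi.zero_apply] at this
      exact (Real.sqrt_pos.2 hc).ne' this)
    (by
      have hl := h.length p
      have hs := Real.mul_self_sqrt hc.le
      unfold ip at hl ⊢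
      rw [Fin.sum_univ_castSucc]
      simp only [Fin.snoc_castSucc, Fin.snoc_last, Fin.val_castSucc, Fin.val_last]
      rw [if_neg (by omega)]
      have e : ∀ i : Fin (n + 2), ((i : ℕ) + (r + 1 + 1) < n + 1 + 2) = ((i : ℕ) + (r + 1) < n + 2) :=
        fun i => propext (by omega)
      simp only [e]
      rw [hl]
      linarith)

/-- For `c < 0`, the pseudo-hyperbolic space `{⟨x, x⟩ = c}` of `ℝ ^ (n + 2)` (index `r + 1`) is
conformally embedded in `Q^{n+1}_r` by `x ↦ [(√(-c), x)]`; this is `ψ` as a map to `Q^{n+1}_r`. -/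
def IsPolar.confNeg {y : M → Quadric n r} {c : ℝ} {ψ : M → Fin (n + 2) → ℝ}
    (h : IsPolar r y c ψ) (hc : c < 0) (hr : r + 2 ≤ n) : M → Quadric (n + 1) r :=
  fun p => Quadric.mk (Fin.cons (α := fun _ => ℝ) (Real.sqrt (-c)) (ψ p) : Fin (n + 2 + 1) → ℝ)
    (by
      intro h0
      have := congrFun h0 0
      simp only [Fin.cons_zero, Pi.zero_apply] at this
      exact (Real.sqrt_pos.2 (neg_pos.2 hc)).ne' this)
    (by
      have hl := h.length p
      have hs := Real.mul_self_sqrt (neg_pos.2 hc).le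
      unfold ip at hl ⊢
      rw [Fin.sum_univ_succ]
      simp only [Fin.cons_zero, Fin.cons_succ, Fin.val_succ]
      rw [if_pos (show ((0 : Fin (n + 2 + 1)) : ℕ) + (r + 1) < n + 1 + 2 by
        rw [Fin.val_zero]; omega)]
      have e : ∀ i : Fin (n + 2), ((i : ℕ) + 1 + (r + 1) < n + 1 + 2) = ((i : ℕ) + (r + 1) < n + 2) :=
        fun i => propext (by omega)
      simp only [e]
      rw [hl]
      linarith)

variable (r)

/-- The lift `Y^ψ = Y / ⟨ψ, κ⟩`. (In an adapted coordinate `⟨ψ, κ⟩` is real.) -/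
def polarLift (φ : OpenPartialHomeomorph M ℂ) (Y ψ : M → Fin (n + 2) → ℝ) (p : M) :
    Fin (n + 2) → ℝ :=
  (ip (r + 1) (toC (ψ p)) (hopf r φ Y p)).re⁻¹ • Y p

/-- `⟨κ, κ⟩ + (⟨ψ, D_z κ⟩ / ⟨ψ, κ⟩)_z̄`. -/
def polarMetric (φ : OpenPartialHomeomorph M ℂ) (Y ψ : M → Fin (n + 2) → ℝ) (p : M) : ℂ :=
  ip (r + 1) (hopf r φ Y p) (hopf r φ Y p) +
    dzb φ (fun q => ip (r + 1) (toC (ψ q)) (normalDz r φ Y (hopf r φ Y) q) /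
      ip (r + 1) (toC (ψ q)) (hopf r φ Y q)) p

end Conformal

/-- On `S`, the surface `η` is isothermic with the same adapted coordinates as `y`, and in these
coordinates its conformally invariant metric is `⟨κ, κ⟩ + (⟨ψ, D_z κ⟩ / ⟨ψ, κ⟩)_z̄` times
`|dz|²`. -/
structure SharesAdapted {n r n' r' : ℕ} (y : M → Quadric n r) (ψ : M → Fin (n + 2) → ℝ)
    (η : M → Quadric n' r') (S : Set M) : Prop where
  isothermic : IsIsothermicOn r' η S
  adapted : ∀ φ Y, IsAdapted r y φ Y → φ.source ⊆ S → ∃ Y', IsAdapted r' η φ Y'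
  metric : ∀ φ Y, IsAdapted r y φ Y → φ.source ⊆ S → ∀ Y', IsCanonicalLift r' η φ Y' →
    ∀ p ∈ φ.source, confMetric r' φ Y' p = polarMetric r φ Y ψ p

/-! ### Surfaces in pseudo-Euclidean space and its quadrics -/

section SpaceForm

variable {m : ℕ} (s : ℕ)

/-- The metric induced by `f`. -/
def inducedMetric (f : M → Fin m → ℝ) (p : M) (v w : TangentSpace 𝓘(ℝ, ℂ) p) : ℝ :=
  ip s (mfderiv 𝓘(ℝ, ℂ) 𝓘(ℝ, Fin m → ℝ) f p v : Fin m → ℝ)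
    (mfderiv 𝓘(ℝ, ℂ) 𝓘(ℝ, Fin m → ℝ) f p w : Fin m → ℝ)

/-- The points at which `f` is an immersion. -/
def immersionSet (f : M → Fin m → ℝ) : Set M :=
  {p | Function.Injective (mfderiv 𝓘(ℝ, ℂ) 𝓘(ℝ, Fin m → ℝ) f p)}

/-- For a surface `f` with `⟨f, f⟩ = c`: the complexified tangent space of the surface, together
with `f` itself if `c ≠ 0`. Its orthogonal complement is the complexified normal space of `f` as a
surface in `{x | ⟨x, x⟩ = c}` if `c ≠ 0`, and in the flat space `ℝ ^ m` if `c = 0`. -/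
def tangent (c : ℝ) (φ : OpenPartialHomeomorph M ℂ) (f : M → Fin m → ℝ) (p : M) :
    Submodule ℂ (Fin m → ℂ) :=
  Submodule.span ℂ ({dz φ (toC ∘ f) p, dzb φ (toC ∘ f) p} ∪ {v | c ≠ 0 ∧ v = toC (f p)})

/-- The vector-valued Hopf differential `Ω`, the normal component of `f_{zz}`. -/
def vecHopf (c : ℝ) (φ : OpenPartialHomeomorph M ℂ) (f : M → Fin m → ℝ) (p : M) : Fin m → ℂ :=
  normalPart s (tangent c φ f p) (dz φ (dz φ (toC ∘ f)) p)

/-- The mean curvature vector `H`: `(1/2) e^{2ω} H` is the normal component of `f_{z z̄}`, where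
`e^{2ω} = 2 ⟨f_z, f_z̄⟩`. -/
def meanCurv (c : ℝ) (φ : OpenPartialHomeomorph M ℂ) (f : M → Fin m → ℝ) (p : M) : Fin m → ℂ :=
  (ip s (dz φ (toC ∘ f) p) (dzb φ (toC ∘ f) p))⁻¹ •
    normalPart s (tangent c φ f p) (dzb φ (dz φ (toC ∘ f)) p)

/-- `z = φ` is a complex coordinate of the spacelike surface `f` (the induced metric is
`e^{2ω} |dz|²`), and it is adapted: `Ω` is real-valued. -/
structure IsAdaptedForm (c : ℝ) (f : M → Fin m → ℝ) (φ : OpenPartialHomeomorph M ℂ) : Prop where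
  chart : φ ∈ IsManifold.maximalAtlas 𝓘(ℝ, ℂ) ∞ M
  smooth : ContMDiffOn 𝓘(ℝ, ℂ) 𝓘(ℝ, Fin m → ℝ) ∞ f φ.source
  conformal : ∀ p ∈ φ.source, ∃ e : ℝ, 0 < e ∧ ∀ v : ℂ,
    ip s (fderiv ℝ (f ∘ φ.symm) (φ p) v) (fderiv ℝ (f ∘ φ.symm) (φ p) v) = e * ‖v‖ ^ 2
  real : ∀ p ∈ φ.source, ∀ i, (vecHopf s c φ f p i).im = 0

/-- On the open set `S`, `f` is a spacelike isothermic surface in `{x | ⟨x, x⟩ = c}` if `c ≠ 0`,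
and in the flat space `ℝ ^ m` if `c = 0`. -/
def IsIsothermicFormOn (c : ℝ) (f : M → Fin m → ℝ) (S : Set M) : Prop :=
  (∀ p ∈ S, c ≠ 0 → ip s (f p) (f p) = c) ∧
    ∀ p ∈ S, ∃ φ, p ∈ φ.source ∧ φ.source ⊆ S ∧ IsAdaptedForm s c f φ

/-- `ξ` is a parallel isoperimetric section of `f` over the coordinate domain `φ.source`, with
constant `⟨ξ, H⟩ = a`: a smooth nowhere vanishing normal field with `D_z ξ = 0`. It is a parallel
minimal section if `a = 0`. The length of `ξ` is constant, and may be zero. -/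
structure IsParallelIsoperimetric (c : ℝ) (φ : OpenPartialHomeomorph M ℂ) (f : M → Fin m → ℝ)
    (ξ : M → Fin m → ℝ) (a : ℂ) : Prop where
  smooth : ContMDiffOn 𝓘(ℝ, ℂ) 𝓘(ℝ, Fin m → ℝ) ∞ ξ φ.source
  ne_zero : ∀ p ∈ φ.source, ξ p ≠ 0
  normal : ∀ p ∈ φ.source, toC (ξ p) ∈ perp s (tangent c φ f p)
  parallel : ∀ p ∈ φ.source, normalPart s (tangent c φ f p) (dz φ (toC ∘ ξ) p) = 0
  isoperimetric : ∀ p ∈ φ.source, ip s (toC (ξ p)) (meanCurv s c φ f p) = a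

/-- `g` is dual to `f` in the coordinate `z = φ`: `g_z` is parallel to `f_z̄`. -/
def IsDual (φ : OpenPartialHomeomorph M ℂ) (g f : M → Fin m → ℝ) : Prop :=
  ∀ p ∈ φ.source, ∃ l : ℂ, l ≠ 0 ∧ dz φ (toC ∘ g) p = l • dzb φ (toC ∘ f) p

end SpaceForm

/-! ### Moduli -/

/-- Two `c`-polar surfaces are identified if they are isometric: they induce the same metric. -/
def isometrySetoid {n : ℕ} (r : ℕ) (y : M → Quadric n r) (c : ℝ) :
    Setoid {ψ : M → Fin (n + 2) → ℝ // IsPolar r y c ψ} where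
  r ψ₁ ψ₂ := ∀ p v w, inducedMetric (r + 1) ψ₁.1 p v w = inducedMetric (r + 1) ψ₂.1 p v w
  iseqv := ⟨fun _ _ _ _ => rfl, fun h p v w => (h p v w).symm,
    fun h k p v w => (h p v w).trans (k p v w)⟩

end Surfaces

/-- The nonzero vectors of square length `c` in `ℝ ^ k` with the form of index `r`; for `c ≠ 0`
this is the whole quadric `{x | ⟨x, x⟩ = c}`. -/
def quadricSet (k r : ℕ) (c : ℝ) : Set (Fin k → ℝ) := {x | x ≠ 0 ∧ ip r x x = c}

/-- The `ℤ/2`-quotient of the quadric: `x` is identified with `-x`. -/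
def signSetoid (k r : ℕ) (c : ℝ) : Setoid (quadricSet k r c) where
  r x y := y.1 = x.1 ∨ y.1 = -x.1
  iseqv := ⟨fun _ => Or.inl rfl,
    by
      rintro x y (h | h)
      · exact Or.inl h.symm
      · exact Or.inr (by rw [h, neg_neg]),
    by
      rintro x y z (h | h) (k | k)
      · exact Or.inl (k.trans h)
      · exact Or.inr (by rw [k, h])
      · exact Or.inr (by rw [k, h])
      · exact Or.inl (by rw [k, h, neg_neg])⟩

end Polar

end

open Polar

set_option linter.unusedSectionVars false

open Set MeasureTheory
open scoped Manifold ContDiff LinearAlgebra.Projectivization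

noncomputable section

/-! Fix an adapted coordinate with canonical lift Y and put h = ⟨ψ, κ⟩, a real function. A parallel
normal field satisfies ψ_z = 2 h_z̄ Y - 2 h Y_z̄ (`dz_of_parallel`; the coefficient of Y is a
Codazzi equation). Together with the Gram matrix of Y, Y_z, Y_z̄, Y_zz̄ this formula yields
everything local. The induced metric is 4 h² |dz|², so ψ is an immersion exactly where h ≠ 0. If h
vanished on an open set, ψ would be constant there and y would lie in the hyperplane orthogonal to
it, against fullness. Modulo ψ_z and ψ_z̄, the vector ψ_zz equals 2 h_zz̄ Y - 2 h Y_zz̄, which is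
real, so ψ is isothermic in the same coordinate. Finally (Y/h)_z = -ψ_z̄ / (2 h²) gives duality and
parallelism of Y/h, and ψ_zz̄ ⊥ Y gives minimality.

The conformal classes for c = 0, c > 0 and c < 0 are treated at once: each has a null lift F = ι ψ +
b with ι a linear isometric embedding (`ConfModel`), and F/(2h) is a canonical lift. For every
canonical lift ⟨κ, κ̄⟩ = ⟨Y_zz̄, Y_zz̄⟩ (`confMetric_eq`), so the new metric is a computation; its
coefficient is ⟨κ, κ⟩ + (h_z/h)_z̄. Between adapted coordinates the ratio of the canonical lifts is
locally constant, so (h_z/h) dz is a form of type (1,0) up to conjugation of the coordinate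
(`logDz_change`). Integrating by parts against a partition of unity then shows that the divergence
term does not contribute to the Willmore functional.

Two polar transforms with the same metric have the same h²; on some open set h agrees up to sign,
and fullness with uniqueness of parallel sections finishes the argument. For existence, the
curvature of the normal connection is a multiple of ⟨x, κ̄⟩κ - ⟨x, κ⟩κ̄, which vanishes for real κ
(`Canon.dc_nproj_comm`). A flat connection on the range of a projection is integrated locally
(`exists_parallel_of_flat`), local frames are continued over a simply connected surface by lifting
to a covering (`exists_section_of_frames`), and a Witt-type argument with reflections identifies a
fibre of the normal bundle with ℝ^{n-2} of index r (`exists_isometry_perp`). -/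

namespace Polar

/-! ### Calculus of ∂/∂z and ∂/∂z̄ in a coordinate. -/

section Calculus

variable {M : Type*} [TopologicalSpace M]
variable {V : Type*} [NormedAddCommGroup V] [NormedSpace ℂ V]
variable {V' : Type*} [NormedAddCommGroup V'] [NormedSpace ℂ V']
variable {E : Type*} [NormedAddCommGroup E] [NormedSpace ℝ E]
variable {E' : Type*} [NormedAddCommGroup E'] [NormedSpace ℝ E']
variable {φ : OpenPartialHomeomorph M ℂ}

/-- The complex vector field `(∂_u + c ∂_v) / 2` in the coordinate `φ = u + iv`. -/
def dc (c : ℂ) (φ : OpenPartialHomeomorph M ℂ) (F : M → V) (p : M) : V :=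
  (1 / 2 : ℂ) • (fderiv ℝ (F ∘ φ.symm) (φ p) 1 + c • fderiv ℝ (F ∘ φ.symm) (φ p) Complex.I)

/-- `F` is smooth in the coordinate `φ`. -/
def Sm (φ : OpenPartialHomeomorph M ℂ) (F : M → E) : Prop :=
  ContDiffOn ℝ ∞ (F ∘ φ.symm) φ.target

lemma Sm.contDiffAt {F : M → E} (hF : Sm φ F) {p : M} (hp : p ∈ φ.source) :
    ContDiffAt ℝ ∞ (F ∘ φ.symm) (φ p) :=
  ContDiffOn.contDiffAt hF (φ.open_target.mem_nhds (φ.map_source hp))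

lemma Sm.differentiableAt {F : M → E} (hF : Sm φ F) {p : M} (hp : p ∈ φ.source) :
    DifferentiableAt ℝ (F ∘ φ.symm) (φ p) :=
  (hF.contDiffAt hp).differentiableAt (by simp)

lemma Sm.hasFDerivAt {F : M → E} (hF : Sm φ F) {p : M} (hp : p ∈ φ.source) :
    HasFDerivAt (F ∘ φ.symm) (fderiv ℝ (F ∘ φ.symm) (φ p)) (φ p) :=
  (hF.differentiableAt hp).hasFDerivAt

lemma Sm.congr {F G : M → E} (hF : Sm φ F) (h : ∀ p ∈ φ.source, G p = F p) : Sm φ G :=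
  ContDiffOn.congr hF fun _ hw => h _ (φ.map_target hw)

lemma Sm.const (v : E) : Sm φ (fun _ => v) := contDiffOn_const

lemma Sm.add {F G : M → E} (hF : Sm φ F) (hG : Sm φ G) : Sm φ (fun p => F p + G p) :=
  ContDiffOn.add hF hG

lemma Sm.sub {F G : M → E} (hF : Sm φ F) (hG : Sm φ G) : Sm φ (fun p => F p - G p) :=
  ContDiffOn.sub hF hG

lemma Sm.neg {F : M → E} (hF : Sm φ F) : Sm φ (fun p => - F p) :=
  ContDiffOn.neg hF

lemma Sm.clm {F : M → E} (hF : Sm φ F) (L : E →L[ℝ] E') : Sm φ (fun p => L (F p)) :=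
  L.contDiff.comp_contDiffOn hF

lemma Sm.smul {f : M → ℂ} {F : M → V} (hf : Sm φ f) (hF : Sm φ F) : Sm φ (fun p => f p • F p) :=
  ContDiffOn.smul hf hF

lemma Sm.rsmul {f : M → ℝ} {F : M → E} (hf : Sm φ f) (hF : Sm φ F) : Sm φ (fun p => f p • F p) :=
  ContDiffOn.smul hf hF

lemma Sm.mul {f g : M → ℂ} (hf : Sm φ f) (hg : Sm φ g) : Sm φ (fun p => f p * g p) :=
  ContDiffOn.mul hf hg

lemma Sm.rmul {f g : M → ℝ} (hf : Sm φ f) (hg : Sm φ g) : Sm φ (fun p => f p * g p) :=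
  ContDiffOn.mul hf hg

lemma Sm.inv {f : M → ℂ} (hf : Sm φ f) (h0 : ∀ p ∈ φ.source, f p ≠ 0) :
    Sm φ (fun p => (f p)⁻¹) :=
  ContDiffOn.inv hf fun _ hw => h0 _ (φ.map_target hw)

lemma Sm.rinv {f : M → ℝ} (hf : Sm φ f) (h0 : ∀ p ∈ φ.source, f p ≠ 0) :
    Sm φ (fun p => (f p)⁻¹) :=
  ContDiffOn.inv hf fun _ hw => h0 _ (φ.map_target hw)

lemma Sm.div {f g : M → ℂ} (hf : Sm φ f) (hg : Sm φ g) (h0 : ∀ p ∈ φ.source, g p ≠ 0) :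
    Sm φ (fun p => f p / g p) := by
  simpa only [div_eq_mul_inv] using hf.mul (hg.inv h0)

lemma Sm.sum {ι : Type*} (t : Finset ι) {F : ι → M → E} (hF : ∀ i ∈ t, Sm φ (F i)) :
    Sm φ (fun p => ∑ i ∈ t, F i p) :=
  ContDiffOn.sum (f := fun i => F i ∘ φ.symm) hF

lemma Sm.ofReal {f : M → ℝ} (hf : Sm φ f) : Sm φ (fun p => (f p : ℂ)) :=
  hf.clm Complex.ofRealCLM

lemma Sm.re {f : M → ℂ} (hf : Sm φ f) : Sm φ (fun p => (f p).re) :=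
  hf.clm Complex.reCLM

lemma Sm.star {f : M → ℂ} (hf : Sm φ f) : Sm φ (fun p => star (f p)) :=
  hf.clm Complex.conjCLE.toContinuousLinearMap

lemma Sm.pi {ι : Type*} [Fintype ι] {F : M → ι → E} (hF : ∀ i, Sm φ (fun p => F p i)) : Sm φ F :=
  contDiffOn_pi.2 hF

lemma Sm.apply {ι : Type*} [Fintype ι] {F : M → ι → E} (hF : Sm φ F) (i : ι) :
    Sm φ (fun p => F p i) :=
  contDiffOn_pi.1 hF i

lemma Sm.toC {m : ℕ} {F : M → Fin m → ℝ} (hF : Sm φ F) : Sm φ (toC ∘ F) :=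
  Sm.pi fun i => (hF.apply i).ofReal

lemma Sm.starVec {m : ℕ} {F : M → Fin m → ℂ} (hF : Sm φ F) : Sm φ (fun p => Star.star (F p)) :=
  Sm.pi fun i => (hF.apply i).star

lemma Sm.ip {m : ℕ} {F G : M → Fin m → ℂ} (s : ℕ) (hF : Sm φ F) (hG : Sm φ G) :
    Sm φ (fun p => ip s (F p) (G p)) :=
  Sm.sum _ fun i _ => ((Sm.const _).mul (hF.apply i)).mul (hG.apply i)

lemma Sm.rip {m : ℕ} {F G : M → Fin m → ℝ} (s : ℕ) (hF : Sm φ F) (hG : Sm φ G) :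
    Sm φ (fun p => Polar.ip s (F p) (G p)) :=
  Sm.sum _ fun i _ => ((Sm.const _).rmul (hF.apply i)).rmul (hG.apply i)

lemma eventuallyEq_of_source {E : Type*} {F G : M → E} (h : ∀ q ∈ φ.source, F q = G q) {p : M}
    (hp : p ∈ φ.source) : F ∘ φ.symm =ᶠ[nhds (φ p)] G ∘ φ.symm :=
  Filter.eventuallyEq_of_mem (φ.open_target.mem_nhds (φ.map_source hp))
    fun _ hw => h _ (φ.map_target hw)

lemma fderiv_congr_source {F G : M → E} (h : ∀ q ∈ φ.source, F q = G q) {p : M}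
    (hp : p ∈ φ.source) :
    fderiv ℝ (F ∘ φ.symm) (φ p) = fderiv ℝ (G ∘ φ.symm) (φ p) :=
  (eventuallyEq_of_source h hp).fderiv_eq

/-- Both complex derivatives are instances of one operator `dc c`, with c = -i and c = i, so that
each rule of calculus is proved once and conjugation acts on the parameter c. -/
lemma dz_eq_dc [ChartedSpace ℂ M] (F : M → V) : dz φ F = dc (-Complex.I) φ F := by
  funext p; simp only [dz, dc, neg_smul, sub_eq_add_neg]

lemma dzb_eq_dc [ChartedSpace ℂ M] (F : M → V) : dzb φ F = dc Complex.I φ F := rfl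

lemma dc_congr {F G : M → V} (c : ℂ) (h : ∀ q ∈ φ.source, F q = G q) {p : M}
    (hp : p ∈ φ.source) : dc c φ F p = dc c φ G p := by
  simp only [dc, fderiv_congr_source h hp]

lemma Sm.dc {F : M → V} (hF : Sm φ F) (c : ℂ) : Sm φ (dc c φ F) := by
  have h1 : ∀ v : ℂ, ContDiffOn ℝ ∞ (fun w => fderiv ℝ (F ∘ φ.symm) w v) φ.target := fun v =>
    (hF.fderiv_of_isOpen φ.open_target (m := ∞) (by simp)).clm_apply contDiffOn_const
  have h2 : ContDiffOn ℝ ∞ (fun w => (1 / 2 : ℂ) • (fderiv ℝ (F ∘ φ.symm) w 1 +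
      c • fderiv ℝ (F ∘ φ.symm) w Complex.I)) φ.target :=
    contDiffOn_const.smul ((h1 1).add (contDiffOn_const.smul (h1 Complex.I)))
  refine h2.congr fun w hw => ?_
  simp only [Function.comp_apply, Polar.dc, φ.right_inv hw]

lemma dc_const (c : ℂ) (v : V) (p : M) : dc c φ (fun _ => v) p = 0 := by
  have : ((fun _ => v) : M → V) ∘ φ.symm = fun _ => v := rfl
  simp [dc, this]

lemma dc_clm {F : M → V} (c : ℂ) (hF : Sm φ F) (L : V →L[ℂ] V') {p : M} (hp : p ∈ φ.source) :
    dc c φ (fun q => L (F q)) p = L (dc c φ F p) := by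
  have h := ((L.restrictScalars ℝ).hasFDerivAt.comp (φ p) (hF.hasFDerivAt hp)).fderiv
  have e : (fun q => L (F q)) ∘ φ.symm = (L.restrictScalars ℝ) ∘ (F ∘ φ.symm) := rfl
  simp only [dc, e, h]
  simp

lemma dc_add {F G : M → V} (c : ℂ) (hF : Sm φ F) (hG : Sm φ G) {p : M} (hp : p ∈ φ.source) :
    dc c φ (fun q => F q + G q) p = dc c φ F p + dc c φ G p := by
  have h := ((hF.hasFDerivAt hp).add (hG.hasFDerivAt hp)).fderiv
  have e : (fun q => F q + G q) ∘ φ.symm = F ∘ φ.symm + G ∘ φ.symm := rfl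
  simp only [dc, e, h, add_apply, smul_add]
  abel

lemma dc_smul {f : M → ℂ} {F : M → V} (c : ℂ) (hf : Sm φ f) (hF : Sm φ F) {p : M}
    (hp : p ∈ φ.source) :
    dc c φ (fun q => f q • F q) p = dc c φ f p • F p + f p • dc c φ F p := by
  have h := ((hf.hasFDerivAt hp).smul (hF.hasFDerivAt hp)).fderiv
  have e : (fun q => f q • F q) ∘ φ.symm = (f ∘ φ.symm) • (F ∘ φ.symm) := rfl
  simp only [dc, e, h]
  simp only [add_apply, smul_apply, ContinuousLinearMap.smulRight_apply, Function.comp_apply,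
    φ.left_inv hp, smul_add, smul_smul, smul_eq_mul]
  module

lemma dc_mul {f g : M → ℂ} (c : ℂ) (hf : Sm φ f) (hg : Sm φ g) {p : M} (hp : p ∈ φ.source) :
    dc c φ (fun q => f q * g q) p = dc c φ f p * g p + f p * dc c φ g p :=
  dc_smul c hf hg hp

lemma dc_const_smul {F : M → V} (c a : ℂ) (hF : Sm φ F) {p : M} (hp : p ∈ φ.source) :
    dc c φ (fun q => a • F q) p = a • dc c φ F p := by
  rw [dc_smul c (Sm.const a) hF hp, dc_const, zero_smul, zero_add]

lemma dc_const_mul {f : M → ℂ} (c a : ℂ) (hf : Sm φ f) {p : M} (hp : p ∈ φ.source) :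
    dc c φ (fun q => a * f q) p = a * dc c φ f p :=
  dc_const_smul c a hf hp

lemma dc_neg {F : M → V} (c : ℂ) (hF : Sm φ F) {p : M} (hp : p ∈ φ.source) :
    dc c φ (fun q => - F q) p = - dc c φ F p := by
  simpa using dc_const_smul c (-1) hF hp

lemma dc_sub {F G : M → V} (c : ℂ) (hF : Sm φ F) (hG : Sm φ G) {p : M} (hp : p ∈ φ.source) :
    dc c φ (fun q => F q - G q) p = dc c φ F p - dc c φ G p := by
  simp only [sub_eq_add_neg]
  rw [dc_add c hF hG.neg hp, dc_neg c hG hp]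

lemma dc_sum {ι : Type*} (c : ℂ) (t : Finset ι) {F : ι → M → V} (hF : ∀ i ∈ t, Sm φ (F i)) {p : M}
    (hp : p ∈ φ.source) :
    dc c φ (fun q => ∑ i ∈ t, F i q) p = ∑ i ∈ t, dc c φ (F i) p := by
  have h := (HasFDerivAt.sum fun i hi => (hF i hi).hasFDerivAt hp).fderiv
  have e : (fun q => ∑ i ∈ t, F i q) ∘ φ.symm = ∑ i ∈ t, F i ∘ φ.symm := by
    funext w; simp
  simp only [dc, e, h]
  simp only [sum_apply, Finset.smul_sum, smul_add, Finset.sum_add_distrib]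

lemma dc_inv {f : M → ℂ} (c : ℂ) (hf : Sm φ f) (h0 : ∀ q ∈ φ.source, f q ≠ 0) {p : M}
    (hp : p ∈ φ.source) :
    dc c φ (fun q => (f q)⁻¹) p = - dc c φ f p / f p ^ 2 := by
  have h1 : dc c φ (fun q => f q * (f q)⁻¹) p = 0 := by
    rw [dc_congr c (G := fun _ => 1) (fun q hq => mul_inv_cancel₀ (h0 q hq)) hp, dc_const]
  rw [dc_mul c hf (hf.inv h0) hp] at h1
  have := h0 p hp
  field_simp at h1 ⊢
  linear_combination h1

lemma dc_div {f g : M → ℂ} (c : ℂ) (hf : Sm φ f) (hg : Sm φ g) (h0 : ∀ q ∈ φ.source, g q ≠ 0)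
    {p : M} (hp : p ∈ φ.source) :
    dc c φ (fun q => f q / g q) p = (dc c φ f p * g p - f p * dc c φ g p) / g p ^ 2 := by
  simp only [div_eq_mul_inv]
  rw [dc_mul c hf (hg.inv h0) hp, dc_inv c hg h0 hp]
  have := h0 p hp
  field_simp
  ring

lemma dc_apply {m : ℕ} {F : M → Fin m → ℂ} (c : ℂ) (hF : Sm φ F) {p : M} (hp : p ∈ φ.source)
    (i : Fin m) : dc c φ F p i = dc c φ (fun q => F q i) p :=
  (dc_clm c hF (ContinuousLinearMap.proj (R := ℂ) (φ := fun _ : Fin m => ℂ) i) hp).symm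

lemma dc_ip {m : ℕ} {F G : M → Fin m → ℂ} (s : ℕ) (c : ℂ) (hF : Sm φ F) (hG : Sm φ G) {p : M}
    (hp : p ∈ φ.source) :
    dc c φ (fun q => ip s (F q) (G q)) p = ip s (dc c φ F p) (G p) + ip s (F p) (dc c φ G p) := by
  simp only [ip]
  rw [dc_sum c _ (fun i _ => ((Sm.const _).mul (hF.apply i)).mul (hG.apply i)) hp,
    ← Finset.sum_add_distrib]
  refine Finset.sum_congr rfl fun i _ => ?_
  rw [dc_mul c ((Sm.const _).mul (hF.apply i)) (hG.apply i) hp, dc_const_mul c _ (hF.apply i) hp,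
    dc_apply c hF hp, dc_apply c hG hp]

lemma fderiv_dc {F : M → V} (c : ℂ) (hF : Sm φ F) {p : M} (hp : p ∈ φ.source) (v : ℂ) :
    fderiv ℝ (dc c φ F ∘ φ.symm) (φ p) v =
      (1 / 2 : ℂ) • (fderiv ℝ (fderiv ℝ (F ∘ φ.symm)) (φ p) v 1 +
        c • fderiv ℝ (fderiv ℝ (F ∘ φ.symm)) (φ p) v Complex.I) := by
  have h0 : DifferentiableAt ℝ (fderiv ℝ (F ∘ φ.symm)) (φ p) :=
    ((hF.contDiffAt hp).fderiv_right (m := ∞) (by simp)).differentiableAt (by simp)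
  have h1 : ∀ u : ℂ, HasFDerivAt (fun w => fderiv ℝ (F ∘ φ.symm) w u)
      ((fderiv ℝ (fderiv ℝ (F ∘ φ.symm)) (φ p)).flip u) (φ p) := fun u => by
    simpa using h0.hasFDerivAt.clm_apply (hasFDerivAt_const u (φ p))
  have h2 := ((h1 1).add ((h1 Complex.I).const_smul c)).const_smul (1 / 2 : ℂ)
  have e : dc c φ F ∘ φ.symm =ᶠ[nhds (φ p)] (1 / 2 : ℂ) • ((fun w => fderiv ℝ (F ∘ φ.symm) w 1) +
      c • fun w => fderiv ℝ (F ∘ φ.symm) w Complex.I) := by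
    filter_upwards [φ.open_target.mem_nhds (φ.map_source hp)] with w hw
    simp [dc, φ.right_inv hw]
  rw [e.fderiv_eq, h2.fderiv]
  simp

/-- Both sides expand into second derivatives in the directions 1 and i; only the mixed ones differ,
and those agree by symmetry. -/
lemma dc_comm {F : M → V} (c d : ℂ) (hF : Sm φ F) {p : M} (hp : p ∈ φ.source) :
    dc c φ (dc d φ F) p = dc d φ (dc c φ F) p := by
  have hs : IsSymmSndFDerivAt ℝ (F ∘ φ.symm) (φ p) :=
    (hF.contDiffAt hp).isSymmSndFDerivAt (by
      rw [minSmoothness_of_isRCLikeNormedField]; exact WithTop.coe_le_coe.2 le_top)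
  have h := hs.eq 1 Complex.I
  rw [dc, dc, fderiv_dc d hF hp, fderiv_dc d hF hp, fderiv_dc c hF hp, fderiv_dc c hF hp, h]
  simp only [smul_add, smul_smul]
  module

lemma dc_star {f : M → ℂ} (c : ℂ) (hf : Sm φ f) {p : M} (hp : p ∈ φ.source) :
    dc c φ (fun q => star (f q)) p = star (dc (star c) φ f p) := by
  have h := (Complex.conjCLE.toContinuousLinearMap.hasFDerivAt.comp (φ p)
    (hf.hasFDerivAt hp)).fderiv
  have e : (fun q => star (f q)) ∘ φ.symm =
    Complex.conjCLE.toContinuousLinearMap ∘ (f ∘ φ.symm) := rfl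
  simp only [dc, e, h]
  simp

lemma dc_starVec {m : ℕ} {F : M → Fin m → ℂ} (c : ℂ) (hF : Sm φ F) {p : M} (hp : p ∈ φ.source) :
    dc c φ (fun q => star (F q)) p = star (dc (star c) φ F p) := by
  funext i
  rw [dc_apply c hF.starVec hp, Pi.star_apply, dc_apply _ hF hp]
  exact dc_star c (hF.apply i) hp

/-- The way back from complex derivatives to the real differential, dF = F_z dz + F_z̄ dz̄. It
serves immersions, induced metrics, local constancy and Jacobians. -/
lemma fderiv_eq_dc {F : M → V} (p : M) (v : ℂ) :
    fderiv ℝ (F ∘ φ.symm) (φ p) v =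
      v • dc (-Complex.I) φ F p + star v • dc Complex.I φ F p := by
  have hv : v = v.re • (1 : ℂ) + v.im • Complex.I := by
    apply Complex.ext <;> simp
  conv_lhs => rw [hv, map_add, map_smul, map_smul]
  have h1 : (v.re : ℂ) = (v + star v) / 2 := by
    rw [Complex.star_def, Complex.re_eq_add_conj]
  have h2 : (v.im : ℂ) = (v - star v) / (2 * Complex.I) := by
    rw [Complex.star_def, Complex.im_eq_sub_conj]
  have h3 : (v - star v) / (2 * Complex.I) = - (Complex.I * (v - star v) / 2) := by
    field_simp
    rw [Complex.I_sq]; ring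
  rw [← Complex.coe_smul (v.re), ← Complex.coe_smul (v.im), h1, h2, h3]
  simp only [dc]
  module

end Calculus

section

/-! ### The bilinear form -/

section Form

variable {K : Type*} [CommRing K] {m : ℕ} (s : ℕ)

lemma ip_comm (x y : Fin m → K) : ip s x y = ip s y x :=
  Finset.sum_congr rfl fun i _ => by ring

lemma ip_add_left (x x' y : Fin m → K) : ip s (x + x') y = ip s x y + ip s x' y := by
  simp only [ip, ← Finset.sum_add_distrib, Pi.add_apply]
  exact Finset.sum_congr rfl fun i _ => by ring

lemma ip_smul_left (a : K) (x y : Fin m → K) : ip s (a • x) y = a * ip s x y := by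
  simp only [ip, Finset.mul_sum, Pi.smul_apply, smul_eq_mul]
  exact Finset.sum_congr rfl fun i _ => by ring

lemma ip_neg_left (x y : Fin m → K) : ip s (-x) y = - ip s x y := by
  simpa using ip_smul_left s (-1) x y

lemma ip_sub_left (x x' y : Fin m → K) : ip s (x - x') y = ip s x y - ip s x' y := by
  rw [sub_eq_add_neg, ip_add_left, ip_neg_left, sub_eq_add_neg]

lemma ip_zero_left (y : Fin m → K) : ip s 0 y = 0 := by
  simpa using ip_smul_left s 0 0 y

lemma ip_add_right (x y y' : Fin m → K) : ip s x (y + y') = ip s x y + ip s x y' := by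
  simp only [ip_comm s x, ip_add_left]

lemma ip_smul_right (a : K) (x y : Fin m → K) : ip s x (a • y) = a * ip s x y := by
  simp only [ip_comm s x, ip_smul_left]

lemma ip_neg_right (x y : Fin m → K) : ip s x (-y) = - ip s x y := by
  simp only [ip_comm s x, ip_neg_left]

lemma ip_sub_right (x y y' : Fin m → K) : ip s x (y - y') = ip s x y - ip s x y' := by
  simp only [ip_comm s x, ip_sub_left]

lemma ip_zero_right (x : Fin m → K) : ip s x 0 = 0 := by
  rw [ip_comm, ip_zero_left]

lemma ip_nondegenerate (x : Fin m → K) (h : ∀ y, ip s x y = 0) : x = 0 := by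
  funext i
  have := h (Pi.single i 1)
  rw [ip, Finset.sum_eq_single i (fun j _ hj => by simp [hj]) (by simp)] at this
  split_ifs at this <;> simpa using this

lemma ip_toC (x y : Fin m → ℝ) : ip s (toC x) (toC y) = ((ip s x y : ℝ) : ℂ) := by
  simp only [ip, toC, Complex.ofReal_sum]
  refine Finset.sum_congr rfl fun i _ => ?_
  split_ifs <;> simp

lemma star_ip (x y : Fin m → ℂ) : star (ip s x y) = ip s (star x) (star y) := by
  simp only [ip, star_sum]
  refine Finset.sum_congr rfl fun i _ => ?_
  split_ifs <;> simp

lemma star_toC (x : Fin m → ℝ) : star (toC x) = toC x := by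
  funext i; simp [toC]

lemma toC_injective : Function.Injective (toC : (Fin m → ℝ) → _) := fun x y h => by
  funext i; exact Complex.ofReal_injective (congrFun h i)

lemma toC_zero : toC (0 : Fin m → ℝ) = 0 := by
  funext i; simp [toC]

lemma toC_add (x y : Fin m → ℝ) : toC (x + y) = toC x + toC y := by
  funext i; simp [toC]

lemma toC_smul (a : ℝ) (x : Fin m → ℝ) : toC (a • x) = (a : ℂ) • toC x := by
  funext i; simp [toC]

lemma toC_sub (x y : Fin m → ℝ) : toC (x - y) = toC x - toC y := by
  funext i; simp [toC]

/-- `toC` as a continuous real linear map. -/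
def toCL : (Fin m → ℝ) →L[ℝ] (Fin m → ℂ) :=
  ContinuousLinearMap.pi fun i => Complex.ofRealCLM ∘L ContinuousLinearMap.proj i

lemma eq_toC_of_star {x : Fin m → ℂ} (h : star x = x) : x = toC fun i => (x i).re := by
  funext i
  exact (Complex.conj_eq_iff_re.1 (congrFun h i)).symm

lemma star_eq_iff_im (x : Fin m → ℂ) : star x = x ↔ ∀ i, (x i).im = 0 := by
  rw [funext_iff]
  exact forall_congr' fun i => Complex.conj_eq_iff_im

end Form

/-! ### Orthogonal projections along tangent spaces. -/

section Normal

variable {m : ℕ} (s : ℕ)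

/-- The form is nondegenerate on `T`. -/
def NondegOn (T : Submodule ℂ (Fin m → ℂ)) : Prop := ∀ x ∈ T, x ∈ perp s T → x = 0

variable {s}

lemma perp_sub {T : Submodule ℂ (Fin m → ℂ)} {x y : Fin m → ℂ} (hx : x ∈ perp s T)
    (hy : y ∈ perp s T) : x - y ∈ perp s T := fun v hv => by
  rw [ip_sub_left, hx v hv, hy v hv, sub_zero]

/-- Nondegeneracy makes the vector chosen in `normalPart` unique, so any explicit candidate computes
it. -/
lemma normalPart_eq {T : Submodule ℂ (Fin m → ℂ)} (hT : NondegOn s T) {v w : Fin m → ℂ}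
    (h1 : w ∈ perp s T) (h2 : v - w ∈ T) : normalPart s T v = w := by
  have h : ∃ w, w ∈ perp s T ∧ v - w ∈ T := ⟨w, h1, h2⟩
  rw [normalPart, dif_pos h]
  have h3 := h.choose_spec
  refine sub_eq_zero.1 (hT _ ?_ (perp_sub h3.1 h1))
  have := T.sub_mem h2 h3.2
  simpa using this

lemma mem_perp_span {S : Set (Fin m → ℂ)} {w : Fin m → ℂ} :
    w ∈ perp s (Submodule.span ℂ S) ↔ ∀ v ∈ S, ip s w v = 0 := by
  refine ⟨fun h v hv => h v (Submodule.subset_span hv), fun h v hv => ?_⟩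
  induction hv using Submodule.span_induction with
  | mem x hx => exact h x hx
  | zero => exact ip_zero_right s w
  | add x y _ _ hx hy => rw [ip_add_right, hx, hy, add_zero]
  | smul a x _ hx => rw [ip_smul_right, hx, mul_zero]

/-- The Gram matrix of `Y, Y_z, Y_z̄, Y_{z z̄}` for a canonical lift. -/
structure Gram (s : ℕ) (Y A B W : Fin m → ℂ) : Prop where
  YY : ip s Y Y = 0
  YA : ip s Y A = 0
  YB : ip s Y B = 0
  YW : ip s Y W = -1 / 2
  AA : ip s A A = 0
  BB : ip s B B = 0
  AB : ip s A B = 1 / 2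
  AW : ip s A W = 0
  BW : ip s B W = 0

/-- The projection along the span of `Y, A, B, W`. -/
def npart (s : ℕ) (Y A B W x : Fin m → ℂ) : Fin m → ℂ :=
  x - (2 * ip s x B) • A - (2 * ip s x A) • B + (2 * ip s x W) • Y + (2 * ip s x Y) • W +
    (4 * ip s W W * ip s x Y) • Y

variable {Y A B W : Fin m → ℂ}

lemma mem_perp_four {w : Fin m → ℂ} : w ∈ perp s (Submodule.span ℂ {Y, A, B, W}) ↔
    ip s w Y = 0 ∧ ip s w A = 0 ∧ ip s w B = 0 ∧ ip s w W = 0 := by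
  rw [mem_perp_span]
  simp

lemma mem_span_four {x : Fin m → ℂ} : x ∈ Submodule.span ℂ {Y, A, B, W} ↔
    ∃ a b c d : ℂ, x = a • Y + b • A + c • B + d • W := by
  constructor
  · intro h
    obtain ⟨a, x1, h1, rfl⟩ := Submodule.mem_span_insert.1 h
    obtain ⟨b, x2, h2, rfl⟩ := Submodule.mem_span_insert.1 h1
    obtain ⟨c, x3, h3, rfl⟩ := Submodule.mem_span_insert.1 h2
    obtain ⟨d, rfl⟩ := Submodule.mem_span_singleton.1 h3
    exact ⟨a, b, c, d, by abel⟩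
  · rintro ⟨a, b, c, d, rfl⟩
    have h : ∀ v ∈ ({Y, A, B, W} : Set (Fin m → ℂ)), ∀ a : ℂ,
        a • v ∈ Submodule.span ℂ {Y, A, B, W} := fun v hv a =>
      Submodule.smul_mem _ _ (Submodule.subset_span hv)
    exact add_mem (add_mem (add_mem (h Y (by simp) a) (h A (by simp) b)) (h B (by simp) c))
      (h W (by simp) d)

/-- The Gram matrix is triangular after reordering: pairing with Y, A, B isolates the coefficients
of W, B, A, and then pairing with W isolates that of Y. -/
lemma Gram.nondeg (h : Gram s Y A B W) : NondegOn s (Submodule.span ℂ {Y, A, B, W}) := by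
  intro x hx hp
  obtain ⟨a, b, c, d, rfl⟩ := mem_span_four.1 hx
  obtain ⟨h1, h2, h3, h4⟩ := mem_perp_four.1 hp
  simp only [ip_add_left, ip_smul_left, h.YY, h.YA, h.YB, h.YW, h.AA, h.BB, h.AB, h.AW, h.BW,
    ip_comm s A Y, ip_comm s B Y, ip_comm s W Y, ip_comm s B A, ip_comm s W A, ip_comm s W B]
    at h1 h2 h3 h4
  have hd : d = 0 := by linear_combination (-2) * h1
  have hc : c = 0 := by linear_combination 2 * h2
  have hb : b = 0 := by linear_combination 2 * h3
  have ha : a = 0 := by rw [hd] at h4; linear_combination (-2) * h4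
  simp [ha, hb, hc, hd]

/-- Nothing is assumed about ⟨W, W⟩; the last term of `npart` compensates for W not being null. -/
lemma Gram.npart_mem_perp (h : Gram s Y A B W) (x : Fin m → ℂ) :
    npart s Y A B W x ∈ perp s (Submodule.span ℂ {Y, A, B, W}) := by
  rw [mem_perp_four]
  simp only [npart, ip_add_left, ip_sub_left, ip_smul_left, h.YY, h.YA, h.YB, h.YW, h.AA, h.BB,
    h.AB, h.AW, h.BW, ip_comm s A Y, ip_comm s B Y, ip_comm s W Y, ip_comm s B A, ip_comm s W A,
    ip_comm s W B]
  refine ⟨?_, ?_, ?_, ?_⟩ <;> ring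

lemma sub_npart_mem (x : Fin m → ℂ) :
    x - npart s Y A B W x ∈ Submodule.span ℂ {Y, A, B, W} := by
  refine mem_span_four.2 ⟨-(2 * ip s x W) - (4 * ip s W W * ip s x Y), 2 * ip s x B, 2 * ip s x A,
    -(2 * ip s x Y), ?_⟩
  rw [npart]
  module

lemma Gram.normalPart_eq (h : Gram s Y A B W) (x : Fin m → ℂ) :
    normalPart s (Submodule.span ℂ {Y, A, B, W}) x = npart s Y A B W x :=
  Polar.normalPart_eq h.nondeg (h.npart_mem_perp x) (sub_npart_mem x)

lemma npart_of_mem_perp {x : Fin m → ℂ} (hx : x ∈ perp s (Submodule.span ℂ {Y, A, B, W})) :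
    npart s Y A B W x = x := by
  obtain ⟨h1, h2, h3, h4⟩ := mem_perp_four.1 hx
  simp [npart, h1, h2, h3, h4]

/-- The projection along the span of `P, Pb, f`. -/
def tpart (s : ℕ) (c : ℂ) (P Pb f x : Fin m → ℂ) : Fin m → ℂ :=
  x - (ip s x Pb / ip s P Pb) • P - (ip s x P / ip s P Pb) • Pb - (ip s x f / c) • f

/-- One formula covers both cases: for c = 0 the quotient by c in `tpart` is 0 by convention, so the
f-term disappears just as f disappears from the spanning set. -/
lemma normalPart_tangent {c : ℝ} {P Pb f : Fin m → ℂ} (hP : ip s P P = 0) (hPb : ip s Pb Pb = 0)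
    (hg : ip s P Pb ≠ 0) (hPf : ip s f P = 0) (hPbf : ip s f Pb = 0) (hf : ip s f f = c)
    (x : Fin m → ℂ) :
    normalPart s (Submodule.span ℂ ({P, Pb} ∪ {v | c ≠ 0 ∧ v = f})) x = tpart s c P Pb f x := by
  have hperp : ∀ {w : Fin m → ℂ}, w ∈ perp s (Submodule.span ℂ ({P, Pb} ∪ {v | c ≠ 0 ∧ v = f})) ↔
      ip s w P = 0 ∧ ip s w Pb = 0 ∧ (c ≠ 0 → ip s w f = 0) := by
    intro w
    rw [mem_perp_span]
    simp only [mem_union, mem_insert_iff, mem_singleton_iff, mem_ofPred_eq]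
    constructor
    · intro h
      exact ⟨h _ (by simp), h _ (by simp), fun hc => h _ (by simp [hc])⟩
    · rintro ⟨h1, h2, h3⟩ v ((rfl | rfl) | ⟨hc, rfl⟩)
      exacts [h1, h2, h3 hc]
  have hmem : ∀ v ∈ ({P, Pb} ∪ {v | c ≠ 0 ∧ v = f} : Set (Fin m → ℂ)), ∀ a : ℂ,
      a • v ∈ Submodule.span ℂ ({P, Pb} ∪ {v | c ≠ 0 ∧ v = f} : Set (Fin m → ℂ)) := fun v hv a =>
    Submodule.smul_mem _ _ (Submodule.subset_span hv)
  refine Polar.normalPart_eq ?_ ?_ ?_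
  · intro x hx hp
    have hx' : ∃ a b d : ℂ, (c = 0 → d = 0) ∧ x = a • P + b • Pb + d • f := by
      rw [Submodule.span_union, Submodule.mem_sup] at hx
      obtain ⟨x1, h1, x2, h2, rfl⟩ := hx
      obtain ⟨a, b, rfl⟩ := Submodule.mem_span_pair.1 h1
      by_cases hc : c = 0
      · refine ⟨a, b, 0, fun _ => rfl, ?_⟩
        simpa [hc] using h2
      · have : {v | c ≠ 0 ∧ v = f} = {f} := by ext; simp [hc]
        rw [this] at h2
        obtain ⟨d, rfl⟩ := Submodule.mem_span_singleton.1 h2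
        exact ⟨a, b, d, fun h => absurd h hc, rfl⟩
    obtain ⟨a, b, d, hd, rfl⟩ := hx'
    obtain ⟨h1, h2, h3⟩ := hperp.1 hp
    simp only [ip_add_left, ip_smul_left, hP, hPb, hPf, hPbf, hf, ip_comm s Pb P, ip_comm s P f,
      ip_comm s Pb f, mul_zero, add_zero, zero_add] at h1 h2 h3
    have hb : b = 0 := (mul_eq_zero.1 h1).resolve_right hg
    have ha : a = 0 := (mul_eq_zero.1 h2).resolve_right hg
    have hd' : d = 0 := by
      by_cases hc : c = 0
      · exact hd hc
      · exact (mul_eq_zero.1 (h3 hc)).resolve_right (by exact_mod_cast hc)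
    simp [ha, hb, hd']
  · rw [hperp]
    simp only [tpart, ip_sub_left, ip_smul_left, hP, hPb, hPf, hPbf, hf, ip_comm s Pb P,
      ip_comm s P f, ip_comm s Pb f, mul_zero, sub_zero]
    refine ⟨by field_simp; ring, by field_simp; ring, fun hc => ?_⟩
    have : (c : ℂ) ≠ 0 := by exact_mod_cast hc
    field_simp
    ring
  · have : x - tpart s c P Pb f x = (ip s x Pb / ip s P Pb) • P + (ip s x P / ip s P Pb) • Pb +
        (ip s x f / c) • f := by
      rw [tpart]; module
    rw [this]
    refine add_mem (add_mem (hmem _ (by simp) _) (hmem _ (by simp) _)) ?_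
    by_cases hc : c = 0
    · simp [hc]
    · exact hmem _ (by simp [hc]) _

end Normal

/-! ### Relations satisfied by a canonical lift. -/

section CanonicalLift

local notation "∂z" => dc (-Complex.I)
local notation "∂b" => dc Complex.I

variable {M : Type*} [TopologicalSpace M] {m : ℕ} {s : ℕ} {φ : OpenPartialHomeomorph M ℂ}

lemma ip_dc_eq_neg {F G : M → Fin m → ℂ} {k : ℂ} (c : ℂ) (hF : Sm φ F) (hG : Sm φ G)
    (h : ∀ q ∈ φ.source, ip s (F q) (G q) = k) {p : M} (hp : p ∈ φ.source) :
    ip s (dc c φ F p) (G p) = - ip s (F p) (dc c φ G p) := by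
  have := dc_ip s c hF hG hp
  rw [dc_congr c h hp, dc_const] at this
  linear_combination -this

lemma ip_dc_self {F : M → Fin m → ℂ} {k : ℂ} (c : ℂ) (hF : Sm φ F)
    (h : ∀ q ∈ φ.source, ip s (F q) (F q) = k) {p : M} (hp : p ∈ φ.source) :
    ip s (F p) (dc c φ F p) = 0 := by
  have := ip_dc_eq_neg c hF hF h hp
  rw [ip_comm] at this
  linear_combination (1 / 2 : ℂ) * this

/-- A real null lift with `|dX|² = |dz|²`. -/
structure Canon (s : ℕ) (φ : OpenPartialHomeomorph M ℂ) (X : M → Fin m → ℂ) : Prop where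
  sm : Sm φ X
  real : ∀ p ∈ φ.source, star (X p) = X p
  null : ∀ p ∈ φ.source, ip s (X p) (X p) = 0
  conf : ∀ p ∈ φ.source, ip s (∂z φ X p) (∂z φ X p) = 0
  unit : ∀ p ∈ φ.source, ip s (∂z φ X p) (∂b φ X p) = 1 / 2

lemma star_dc_of_real {X : M → Fin m → ℂ} (hX : Sm φ X) (h : ∀ p ∈ φ.source, star (X p) = X p)
    (c : ℂ) {p : M} (hp : p ∈ φ.source) : star (dc c φ X p) = dc (star c) φ X p := by
  have := dc_starVec (star c) hX hp
  rw [dc_congr _ h hp, star_star] at this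
  exact this.symm

lemma star_dc_of_real_fun {f : M → ℂ} (hf : Sm φ f) (h : ∀ p ∈ φ.source, star (f p) = f p)
    (c : ℂ) {p : M} (hp : p ∈ φ.source) : star (dc c φ f p) = dc (star c) φ f p := by
  have := dc_star (star c) hf hp
  rw [dc_congr _ h hp, star_star] at this
  exact this.symm

lemma star_dc_dc {X : M → Fin m → ℂ} (hX : Sm φ X) (h : ∀ p ∈ φ.source, star (X p) = X p)
    (c d : ℂ) {p : M} (hp : p ∈ φ.source) :
    star (dc c φ (dc d φ X) p) = dc (star c) φ (dc (star d) φ X) p := by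
  have := dc_starVec (star c) (hX.dc d) hp
  rw [star_star] at this
  rw [← this]
  exact dc_congr _ (fun q hq => star_dc_of_real hX h d hq) hp

lemma star_dc_dc_fun {f : M → ℂ} (hf : Sm φ f) (h : ∀ p ∈ φ.source, star (f p) = f p)
    (c d : ℂ) {p : M} (hp : p ∈ φ.source) :
    star (dc c φ (dc d φ f) p) = dc (star c) φ (dc (star d) φ f) p := by
  have := dc_star (star c) (hf.dc d) hp
  rw [star_star] at this
  rw [← this]
  exact dc_congr _ (fun q hq => star_dc_of_real_fun hf h d hq) hp

lemma star_I : star Complex.I = -Complex.I := Complex.conj_I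

lemma star_neg_I : star (-Complex.I) = Complex.I := by
  rw [star_neg, star_I, neg_neg]

namespace Canon

variable {X : M → Fin m → ℂ} (h : Canon s φ X)
include h

lemma star_dz {p : M} (hp : p ∈ φ.source) : star (∂z φ X p) = ∂b φ X p := by
  rw [star_dc_of_real h.sm h.real _ hp, star_neg_I]

lemma star_dzb {p : M} (hp : p ∈ φ.source) : star (∂b φ X p) = ∂z φ X p := by
  rw [← h.star_dz hp, star_star]

lemma star_W {p : M} (hp : p ∈ φ.source) : star (∂b φ (∂z φ X) p) = ∂b φ (∂z φ X) p := by
  rw [star_dc_dc h.sm h.real _ _ hp, star_neg_I, star_I, dc_comm _ _ h.sm hp]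

lemma star_dzz {p : M} (hp : p ∈ φ.source) : star (∂z φ (∂z φ X) p) = ∂b φ (∂b φ X) p := by
  rw [star_dc_dc h.sm h.real _ _ hp, star_neg_I]

lemma conf' {p : M} (hp : p ∈ φ.source) : ip s (∂b φ X p) (∂b φ X p) = 0 := by
  rw [← h.star_dz hp, ← star_ip, h.conf p hp, star_zero]

lemma X_dc (c : ℂ) {p : M} (hp : p ∈ φ.source) : ip s (X p) (dc c φ X p) = 0 :=
  ip_dc_self c h.sm h.null hp

lemma X_dzz {p : M} (hp : p ∈ φ.source) : ip s (X p) (∂z φ (∂z φ X) p) = 0 := by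
  have := ip_dc_eq_neg (-Complex.I) h.sm (h.sm.dc (-Complex.I)) (fun q hq => h.X_dc _ hq) hp
  rw [h.conf p hp] at this
  linear_combination this

lemma X_W {p : M} (hp : p ∈ φ.source) : ip s (X p) (∂b φ (∂z φ X) p) = -1 / 2 := by
  have := ip_dc_eq_neg Complex.I h.sm (h.sm.dc (-Complex.I)) (fun q hq => h.X_dc _ hq) hp
  rw [ip_comm, h.unit p hp] at this
  linear_combination this

lemma A_W {p : M} (hp : p ∈ φ.source) : ip s (∂z φ X p) (∂b φ (∂z φ X) p) = 0 :=
  ip_dc_self _ (h.sm.dc _) h.conf hp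

lemma A_dzz {p : M} (hp : p ∈ φ.source) : ip s (∂z φ X p) (∂z φ (∂z φ X) p) = 0 :=
  ip_dc_self _ (h.sm.dc _) h.conf hp

lemma B_W {p : M} (hp : p ∈ φ.source) : ip s (∂b φ X p) (∂b φ (∂z φ X) p) = 0 := by
  rw [dc_comm _ _ h.sm hp]
  exact ip_dc_self _ (h.sm.dc _) (fun q hq => h.conf' hq) hp

lemma B_dzz {p : M} (hp : p ∈ φ.source) : ip s (∂b φ X p) (∂z φ (∂z φ X) p) = 0 := by
  have := ip_dc_eq_neg (-Complex.I) (h.sm.dc (-Complex.I)) (h.sm.dc Complex.I) h.unit hp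
  rw [dc_comm (-Complex.I) Complex.I h.sm hp, h.A_W hp] at this
  rw [ip_comm, this, neg_zero]

/-- All entries follow by differentiating the three defining relations of `Canon` and conjugating.
-/
lemma gram {p : M} (hp : p ∈ φ.source) :
    Gram s (X p) (∂z φ X p) (∂b φ X p) (∂b φ (∂z φ X) p) where
  YY := h.null p hp
  YA := h.X_dc _ hp
  YB := h.X_dc _ hp
  YW := h.X_W hp
  AA := h.conf p hp
  BB := h.conf' hp
  AB := h.unit p hp
  AW := h.A_W hp
  BW := h.B_W hp

/-- Differentiate ⟨X_z̄, X_zz⟩ = 0 in z̄ and ⟨X_z̄, X_zz̄⟩ = 0 in z; the pairings of X_z̄ with the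
third derivative X_zzz̄ coincide. This is what later removes the Hopf differential from ⟨κ, κ̄⟩. -/
lemma W_W {p : M} (hp : p ∈ φ.source) :
    ip s (∂z φ (∂z φ X) p) (∂b φ (∂b φ X) p) =
      ip s (∂b φ (∂z φ X) p) (∂b φ (∂z φ X) p) := by
  have h1 := ip_dc_eq_neg Complex.I (h.sm.dc Complex.I) ((h.sm.dc (-Complex.I)).dc (-Complex.I))
    (fun q hq => h.B_dzz hq) hp
  have h2 := ip_dc_eq_neg (-Complex.I) (h.sm.dc Complex.I) ((h.sm.dc (-Complex.I)).dc Complex.I)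
    (fun q hq => h.B_W hq) hp
  rw [dc_comm Complex.I (-Complex.I) (h.sm.dc _) hp, ← h2, dc_comm _ _ h.sm hp] at h1
  rw [ip_comm, h1, dc_comm _ _ h.sm hp]

/-- The normal component of `X_zz`. -/
lemma npart_dzz {p : M} (hp : p ∈ φ.source) :
    npart s (X p) (∂z φ X p) (∂b φ X p) (∂b φ (∂z φ X) p) (∂z φ (∂z φ X) p) =
      ∂z φ (∂z φ X) p + (2 * ip s (∂z φ (∂z φ X) p) (∂b φ (∂z φ X) p)) • X p := by
  rw [npart, ip_comm s _ (∂b φ X p), ip_comm s _ (∂z φ X p), ip_comm s _ (X p), h.A_dzz hp,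
    h.B_dzz hp, h.X_dzz hp]
  simp

end Canon

end CanonicalLift

end

section

/-! ### Coordinates and induced metrics. -/

section Charts

local notation "∂z" => dc (-Complex.I)
local notation "∂b" => dc Complex.I

variable {M : Type*} [TopologicalSpace M] [ChartedSpace ℂ M]
variable {E : Type*} [NormedAddCommGroup E] [NormedSpace ℝ E]
variable {φ : OpenPartialHomeomorph M ℂ}

lemma contMDiffOn_source_iff [IsManifold 𝓘(ℝ, ℂ) ∞ M]
    (hφ : φ ∈ IsManifold.maximalAtlas 𝓘(ℝ, ℂ) ∞ M) {F : M → E} :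
    ContMDiffOn 𝓘(ℝ, ℂ) 𝓘(ℝ, E) ∞ F φ.source ↔ Sm φ F := by
  rw [contMDiffOn_iff_source_of_mem_maximalAtlas hφ subset_rfl, contMDiffOn_iff_contDiffOn]
  simp only [mfld_simps, Sm, φ.image_source_eq_target]

lemma Sm.of_contMDiff [IsManifold 𝓘(ℝ, ℂ) ∞ M]
    (hφ : φ ∈ IsManifold.maximalAtlas 𝓘(ℝ, ℂ) ∞ M) {F : M → E}
    (hF : ContMDiff 𝓘(ℝ, ℂ) 𝓘(ℝ, E) ∞ F) : Sm φ F :=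
  (contMDiffOn_source_iff hφ).1 hF.contMDiffOn

lemma mdifferentiable_of_mem_maximalAtlas [IsManifold 𝓘(ℝ, ℂ) ∞ M]
    (hφ : φ ∈ IsManifold.maximalAtlas 𝓘(ℝ, ℂ) ∞ M) :
    φ.MDifferentiable 𝓘(ℝ, ℂ) 𝓘(ℝ, ℂ) :=
  ⟨(contMDiffOn_of_mem_maximalAtlas hφ).mdifferentiableOn (by simp),
    (contMDiffOn_symm_of_mem_maximalAtlas hφ).mdifferentiableOn (by simp)⟩

lemma mfderiv_chart_bijective [IsManifold 𝓘(ℝ, ℂ) ∞ M]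
    (hφ : φ ∈ IsManifold.maximalAtlas 𝓘(ℝ, ℂ) ∞ M) {p : M} (hp : p ∈ φ.source) :
    Function.Bijective (mfderiv 𝓘(ℝ, ℂ) 𝓘(ℝ, ℂ) φ p) :=
  (mdifferentiable_of_mem_maximalAtlas hφ).mfderiv_bijective hp

lemma mfderiv_eq_fderiv_chart [IsManifold 𝓘(ℝ, ℂ) ∞ M]
    (hφ : φ ∈ IsManifold.maximalAtlas 𝓘(ℝ, ℂ) ∞ M) {p : M} (hp : p ∈ φ.source) {F : M → E}
    (hF : Sm φ F) (v : TangentSpace 𝓘(ℝ, ℂ) p) :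
    mfderiv 𝓘(ℝ, ℂ) 𝓘(ℝ, E) F p v =
      fderiv ℝ (F ∘ φ.symm) (φ p) (mfderiv 𝓘(ℝ, ℂ) 𝓘(ℝ, ℂ) φ p v : ℂ) := by
  have h1 : F =ᶠ[nhds p] (F ∘ φ.symm) ∘ φ := by
    filter_upwards [φ.open_source.mem_nhds hp] with q hq
    simp [φ.left_inv hq]
  have h2 : MDifferentiableAt 𝓘(ℝ, ℂ) 𝓘(ℝ, E) (F ∘ φ.symm) (φ p) :=
    (hF.differentiableAt hp).mdifferentiableAt
  have h3 : MDifferentiableAt 𝓘(ℝ, ℂ) 𝓘(ℝ, ℂ) φ p :=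
    (mdifferentiable_of_mem_maximalAtlas hφ).mdifferentiableAt hp
  rw [h1.mfderiv_eq, mfderiv_comp p h2 h3, mfderiv_eq_fderiv]
  rfl

lemma fderiv_toC {m : ℕ} {F : M → Fin m → ℝ} (hF : Sm φ F) {p : M} (hp : p ∈ φ.source) (v : ℂ) :
    fderiv ℝ ((toC ∘ F) ∘ φ.symm) (φ p) v = toC (fderiv ℝ (F ∘ φ.symm) (φ p) v) := by
  have h := ((toCL (m := m)).hasFDerivAt.comp (φ p) (hF.hasFDerivAt hp)).fderiv
  have e : (toC ∘ F) ∘ φ.symm = (toCL (m := m)) ∘ (F ∘ φ.symm) := rfl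
  rw [e, h]; rfl

lemma ip_fderiv {m : ℕ} (s : ℕ) {F : M → Fin m → ℝ} (hF : Sm φ F) {p : M} (hp : p ∈ φ.source)
    (v w : ℂ) :
    ((ip s (fderiv ℝ (F ∘ φ.symm) (φ p) v) (fderiv ℝ (F ∘ φ.symm) (φ p) w) : ℝ) : ℂ) =
      ip s (v • ∂z φ (toC ∘ F) p + star v • ∂b φ (toC ∘ F) p)
        (w • ∂z φ (toC ∘ F) p + star w • ∂b φ (toC ∘ F) p) := by
  rw [← ip_toC, ← fderiv_toC hF hp, ← fderiv_toC hF hp, fderiv_eq_dc, fderiv_eq_dc]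

lemma normSq_cast (v : ℂ) : ((‖v‖ ^ 2 : ℝ) : ℂ) = v * star v := by
  rw [Complex.star_def, Complex.mul_conj, Complex.normSq_eq_norm_sq]

/-- The metric induced by `F` is `e |dz|²`. -/
lemma conformal_iff {m : ℕ} (s : ℕ) {F : M → Fin m → ℝ} (hF : Sm φ F) {p : M}
    (hp : p ∈ φ.source) (e : ℝ) :
    (∀ v : ℂ, ip s (fderiv ℝ (F ∘ φ.symm) (φ p) v) (fderiv ℝ (F ∘ φ.symm) (φ p) v) = e * ‖v‖ ^ 2) ↔
      ip s (∂z φ (toC ∘ F) p) (∂z φ (toC ∘ F) p) = 0 ∧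
      ip s (∂z φ (toC ∘ F) p) (∂b φ (toC ∘ F) p) = e / 2 := by
  have key : ∀ v : ℂ, ((ip s (fderiv ℝ (F ∘ φ.symm) (φ p) v)
      (fderiv ℝ (F ∘ φ.symm) (φ p) v) : ℝ) : ℂ) =
      v ^ 2 * ip s (∂z φ (toC ∘ F) p) (∂z φ (toC ∘ F) p) +
      2 * (v * star v) * ip s (∂z φ (toC ∘ F) p) (∂b φ (toC ∘ F) p) +
      star v ^ 2 * ip s (∂b φ (toC ∘ F) p) (∂b φ (toC ∘ F) p) := fun v => by
    rw [ip_fderiv s hF hp]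
    simp only [ip_add_left, ip_add_right, ip_smul_left, ip_smul_right,
      ip_comm s (∂b φ (toC ∘ F) p) (∂z φ (toC ∘ F) p)]
    ring
  have hb : ip s (∂b φ (toC ∘ F) p) (∂b φ (toC ∘ F) p) =
      star (ip s (∂z φ (toC ∘ F) p) (∂z φ (toC ∘ F) p)) := by
    rw [star_ip, star_dc_of_real hF.toC (fun q _ => star_toC _) _ hp, star_neg_I]
  constructor
  · intro h
    have h' : ∀ v : ℂ, (e : ℂ) * (v * star v) =
      v ^ 2 * ip s (∂z φ (toC ∘ F) p) (∂z φ (toC ∘ F) p) +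
      2 * (v * star v) * ip s (∂z φ (toC ∘ F) p) (∂b φ (toC ∘ F) p) +
      star v ^ 2 * ip s (∂b φ (toC ∘ F) p) (∂b φ (toC ∘ F) p) := fun v => by
      rw [← key, h, Complex.ofReal_mul, normSq_cast]
    -- The test vectors 1, i and 1 + i determine the three coefficients of the quadratic form.
    have h1 := h' 1
    have h2 := h' Complex.I
    have h3 := h' (1 + Complex.I)
    have hI := Complex.I_sq
    simp only [star_one, star_I, star_add] at h1 h2 h3
    generalize ip s (∂z φ (toC ∘ F) p) (∂z φ (toC ∘ F) p) = a at *
    generalize ip s (∂z φ (toC ∘ F) p) (∂b φ (toC ∘ F) p) = b at *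
    generalize ip s (∂b φ (toC ∘ F) p) (∂b φ (toC ∘ F) p) = c at *
    have e1 : b = e / 2 := by
      linear_combination (-1 / 4 : ℂ) * h1 - 1 / 4 * h2 - (1 / 4 * (a + c - 2 * b + e)) * hI
    have e2 : a + c = 0 := by linear_combination (-1 : ℂ) * h1 - 2 * e1
    have e3 : Complex.I * (a - c) = 0 := by
      linear_combination (-1 / 2 : ℂ) * h3 - 2 * e1 - (1 / 2) * (a + c - 2 * b + e) * hI
    have e4 : a - c = 0 := (mul_eq_zero.1 e3).resolve_left Complex.I_ne_zero
    exact ⟨by linear_combination (1 / 2 : ℂ) * e2 + 1 / 2 * e4, e1⟩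
  · rintro ⟨h1, h2⟩ v
    have := key v
    rw [hb, h1, h2, star_zero] at this
    apply Complex.ofReal_injective
    rw [this, Complex.ofReal_mul, normSq_cast]
    ring

end Charts

/-! ### Lifts to the light cone and the Hopf differential. -/

section Lifts

local notation "∂z" => dc (-Complex.I)
local notation "∂b" => dc Complex.I

variable {M : Type*} [TopologicalSpace M] [ChartedSpace ℂ M] {n r : ℕ}
variable {φ : OpenPartialHomeomorph M ℂ} {y : M → Quadric n r} {Y : M → Fin (n + 2) → ℝ}

lemma IsLiftOn.null {U : Set M} (h : IsLiftOn r y U Y) {p : M} (hp : p ∈ U) :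
    ip (r + 1) (Y p) (Y p) = 0 := by
  obtain ⟨h0, h1⟩ := h.lift p hp
  obtain ⟨a, ha⟩ := Projectivization.exists_smul_eq_mk_rep ℝ (Y p) h0
  have h2 := (y p).2
  rw [← h1, ← ha, Units.smul_def, ip_smul_smul] at h2
  exact (mul_eq_zero.1 h2).resolve_left (pow_ne_zero 2 a.ne_zero)

/-- The orthogonal complement of a point of the surface does not depend on its representative. -/
lemma IsLiftOn.ip_rep {U : Set M} (h : IsLiftOn r y U Y) {p : M} (hp : p ∈ U)
    {v : Fin (n + 2) → ℝ} (hv : ip (r + 1) v (Y p) = 0) : ip (r + 1) v (y p).1.rep = 0 := by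
  obtain ⟨h0, h1⟩ := h.lift p hp
  obtain ⟨a, ha⟩ := Projectivization.exists_smul_eq_mk_rep ℝ (Y p) h0
  rw [← h1, ← ha, Units.smul_def, ip_smul_right, hv, mul_zero]

variable [IsManifold 𝓘(ℝ, ℂ) ∞ M]

lemma IsCanonicalLift.sm (h : IsCanonicalLift r y φ Y) : Sm φ Y :=
  (contMDiffOn_source_iff h.chart).1 h.lift.smooth

lemma IsCanonicalLift.canon (h : IsCanonicalLift r y φ Y) : Canon (r + 1) φ (toC ∘ Y) := by
  have key := fun p (hp : p ∈ φ.source) => (conformal_iff (r + 1) h.sm hp 1).1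
    (fun v => by rw [h.isometric p hp, one_mul])
  refine ⟨h.sm.toC, fun p _ => star_toC _, fun p hp => ?_, fun p hp => (key p hp).1,
    fun p hp => by simpa using (key p hp).2⟩
  rw [Function.comp_apply, ip_toC, h.lift.null hp, Complex.ofReal_zero]

lemma isCanonicalLift_of_canon (hφ : φ ∈ IsManifold.maximalAtlas 𝓘(ℝ, ℂ) ∞ M)
    (hY : IsLiftOn r y φ.source Y) (h : Canon (r + 1) φ (toC ∘ Y)) : IsCanonicalLift r y φ Y := by
  refine ⟨hφ, hY, fun p hp v => ?_⟩
  have := (conformal_iff (r + 1) ((contMDiffOn_source_iff hφ).1 hY.smooth) hp 1).2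
    ⟨h.conf p hp, by simpa using h.unit p hp⟩ v
  rw [this, one_mul]

lemma confTangent_eq (p : M) : confTangent φ Y p = Submodule.span ℂ
    {(toC ∘ Y) p, ∂z φ (toC ∘ Y) p, ∂b φ (toC ∘ Y) p, ∂b φ (∂z φ (toC ∘ Y)) p} := by
  simp only [confTangent, dz_eq_dc, dzb_eq_dc, Function.comp_apply]

/-- Y_zz is already orthogonal to Y, Y_z and Y_z̄, so only its pairing with Y_zz̄ needs a
correction, which is a multiple of Y. -/
lemma hopf_eq (h : Canon (r + 1) φ (toC ∘ Y)) {p : M} (hp : p ∈ φ.source) :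
    hopf r φ Y p = ∂z φ (∂z φ (toC ∘ Y)) p +
      (2 * ip (r + 1) (∂z φ (∂z φ (toC ∘ Y)) p) (∂b φ (∂z φ (toC ∘ Y)) p)) • (toC ∘ Y) p := by
  rw [hopf, confTangent_eq, dz_eq_dc, dz_eq_dc, (h.gram hp).normalPart_eq, h.npart_dzz hp]

lemma hopf_mem_perp (h : Canon (r + 1) φ (toC ∘ Y)) {p : M} (hp : p ∈ φ.source) :
    hopf r φ Y p ∈ perp (r + 1) (confTangent φ Y p) := by
  rw [hopf, confTangent_eq, (h.gram hp).normalPart_eq]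
  exact (h.gram hp).npart_mem_perp _

lemma sm_hopf (h : Canon (r + 1) φ (toC ∘ Y)) : Sm φ (hopf r φ Y) :=
  Sm.congr (((h.sm.dc _).dc _).add (((Sm.const (2 : ℂ)).mul
    (((h.sm.dc _).dc _).ip (r + 1) ((h.sm.dc _).dc _))).smul h.sm)) fun _ hp => hopf_eq h hp

/-- In κ = Y_zz + kY the terms with Y drop out of ⟨κ, κ̄⟩, since Y is null and orthogonal to Y_zz
and Y_z̄z̄; `Canon.W_W` does the rest. No normal projection remains, which makes the metric of a
rescaled lift computable. -/
lemma confMetric_eq (h : Canon (r + 1) φ (toC ∘ Y)) {p : M} (hp : p ∈ φ.source) :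
    confMetric r φ Y p =
      ip (r + 1) (∂b φ (∂z φ (toC ∘ Y)) p) (∂b φ (∂z φ (toC ∘ Y)) p) := by
  have hX : ip (r + 1) (toC (Y p)) (∂b φ (∂b φ (toC ∘ Y)) p) = 0 := by
    have := congrArg star (h.X_dzz hp)
    rwa [star_ip, h.star_dzz hp, h.real p hp, star_zero] at this
  have h1 := h.X_dzz hp
  have h2 := h.null p hp
  have h3 := h.real p hp
  simp only [Function.comp_apply] at h1 h2 h3
  rw [confMetric, hopf_eq h hp, ← h.W_W hp, star_add, star_smul, h.star_dzz hp]
  simp only [ip_add_left, ip_add_right, ip_smul_left, ip_smul_right, Function.comp_apply,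
    ip_comm _ _ (toC (Y p)), h1, h2, h3, hX]
  ring

lemma sm_confMetric (h : Canon (r + 1) φ (toC ∘ Y)) : Sm φ (confMetric r φ Y) :=
  Sm.congr (((h.sm.dc _).dc _).ip (r + 1) ((h.sm.dc _).dc _)) fun _ hp => confMetric_eq h hp

lemma isAdapted_iff : IsAdapted r y φ Y ↔
    IsCanonicalLift r y φ Y ∧ ∀ p ∈ φ.source, star (hopf r φ Y p) = hopf r φ Y p := by
  simp only [IsAdapted, star_eq_iff_im]

end Lifts

end

section

/-! ### Local structure equations of a parallel normal field. -/

section PolarLocal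

local notation "∂z" => dc (-Complex.I)
local notation "∂b" => dc Complex.I

variable {M : Type*} [TopologicalSpace M] {m : ℕ} {s : ℕ} {φ : OpenPartialHomeomorph M ℂ}

/-- A real parallel normal field `P` along the surface with canonical lift `X`, in an adapted
coordinate; `h = ⟨P, κ⟩`. -/
structure LocalPolar (s : ℕ) (φ : OpenPartialHomeomorph M ℂ) (X P : M → Fin m → ℂ) (h : M → ℂ) :
    Prop where
  canon : Canon s φ X
  sm : Sm φ P
  real : ∀ p ∈ φ.source, star (P p) = P p
  smh : Sm φ h
  realh : ∀ p ∈ φ.source, star (h p) = h p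
  X_P : ∀ p ∈ φ.source, ip s (X p) (P p) = 0
  A_P : ∀ p ∈ φ.source, ip s (∂z φ X p) (P p) = 0
  B_P : ∀ p ∈ φ.source, ip s (∂b φ X p) (P p) = 0
  dz : ∀ p ∈ φ.source, ∂z φ P p = (2 * ∂b φ h p) • X p - (2 * h p) • ∂b φ X p

/-- The structure equation of a parallel normal field. -/
lemma dz_of_parallel {X P : M → Fin m → ℂ} (hX : Canon s φ X) (hP : Sm φ P)
    (real : ∀ p ∈ φ.source, star (P p) = P p)
    (hperp : ∀ p ∈ φ.source, ip s (X p) (P p) = 0 ∧ ip s (∂z φ X p) (P p) = 0 ∧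
      ip s (∂b φ X p) (P p) = 0 ∧ ip s (∂b φ (∂z φ X) p) (P p) = 0)
    (hpar : ∀ p ∈ φ.source,
      npart s (X p) (∂z φ X p) (∂b φ X p) (∂b φ (∂z φ X) p) (∂z φ P p) = 0)
    {h : M → ℂ} (hh : ∀ p ∈ φ.source, h p = ip s (∂z φ (∂z φ X) p) (P p))
    {p : M} (hp : p ∈ φ.source) :
    ∂z φ P p = (2 * ∂b φ h p) • X p - (2 * h p) • ∂b φ X p := by
  -- The pairings of P_z with X, X_z̄ and X_z come from differentiating the orthogonality relations
  -- of P; with P_z tangent, only ⟨X_zz̄, P_z⟩ is left to be found.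
  have e1 : ∀ q ∈ φ.source, ip s (X q) (∂z φ P q) = 0 := fun q hq => by
    have := ip_dc_eq_neg (-Complex.I) hX.sm hP (fun q hq => (hperp q hq).1) hq
    rw [(hperp q hq).2.1] at this
    linear_combination this
  have e2 : ∀ q ∈ φ.source, ip s (∂b φ X q) (∂z φ P q) = 0 := fun q hq => by
    have := ip_dc_eq_neg (-Complex.I) (hX.sm.dc Complex.I) hP (fun q hq => (hperp q hq).2.2.1) hq
    rw [dc_comm _ _ hX.sm hq, (hperp q hq).2.2.2] at this
    linear_combination this
  have e3 : ∀ q ∈ φ.source, ip s (∂z φ X q) (∂z φ P q) = - h q := fun q hq => by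
    have := ip_dc_eq_neg (-Complex.I) (hX.sm.dc (-Complex.I)) hP (fun q hq => (hperp q hq).2.1) hq
    rw [hh q hq, this, neg_neg]
  have e4 : ∀ q ∈ φ.source, ∂z φ P q =
      (-2 * ip s (∂b φ (∂z φ X) q) (∂z φ P q)) • X q - (2 * h q) • ∂b φ X q := fun q hq => by
    have := hpar q hq
    rw [npart, ip_comm s _ (X q), ip_comm s _ (∂b φ X q), ip_comm s _ (∂z φ X q),
      ip_comm s (∂z φ P q) (∂b φ (∂z φ X) q), e1 q hq, e2 q hq, e3 q hq] at this
    rw [← sub_eq_zero, ← this]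
    module
  have e5 : ip s (∂z φ (∂z φ X) p) (∂b φ P p) = 0 := by
    have : ∂b φ P p = star (∂z φ P p) := by
      rw [star_dc_of_real hP real _ hp, star_neg_I]
    rw [this, e4 p hp, star_sub, star_smul, star_smul, hX.star_dzb hp, hX.real p hp, ip_sub_right,
      ip_smul_right, ip_smul_right, ip_comm s _ (X p), ip_comm s _ (∂z φ X p), hX.X_dzz hp,
      hX.A_dzz hp]
    ring
  -- Codazzi: differentiate h = ⟨X_zz, P⟩ in z̄. The term with P_z̄ vanishes because P_z̄ is a
  -- combination of X and X_z, both orthogonal to X_zz; the other is -⟨X_zz̄, P_z⟩.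
  have e6 : ip s (∂b φ (∂z φ X) p) (∂z φ P p) = - ∂b φ h p := by
    have h1 := ip_dc_eq_neg (-Complex.I) ((hX.sm.dc (-Complex.I)).dc Complex.I) hP
      (fun q hq => (hperp q hq).2.2.2) hp
    have h2 := dc_ip s Complex.I ((hX.sm.dc (-Complex.I)).dc (-Complex.I)) hP hp
    rw [← dc_congr Complex.I hh hp, e5,
      dc_comm Complex.I (-Complex.I) (hX.sm.dc _) hp, h1] at h2
    linear_combination h2
  rw [e4 p hp, e6]
  module

lemma tpart_add_tangent {c : ℂ} {P Pb f : Fin m → ℂ} (hP : ip s P P = 0) (hPb : ip s Pb Pb = 0)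
    (hg : ip s P Pb ≠ 0) (hPf : ip s f P = 0) (hPbf : ip s f Pb = 0) (x : Fin m → ℂ) (a b : ℂ) :
    tpart s c P Pb f (x + a • P + b • Pb) = tpart s c P Pb f x := by
  simp only [tpart, ip_add_left, ip_smul_left, hP, hPb, ip_comm s P f, ip_comm s Pb f, hPf, hPbf,
    ip_comm s Pb P, mul_zero, add_zero, add_div, mul_div_assoc, div_self hg]
  module

namespace LocalPolar

variable {X P : M → Fin m → ℂ} {h : M → ℂ} (H : LocalPolar s φ X P h)
include H

lemma star_dzh {p : M} (hp : p ∈ φ.source) : star (∂z φ h p) = ∂b φ h p := by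
  rw [star_dc_of_real_fun H.smh H.realh _ hp, star_neg_I]

lemma star_dzbh {p : M} (hp : p ∈ φ.source) : star (∂b φ h p) = ∂z φ h p := by
  rw [← H.star_dzh hp, star_star]

lemma star_dz {p : M} (hp : p ∈ φ.source) : star (∂z φ P p) = ∂b φ P p := by
  rw [star_dc_of_real H.sm H.real _ hp, star_neg_I]

lemma star_dzb {p : M} (hp : p ∈ φ.source) : star (∂b φ P p) = ∂z φ P p := by
  rw [← H.star_dz hp, star_star]

lemma dzb {p : M} (hp : p ∈ φ.source) :
    ∂b φ P p = (2 * ∂z φ h p) • X p - (2 * h p) • ∂z φ X p := by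
  rw [← H.star_dz hp, H.dz p hp]
  simp only [star_sub, star_smul, star_mul', star_ofNat, H.star_dzbh hp, H.realh p hp,
    H.canon.real p hp, H.canon.star_dzb hp]

lemma dz_dz {p : M} (hp : p ∈ φ.source) : ip s (∂z φ P p) (∂z φ P p) = 0 := by
  have hX := H.canon.gram hp
  simp only [H.dz p hp, ip_sub_left, ip_sub_right, ip_smul_left, ip_smul_right, hX.YY, hX.YB,
    hX.BB, ip_comm s (∂b φ X p) (X p)]
  ring

lemma dzb_dzb {p : M} (hp : p ∈ φ.source) : ip s (∂b φ P p) (∂b φ P p) = 0 := by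
  rw [← H.star_dz hp, ← star_ip, H.dz_dz hp, star_zero]

/-- Only the product of the X_z̄ and X_z terms survives. With `dz_dz` this says that the induced
metric is 4h²|dz|². -/
lemma dz_dzb {p : M} (hp : p ∈ φ.source) : ip s (∂z φ P p) (∂b φ P p) = 2 * h p ^ 2 := by
  have hX := H.canon.gram hp
  simp only [H.dz p hp, H.dzb hp, ip_sub_left, ip_sub_right, ip_smul_left, ip_smul_right, hX.YY,
    hX.YB, hX.YA, ip_comm s (∂b φ X p) (X p), ip_comm s (∂b φ X p) (∂z φ X p), hX.AB]
  ring

lemma X_dz {p : M} (hp : p ∈ φ.source) : ip s (X p) (∂z φ P p) = 0 := by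
  have hX := H.canon.gram hp
  simp only [H.dz p hp, ip_sub_right, ip_smul_right, hX.YY, hX.YB]
  ring

lemma X_dzb {p : M} (hp : p ∈ φ.source) : ip s (X p) (∂b φ P p) = 0 := by
  have hX := H.canon.gram hp
  simp only [H.dzb hp, ip_sub_right, ip_smul_right, hX.YY, hX.YA]
  ring

lemma P_dz {p : M} (hp : p ∈ φ.source) : ip s (P p) (∂z φ P p) = 0 := by
  rw [ip_comm, H.dz p hp]
  simp only [ip_sub_left, ip_smul_left, H.X_P p hp, H.B_P p hp]
  ring

lemma P_dzb {p : M} (hp : p ∈ φ.source) : ip s (P p) (∂b φ P p) = 0 := by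
  rw [ip_comm, H.dzb hp]
  simp only [ip_sub_left, ip_smul_left, H.X_P p hp, H.A_P p hp]
  ring

/-- The part of `P_zz` that is not tangent to the surface `P`. -/
def secondReal (φ : OpenPartialHomeomorph M ℂ) (X : M → Fin m → ℂ) (h : M → ℂ) (p : M) :
    Fin m → ℂ :=
  (2 * ∂b φ (∂z φ h) p) • X p - (2 * h p) • ∂b φ (∂z φ X) p

lemma star_secondReal {p : M} (hp : p ∈ φ.source) :
    star (secondReal φ X h p) = secondReal φ X h p := by
  simp only [secondReal, star_sub, star_smul, star_mul', star_ofNat, H.realh p hp,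
    H.canon.real p hp, H.canon.star_W hp, star_dc_dc_fun H.smh H.realh _ _ hp, star_I, star_neg_I,
    dc_comm (-Complex.I) Complex.I H.smh hp]

lemma dzz {p : M} (hp : p ∈ φ.source) : ∂z φ (∂z φ P) p = secondReal φ X h p +
    (2 * ∂b φ h p) • ∂z φ X p - (2 * ∂z φ h p) • ∂b φ X p := by
  have hX := H.canon.sm
  have s1 : Sm φ (fun q => 2 * ∂b φ h q) := (Sm.const 2).mul (H.smh.dc _)
  have s2 : Sm φ (fun q => 2 * h q) := (Sm.const 2).mul H.smh
  rw [dc_congr _ H.dz hp, dc_sub _ (s1.smul hX) (s2.smul (hX.dc _)) hp, dc_smul _ s1 hX hp,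
    dc_smul _ s2 (hX.dc _) hp, dc_const_mul _ _ (H.smh.dc _) hp, dc_const_mul _ _ H.smh hp,
    dc_comm (-Complex.I) Complex.I H.smh hp, dc_comm (-Complex.I) Complex.I hX hp, secondReal]
  module

/-- Where h ≠ 0, the vectors X_z and X_z̄ can be traded for P_z̄ and P_z; the multiples of X that
arise cancel each other. What remains modulo the tangent plane is the real vector `secondReal`, and
this is the reason why P is isothermic in the same coordinate. -/
lemma dzz' {p : M} (hp : p ∈ φ.source) (h0 : h p ≠ 0) : ∂z φ (∂z φ P) p = secondReal φ X h p +
    (∂z φ h p / h p) • ∂z φ P p + (-(∂b φ h p / h p)) • ∂b φ P p := by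
  have e1 : (2 * ∂b φ h p) • ∂z φ X p =
      (∂b φ h p / h p) • ((2 * ∂z φ h p) • X p - ∂b φ P p) := by
    rw [H.dzb hp, sub_sub_cancel, smul_smul]
    congr 1; field_simp
  have e2 : (2 * ∂z φ h p) • ∂b φ X p =
      (∂z φ h p / h p) • ((2 * ∂b φ h p) • X p - ∂z φ P p) := by
    rw [H.dz p hp, sub_sub_cancel, smul_smul]
    congr 1; field_simp
  rw [H.dzz hp, e1, e2]
  module

lemma dzbz {p : M} (hp : p ∈ φ.source) : ∂b φ (∂z φ P) p =
    (2 * ∂b φ (∂b φ h) p) • X p - (2 * h p) • ∂b φ (∂b φ X) p := by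
  have hX := H.canon.sm
  have s1 : Sm φ (fun q => 2 * ∂b φ h q) := (Sm.const 2).mul (H.smh.dc _)
  have s2 : Sm φ (fun q => 2 * h q) := (Sm.const 2).mul H.smh
  rw [dc_congr _ H.dz hp, dc_sub _ (s1.smul hX) (s2.smul (hX.dc _)) hp, dc_smul _ s1 hX hp,
    dc_smul _ s2 (hX.dc _) hp, dc_const_mul _ _ (H.smh.dc _) hp, dc_const_mul _ _ H.smh hp]
  module

/-- P_zz̄ involves only X and X_z̄z̄, both orthogonal to X. This is the minimality of the lift X/h
as a normal section of P. -/
lemma X_dzbz {p : M} (hp : p ∈ φ.source) : ip s (X p) (∂b φ (∂z φ P) p) = 0 := by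
  have hX : ip s (X p) (∂b φ (∂b φ X) p) = 0 := by
    have := congrArg star (H.canon.X_dzz hp)
    rwa [star_ip, H.canon.star_dzz hp, H.canon.real p hp, star_zero] at this
  simp only [H.dzbz hp, ip_sub_right, ip_smul_right, H.canon.null p hp, hX]
  ring

/-- The derivative of `X / h`: the duality with `P`. -/
lemma dz_dual (h0 : ∀ q ∈ φ.source, h q ≠ 0) {p : M} (hp : p ∈ φ.source) :
    ∂z φ (fun q => (h q)⁻¹ • X q) p = (-(1 / (2 * h p ^ 2))) • ∂b φ P p := by
  have := h0 p hp
  rw [dc_smul _ (H.smh.inv h0) H.canon.sm hp, dc_inv _ H.smh h0 hp, H.dzb hp]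
  match_scalars <;> field_simp

lemma dzb_dual (h0 : ∀ q ∈ φ.source, h q ≠ 0) {p : M} (hp : p ∈ φ.source) :
    ∂b φ (fun q => (h q)⁻¹ • X q) p = (-(1 / (2 * h p ^ 2))) • ∂z φ P p := by
  have := h0 p hp
  rw [dc_smul _ (H.smh.inv h0) H.canon.sm hp, dc_inv _ H.smh h0 hp, H.dz p hp]
  match_scalars <;> field_simp

end LocalPolar

end PolarLocal

/-! ### Parallel sections of the conformal normal bundle. -/

section PolarSurface

local notation "∂z" => dc (-Complex.I)
local notation "∂b" => dc Complex.I

variable {M : Type*} [TopologicalSpace M] [ChartedSpace ℂ M] [IsManifold 𝓘(ℝ, ℂ) ∞ M] {n r : ℕ}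
variable {φ : OpenPartialHomeomorph M ℂ} {y : M → Quadric n r} {Y ψ : M → Fin (n + 2) → ℝ} {c : ℝ}

/-- The function `⟨ψ, κ⟩`. -/
def hFun (r : ℕ) (φ : OpenPartialHomeomorph M ℂ) (Y ψ : M → Fin (n + 2) → ℝ) (p : M) : ℂ :=
  ip (r + 1) (toC (ψ p)) (hopf r φ Y p)

lemma IsParallelSection.perp (hψ : IsParallelSection r y ψ) (hY : IsCanonicalLift r y φ Y) {p : M}
    (hp : p ∈ φ.source) : ip (r + 1) ((toC ∘ Y) p) ((toC ∘ ψ) p) = 0 ∧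
      ip (r + 1) (∂z φ (toC ∘ Y) p) ((toC ∘ ψ) p) = 0 ∧
      ip (r + 1) (∂b φ (toC ∘ Y) p) ((toC ∘ ψ) p) = 0 ∧
      ip (r + 1) (∂b φ (∂z φ (toC ∘ Y)) p) ((toC ∘ ψ) p) = 0 := by
  have := hψ.normal φ Y hY p hp
  rw [confTangent_eq, mem_perp_four] at this
  simp only [ip_comm _ (toC (ψ p))] at this
  exact this

lemma hFun_eq (hψ : IsParallelSection r y ψ) (hY : IsCanonicalLift r y φ Y) {p : M}
    (hp : p ∈ φ.source) :
    hFun r φ Y ψ p = ip (r + 1) (∂z φ (∂z φ (toC ∘ Y)) p) ((toC ∘ ψ) p) := by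
  rw [hFun, hopf_eq hY.canon hp, ip_add_right, ip_smul_right, ip_comm _ _ ((toC ∘ Y) p)]
  have := (hψ.perp hY hp).1
  rw [Function.comp_apply (f := toC) (g := ψ)] at this
  rw [this, mul_zero, add_zero, ip_comm]
  rfl

lemma IsParallelSection.sm (hψ : IsParallelSection r y ψ) (hY : IsCanonicalLift r y φ Y) :
    Sm φ ψ := Sm.of_contMDiff hY.chart hψ.smooth

lemma IsParallelSection.dz (hψ : IsParallelSection r y ψ) (hY : IsCanonicalLift r y φ Y) {p : M}
    (hp : p ∈ φ.source) : ∂z φ (toC ∘ ψ) p = (2 * ∂b φ (hFun r φ Y ψ) p) • (toC ∘ Y) p -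
      (2 * hFun r φ Y ψ p) • ∂b φ (toC ∘ Y) p := by
  refine dz_of_parallel hY.canon (hψ.sm hY).toC (fun p _ => star_toC _)
    (fun p hp => hψ.perp hY hp) (fun p hp => ?_) (fun p hp => hFun_eq hψ hY hp) hp
  have := hψ.parallel φ Y hY p hp
  rwa [normalDz, confTangent_eq, dz_eq_dc, (hY.canon.gram hp).normalPart_eq] at this

lemma IsParallelSection.localPolar (hψ : IsParallelSection r y ψ) (hY : IsAdapted r y φ Y) :
    LocalPolar (r + 1) φ (toC ∘ Y) (toC ∘ ψ) (hFun r φ Y ψ) where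
  canon := hY.1.canon
  sm := (hψ.sm hY.1).toC
  real := fun p _ => star_toC _
  smh := (hψ.sm hY.1).toC.ip (r + 1) (sm_hopf hY.1.canon)
  realh := fun p hp => by
    rw [hFun, star_ip, star_toC, (isAdapted_iff.1 hY).2 p hp]
  X_P := fun p hp => (hψ.perp hY.1 hp).1
  A_P := fun p hp => (hψ.perp hY.1 hp).2.1
  B_P := fun p hp => (hψ.perp hY.1 hp).2.2.1
  dz := fun p hp => hψ.dz hY.1 hp

end PolarSurface

end

section

/-! ### Restriction of coordinates and local constancy. -/

section Restriction

variable {M : Type*} [TopologicalSpace M] [ChartedSpace ℂ M] [IsManifold 𝓘(ℝ, ℂ) ∞ M] {n r : ℕ}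
variable {E : Type*} [NormedAddCommGroup E] [NormedSpace ℝ E]
variable {V : Type*} [NormedAddCommGroup V] [NormedSpace ℂ V]
variable {φ : OpenPartialHomeomorph M ℂ} {y : M → Quadric n r} {Y : M → Fin (n + 2) → ℝ}

lemma restr_mem_maximalAtlas (hφ : φ ∈ IsManifold.maximalAtlas 𝓘(ℝ, ℂ) ∞ M) {U : Set M}
    (hU : IsOpen U) : φ.restr U ∈ IsManifold.maximalAtlas 𝓘(ℝ, ℂ) ∞ M :=
  _root_.restr_mem_maximalAtlas (contDiffGroupoid ∞ 𝓘(ℝ, ℂ)) hφ hU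

lemma restr_source_subset (φ : OpenPartialHomeomorph M ℂ) (U : Set M) :
    (φ.restr U).source ⊆ φ.source := fun _ h => h.1

lemma IsCanonicalLift.restr (h : IsCanonicalLift r y φ Y) {U : Set M} (hU : IsOpen U) :
    IsCanonicalLift r y (φ.restr U) Y where
  chart := restr_mem_maximalAtlas h.chart hU
  lift := ⟨h.lift.smooth.mono (restr_source_subset φ U),
    fun p hp => h.lift.lift p (restr_source_subset φ U hp)⟩
  isometric := fun p hp v => h.isometric p (restr_source_subset φ U hp) v

lemma IsAdapted.restr (h : IsAdapted r y φ Y) {U : Set M} (hU : IsOpen U) :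
    IsAdapted r y (φ.restr U) Y :=
  ⟨h.1.restr hU, fun p hp i => h.2 p (restr_source_subset φ U hp) i⟩

lemma Sm.continuousOn {F : M → E} (hF : Sm φ F) : ContinuousOn F φ.source := by
  have h1 : ContinuousOn ((F ∘ φ.symm) ∘ φ) φ.source :=
    ContinuousOn.comp (ContDiffOn.continuousOn hF) φ.continuousOn fun p hp => φ.map_source hp
  exact h1.congr fun p hp => by simp [φ.left_inv hp]

lemma Sm.restr {F : M → E} (hF : Sm φ F) {U : Set M} : Sm (φ.restr U) F :=
  ContDiffOn.mono hF fun _ hw => hw.1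

/-- A function with vanishing derivative is constant near each point. -/
lemma eventually_const_of_fderiv_eq_zero {F : M → E} (hF : Sm φ F)
    (h : ∀ p ∈ φ.source, fderiv ℝ (F ∘ φ.symm) (φ p) = 0) {p : M} (hp : p ∈ φ.source) :
    ∀ᶠ q in nhds p, F q = F p := by
  obtain ⟨ε, hε, hb⟩ := Metric.isOpen_iff.1 φ.open_target (φ p) (φ.map_source hp)
  have hc : φ ⁻¹' Metric.ball (φ p) ε ∈ nhds p :=
    (φ.continuousAt hp).preimage_mem_nhds (Metric.ball_mem_nhds _ hε)
  filter_upwards [hc, φ.open_source.mem_nhds hp] with q hq hq'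
  have := Metric.isOpen_ball.is_const_of_fderiv_eq_zero (𝕜 := ℝ) (f := F ∘ φ.symm)
    (convex_ball (φ p) ε).isPreconnected
    (ContDiffOn.differentiableOn (hF.mono hb) (by simp)) (fun w hw => by
      have := h _ (φ.map_target (hb hw))
      rwa [φ.right_inv (hb hw)] at this) hq (Metric.mem_ball_self hε)
  simpa [φ.left_inv hq', φ.left_inv hp] using this

end Restriction

/-! ### Polar transforms as surfaces in pseudo-Euclidean space and its quadrics. -/

section PolarForm

local notation "∂z" => dc (-Complex.I)
local notation "∂b" => dc Complex.I

variable {M : Type*} [TopologicalSpace M] [ChartedSpace ℂ M] [IsManifold 𝓘(ℝ, ℂ) ∞ M] {n r : ℕ}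
variable {φ : OpenPartialHomeomorph M ℂ} {y : M → Quadric n r} {Y ψ : M → Fin (n + 2) → ℝ} {c : ℝ}

lemma hFun_eq_re (hψ : IsParallelSection r y ψ) (hY : IsAdapted r y φ Y) {p : M}
    (hp : p ∈ φ.source) : hFun r φ Y ψ p = ((hFun r φ Y ψ p).re : ℂ) :=
  (Complex.conj_eq_iff_re.1 ((hψ.localPolar hY).realh p hp)).symm

/-- The metric induced by a parallel section is `4 ⟨ψ, κ⟩² |dz|²`. -/
lemma IsParallelSection.ip_fderiv_self (hψ : IsParallelSection r y ψ) (hY : IsAdapted r y φ Y)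
    {p : M} (hp : p ∈ φ.source) (v : ℂ) :
    ip (r + 1) (fderiv ℝ (ψ ∘ φ.symm) (φ p) v) (fderiv ℝ (ψ ∘ φ.symm) (φ p) v) =
      4 * (hFun r φ Y ψ p).re ^ 2 * ‖v‖ ^ 2 := by
  have H := hψ.localPolar hY
  refine (conformal_iff (r + 1) (hψ.sm hY.1) hp _).2 ⟨H.dz_dz hp, ?_⟩ v
  rw [H.dz_dzb hp, hFun_eq_re hψ hY hp]
  push_cast
  simp only [Complex.ofReal_re]
  ring

lemma IsParallelSection.fderiv_eq (hψ : IsParallelSection r y ψ) (hY : IsAdapted r y φ Y)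
    {p : M} (hp : p ∈ φ.source) (v : ℂ) : toC (fderiv ℝ (ψ ∘ φ.symm) (φ p) v) =
      v • ∂z φ (toC ∘ ψ) p + star v • ∂b φ (toC ∘ ψ) p := by
  rw [← fderiv_toC (hψ.sm hY.1) hp, fderiv_eq_dc]

/-- Where h ≠ 0 the induced metric is definite. Where h = 0 the differential takes values in the
line of Y, so it has a kernel. -/
lemma injective_fderiv_iff (hψ : IsParallelSection r y ψ) (hY : IsAdapted r y φ Y) {p : M}
    (hp : p ∈ φ.source) : Function.Injective (fderiv ℝ (ψ ∘ φ.symm) (φ p)) ↔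
      hFun r φ Y ψ p ≠ 0 := by
  have H := hψ.localPolar hY
  rw [injective_iff_map_eq_zero]
  constructor
  · intro hinj h0
    have key : ∀ v : ℂ, v * ∂b φ (hFun r φ Y ψ) p + star v * ∂z φ (hFun r φ Y ψ) p = 0 →
        v = 0 := fun v hv => by
      refine hinj v (toC_injective ?_)
      rw [hψ.fderiv_eq hY hp, H.dz p hp, H.dzb hp, h0, toC_zero]
      have : v • ((2 * ∂b φ (hFun r φ Y ψ) p) • (toC ∘ Y) p - (2 * 0 : ℂ) • ∂b φ (toC ∘ Y) p) +
          star v • ((2 * ∂z φ (hFun r φ Y ψ) p) • (toC ∘ Y) p - (2 * 0 : ℂ) • ∂z φ (toC ∘ Y) p) =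
          (2 * (v * ∂b φ (hFun r φ Y ψ) p + star v * ∂z φ (hFun r φ Y ψ) p)) • (toC ∘ Y) p := by
        module
      rw [this, hv, mul_zero, zero_smul]
    by_cases hz : ∂z φ (hFun r φ Y ψ) p = 0
    · have hb : ∂b φ (hFun r φ Y ψ) p = 0 := by rw [← H.star_dzh hp, hz, star_zero]
      exact one_ne_zero (key 1 (by rw [hz, hb]; simp))
    -- The tangent vector i h_z solves v h_z̄ + v̄ h_z = 0, because h_z̄ is the conjugate of h_z.
    · refine hz ((mul_eq_zero.1 (key (Complex.I * ∂z φ (hFun r φ Y ψ) p) ?_)).resolve_left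
        Complex.I_ne_zero)
      rw [star_mul', star_I, H.star_dzh hp]
      ring
  · intro h0 v hv
    have := hψ.ip_fderiv_self hY hp v
    rw [hv, ip_zero_left] at this
    have h1 : (hFun r φ Y ψ p).re ≠ 0 := fun h => h0 (by
      rw [hFun_eq_re hψ hY hp, h, Complex.ofReal_zero])
    have h2 : ‖v‖ ^ 2 = 0 := by
      have h3 : 4 * (hFun r φ Y ψ p).re ^ 2 ≠ 0 := by positivity
      exact (mul_eq_zero.1 this.symm).resolve_left h3
    simpa using h2

lemma mem_immersionSet_iff (hψ : IsParallelSection r y ψ) (hY : IsAdapted r y φ Y) {p : M}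
    (hp : p ∈ φ.source) : p ∈ immersionSet ψ ↔ hFun r φ Y ψ p ≠ 0 := by
  rw [← injective_fderiv_iff hψ hY hp]
  have hb := mfderiv_chart_bijective hY.1.chart hp
  have e : (mfderiv 𝓘(ℝ, ℂ) 𝓘(ℝ, Fin (n + 2) → ℝ) ψ p : _ → (Fin (n + 2) → ℝ)) =
      (fderiv ℝ (ψ ∘ φ.symm) (φ p)) ∘ (mfderiv 𝓘(ℝ, ℂ) 𝓘(ℝ, ℂ) φ p : _ → ℂ) :=
    funext fun v => mfderiv_eq_fderiv_chart hY.1.chart hp (hψ.sm hY.1) v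
  have : p ∈ immersionSet ψ ↔ Function.Injective
      (mfderiv 𝓘(ℝ, ℂ) 𝓘(ℝ, Fin (n + 2) → ℝ) ψ p : _ → (Fin (n + 2) → ℝ)) := Iff.rfl
  rw [this, e]
  exact Function.Injective.of_comp_iff' _ hb

/-- A parallel section with `⟨ψ, κ⟩ = 0` on an open set vanishes there if the surface is full. -/
lemma IsParallelSection.eq_zero_of_hFun (hψ : IsParallelSection r y ψ) (hfull : IsFull r y)
    (hY : IsAdapted r y φ Y) (h : ∀ q ∈ φ.source, hFun r φ Y ψ q = 0) {p : M}
    (hp : p ∈ φ.source) : ψ p = 0 := by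
  by_contra hne
  have H := hψ.localPolar hY
  -- With h = 0 the structure equation gives dψ = 0; the locally constant vector ψ is then
  -- orthogonal to an open piece of the surface.
  have hz : ∀ q ∈ φ.source, ∂z φ (toC ∘ ψ) q = 0 := fun q hq => by
    rw [H.dz q hq, dc_congr _ h hq, dc_const, h q hq]
    simp
  have hb : ∀ q ∈ φ.source, ∂b φ (toC ∘ ψ) q = 0 := fun q hq => by
    rw [← H.star_dz hq, hz q hq, star_zero]
  have hev := eventually_const_of_fderiv_eq_zero (hψ.sm hY.1) (fun q hq => by
    refine ContinuousLinearMap.ext fun v => toC_injective ?_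
    rw [hψ.fderiv_eq hY hq, hz q hq, hb q hq]
    simp [toC_zero]) hp
  obtain ⟨U, hU1, hU2, hU3⟩ := mem_nhds_iff.1
    (Filter.inter_mem hev (φ.open_source.mem_nhds hp))
  obtain ⟨q, hq, hq'⟩ := hfull U hU2 ⟨p, hU3⟩ (ψ p) hne
  refine hq' (hY.1.lift.ip_rep (hU1 hq).2 ?_)
  have h1 : ψ q = ψ p := (hU1 hq).1
  have h2 := H.X_P q (hU1 hq).2
  rw [Function.comp_apply, Function.comp_apply, ip_toC] at h2
  rw [← h1, ip_comm]
  exact_mod_cast h2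

lemma isOpen_immersionSet (hy : IsIsothermicOn r y univ) (hψ : IsParallelSection r y ψ) :
    IsOpen (immersionSet ψ) := by
  rw [isOpen_iff_mem_nhds]
  intro p hp
  obtain ⟨φ, Y, hpφ, -, hY⟩ := hy p (mem_univ p)
  have h1 := ((hψ.localPolar hY).smh.continuousOn.continuousAt (φ.open_source.mem_nhds hpφ))
  filter_upwards [h1.eventually_ne ((mem_immersionSet_iff hψ hY hpφ).1 hp),
    φ.open_source.mem_nhds hpφ] with q hq hq'
  exact (mem_immersionSet_iff hψ hY hq').2 hq

/-- An adapted coordinate restricted to an open set without immersion points has h = 0 throughout,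
which would make ψ vanish. -/
lemma dense_immersionSet (hy : IsIsothermicOn r y univ) (hfull : IsFull r y)
    (hψ : IsParallelSection r y ψ) (h0 : ∀ p, ψ p ≠ 0) : Dense (immersionSet ψ) := by
  rw [dense_iff_inter_open]
  rintro U hU ⟨p, hp⟩
  obtain ⟨φ, Y, hpφ, -, hY⟩ := hy p (mem_univ p)
  by_contra hne
  have hpr : p ∈ (φ.restr U).source := by
    rw [φ.restr_source' U hU]; exact ⟨hpφ, hp⟩
  refine h0 p (hψ.eq_zero_of_hFun hfull (hY.restr hU) (fun q hq => ?_) hpr)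
  by_contra hq0
  rw [φ.restr_source' U hU] at hq
  exact hne ⟨q, hq.2, (mem_immersionSet_iff hψ hY hq.1).2 hq0⟩

/-- Around each point of an open set there is an adapted coordinate with domain in the set. -/
lemma IsIsothermicOn.exists_adapted (hy : IsIsothermicOn r y univ) {U : Set M} (hU : IsOpen U)
    {p : M} (hp : p ∈ U) : ∃ φ Y, p ∈ φ.source ∧ φ.source ⊆ U ∧ IsAdapted r y φ Y := by
  obtain ⟨φ, Y, hpφ, -, hY⟩ := hy p (mem_univ p)
  refine ⟨φ.restr U, Y, ?_, ?_, hY.restr hU⟩ <;> rw [φ.restr_source' U hU]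
  exacts [⟨hpφ, hp⟩, fun q hq => hq.2]

section Immersed

variable (hψ : IsPolar r y c ψ) (hY : IsAdapted r y φ Y) (hS : φ.source ⊆ immersionSet ψ)
include hψ hY hS

lemma IsPolar.hFun_ne_zero {p : M} (hp : p ∈ φ.source) : hFun r φ Y ψ p ≠ 0 :=
  (mem_immersionSet_iff hψ.section_ hY hp).1 (hS hp)

lemma IsPolar.hFun_re_ne_zero {p : M} (hp : p ∈ φ.source) : (hFun r φ Y ψ p).re ≠ 0 := fun h =>
  hψ.hFun_ne_zero hY hS hp (by rw [hFun_eq_re hψ.section_ hY hp, h, Complex.ofReal_zero])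

lemma IsPolar.normalPart_tangent {p : M} (hp : p ∈ φ.source) (x : Fin (n + 2) → ℂ) :
    normalPart (r + 1) (tangent c φ ψ p) x =
      tpart (r + 1) c (∂z φ (toC ∘ ψ) p) (∂b φ (toC ∘ ψ) p) ((toC ∘ ψ) p) x := by
  have H := hψ.section_.localPolar hY
  rw [tangent, dz_eq_dc, dzb_eq_dc]
  refine Polar.normalPart_tangent (H.dz_dz hp) (H.dzb_dzb hp) ?_ (H.P_dz hp) (H.P_dzb hp) ?_ x
  · rw [H.dz_dzb hp]
    exact mul_ne_zero two_ne_zero (pow_ne_zero 2 (hψ.hFun_ne_zero hY hS hp))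
  · exact (ip_toC _ _ _).trans (by rw [hψ.length])

lemma IsPolar.isAdaptedForm : IsAdaptedForm (r + 1) c ψ φ where
  chart := hY.1.chart
  smooth := (contMDiffOn_source_iff hY.1.chart).2 (hψ.section_.sm hY.1)
  conformal := fun p hp => ⟨4 * (hFun r φ Y ψ p).re ^ 2, by
    have := hψ.hFun_re_ne_zero hY hS hp
    positivity, hψ.section_.ip_fderiv_self hY hp⟩
  real := fun p hp => by
    have H := hψ.section_.localPolar hY
    rw [← star_eq_iff_im]
    have h0 := hψ.hFun_ne_zero hY hS hp
    rw [vecHopf, hψ.normalPart_tangent hY hS hp, dz_eq_dc, dz_eq_dc, H.dzz' hp h0,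
      tpart_add_tangent (H.dz_dz hp) (H.dzb_dzb hp) (by
        rw [H.dz_dzb hp]; exact mul_ne_zero two_ne_zero (pow_ne_zero 2 h0))
        (H.P_dz hp) (H.P_dzb hp)]
    -- Conjugation exchanges ψ_z and ψ_z̄ and so commutes with `tpart`; hence the projection of the
    -- real vector `secondReal` is real.
    simp only [tpart, star_sub, star_smul, star_div₀, star_ip, H.star_secondReal hp, H.star_dz hp,
      H.star_dzb hp, H.real p hp, ip_comm _ (∂b φ (toC ∘ ψ) p) (∂z φ (toC ∘ ψ) p), Complex.star_def,
      Complex.conj_ofReal]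
    abel

lemma IsPolar.toC_polarLift {p : M} (hp : p ∈ φ.source) :
    (toC ∘ polarLift r φ Y ψ) p = (hFun r φ Y ψ p)⁻¹ • (toC ∘ Y) p := by
  rw [Function.comp_apply, polarLift, toC_smul, Complex.ofReal_inv]
  have := hFun_eq_re hψ.section_ hY hp
  rw [this]
  rfl

lemma IsPolar.isLiftOn : IsLiftOn r y φ.source (polarLift r φ Y ψ) where
  smooth := by
    rw [contMDiffOn_source_iff hY.1.chart]
    exact ((hψ.section_.localPolar hY).smh.re.rinv fun p hp =>
      hψ.hFun_re_ne_zero hY hS hp).rsmul hY.1.sm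
  lift := fun p hp => by
    obtain ⟨h0, h1⟩ := hY.1.lift.lift p hp
    have h2 : (hFun r φ Y ψ p).re⁻¹ ≠ 0 := inv_ne_zero (hψ.hFun_re_ne_zero hY hS hp)
    refine ⟨smul_ne_zero h2 h0, ?_⟩
    rw [← h1]
    exact (Projectivization.mk_eq_mk_iff' ℝ _ _ _ _).2 ⟨_, rfl⟩

lemma IsPolar.isDual : IsDual φ (polarLift r φ Y ψ) ψ := fun p hp => by
  have H := hψ.section_.localPolar hY
  have h0 := fun q hq => hψ.hFun_ne_zero hY hS (p := q) hq
  refine ⟨-(1 / (2 * hFun r φ Y ψ p ^ 2)), ?_, ?_⟩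
  · exact neg_ne_zero.2 (one_div_ne_zero (mul_ne_zero two_ne_zero (pow_ne_zero 2 (h0 p hp))))
  · rw [dz_eq_dc, dzb_eq_dc, ← H.dz_dual h0 hp]
    exact dc_congr _ (fun q hq => hψ.toC_polarLift hY hS hq) hp

/-- Parallelism is duality: the z-derivative of the lift is a multiple of ψ_z̄, hence tangent to ψ.
Minimality holds because ψ_zz̄ and the tangent space, including ψ itself, are all orthogonal to Y.
-/
lemma IsPolar.isParallelIsoperimetric :
    IsParallelIsoperimetric (r + 1) c φ ψ (polarLift r φ Y ψ) 0 where
  smooth := (hψ.isLiftOn hY hS).smooth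
  ne_zero := fun p hp => ((hψ.isLiftOn hY hS).lift p hp).1
  normal := fun p hp => by
    have H := hψ.section_.localPolar hY
    rw [tangent, mem_perp_span, dz_eq_dc, dzb_eq_dc]
    have e := hψ.toC_polarLift hY hS hp
    rw [Function.comp_apply] at e
    rintro v ((rfl | rfl) | ⟨-, rfl⟩)
    · rw [e, ip_smul_left, H.X_dz hp, mul_zero]
    · rw [e, ip_smul_left, H.X_dzb hp, mul_zero]
    · rw [e, ip_smul_left]
      exact mul_eq_zero_of_right _ (H.X_P p hp)
  parallel := fun p hp => by
    have H := hψ.section_.localPolar hY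
    obtain ⟨l, -, hl⟩ := hψ.isDual hY hS p hp
    have h0 := hψ.hFun_ne_zero hY hS hp
    rw [hl, hψ.normalPart_tangent hY hS hp, dzb_eq_dc]
    have := tpart_add_tangent (c := c) (H.dz_dz hp) (H.dzb_dzb hp) (by
        rw [H.dz_dzb hp]; exact mul_ne_zero two_ne_zero (pow_ne_zero 2 h0))
        (H.P_dz hp) (H.P_dzb hp) 0 0 l
    rw [zero_smul, add_zero, zero_add] at this
    rw [this]
    simp [tpart, ip_zero_left]
  isoperimetric := fun p hp => by
    have H := hψ.section_.localPolar hY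
    have e := hψ.toC_polarLift hY hS hp
    rw [Function.comp_apply] at e
    rw [meanCurv, hψ.normalPart_tangent hY hS hp, dz_eq_dc, dzb_eq_dc, dzb_eq_dc, e]
    simp only [tpart, ip_smul_left, ip_smul_right, ip_sub_right, H.X_dz hp, H.X_dzb hp, H.X_P p hp,
      H.X_dzbz hp, mul_zero, sub_zero]

end Immersed

end PolarForm

end

section

local notation "∂z" => dc (-Complex.I)
local notation "∂b" => dc Complex.I

/-! ### Comparison and rescaling of lifts. -/

section Ratio

variable {m : ℕ}

/-- The form of index 0 is Euclidean. It extracts the ratio of two lifts smoothly, which the light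
cone form cannot do, since it vanishes on them. -/
lemma ip_zero_self_ne_zero {x : Fin m → ℝ} (hx : x ≠ 0) : ip 0 x x ≠ 0 := by
  have e : ip 0 x x = ∑ i, x i ^ 2 := Finset.sum_congr rfl fun i _ => by
    rw [if_pos (by simp)]; ring
  rw [e]
  intro h
  rw [Finset.sum_eq_zero_iff_of_nonneg fun i _ => sq_nonneg _] at h
  exact hx (funext fun i => by simpa using h i (Finset.mem_univ i))

variable {M : Type*} [TopologicalSpace M] [ChartedSpace ℂ M] [IsManifold 𝓘(ℝ, ℂ) ∞ M] {n r : ℕ}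
variable {φ : OpenPartialHomeomorph M ℂ} {y : M → Quadric n r} {Y Y' : M → Fin (n + 2) → ℝ}

/-- Two lifts of a surface differ by a smooth function without zeros. -/
lemma IsLiftOn.exists_ratio (hφ : φ ∈ IsManifold.maximalAtlas 𝓘(ℝ, ℂ) ∞ M)
    (h : IsLiftOn r y φ.source Y) (h' : IsLiftOn r y φ.source Y') :
    ∃ a : M → ℝ, Sm φ a ∧ ∀ p ∈ φ.source, a p ≠ 0 ∧ Y' p = a p • Y p := by
  have s := (contMDiffOn_source_iff hφ).1 h.smooth
  have s' := (contMDiffOn_source_iff hφ).1 h'.smooth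
  refine ⟨fun p => ip 0 (Y' p) (Y p) * (ip 0 (Y p) (Y p))⁻¹, (s'.rip 0 s).rmul
    ((s.rip 0 s).rinv fun p hp => ip_zero_self_ne_zero (h.lift p hp).1), fun p hp => ?_⟩
  obtain ⟨h0, h1⟩ := h.lift p hp
  obtain ⟨h0', h1'⟩ := h'.lift p hp
  obtain ⟨a, ha⟩ := (Projectivization.mk_eq_mk_iff' ℝ _ _ h0' h0).1 (h1'.trans h1.symm)
  have e : ip 0 (Y' p) (Y p) * (ip 0 (Y p) (Y p))⁻¹ = a := by
    rw [← ha, ip_smul_left, mul_assoc, mul_inv_cancel₀ (ip_zero_self_ne_zero h0), mul_one]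
  simp only [e]
  refine ⟨?_, ha.symm⟩
  rintro rfl
  exact h0' (by rw [← ha, zero_smul])

/-- Rescaling a lift. -/
lemma IsLiftOn.smul (hφ : φ ∈ IsManifold.maximalAtlas 𝓘(ℝ, ℂ) ∞ M) (h : IsLiftOn r y φ.source Y)
    {a : M → ℝ} (ha : Sm φ a) (h0 : ∀ p ∈ φ.source, a p ≠ 0) :
    IsLiftOn r y φ.source (fun p => a p • Y p) where
  smooth := (contMDiffOn_source_iff hφ).2 (ha.rsmul ((contMDiffOn_source_iff hφ).1 h.smooth))
  lift := fun p hp => by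
    obtain ⟨h1, h2⟩ := h.lift p hp
    refine ⟨smul_ne_zero (h0 p hp) h1, ?_⟩
    rw [← h2]
    exact (Projectivization.mk_eq_mk_iff' ℝ _ _ _ _).2 ⟨_, rfl⟩

end Ratio

/-! ### A criterion for a real Hopf differential. -/

section Real

variable {M : Type*} [TopologicalSpace M] [ChartedSpace ℂ M] [IsManifold 𝓘(ℝ, ℂ) ∞ M] {n r : ℕ}
variable {φ : OpenPartialHomeomorph M ℂ} {Y : M → Fin (n + 2) → ℝ}

/-- `κ` is real if `Im Y_zz` is in the span of `Y, Y_z, Y_z̄`. -/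
lemma star_hopf_of_im_tangent (h : Canon (r + 1) φ (toC ∘ Y)) {p : M} (hp : p ∈ φ.source)
    {a b c : ℂ} (habc : ∂z φ (∂z φ (toC ∘ Y)) p - ∂b φ (∂b φ (toC ∘ Y)) p =
      a • (toC ∘ Y) p + b • ∂z φ (toC ∘ Y) p + c • ∂b φ (toC ∘ Y) p) :
    star (hopf r φ Y p) = hopf r φ Y p := by
  have h1 := hopf_mem_perp h hp
  rw [confTangent_eq] at h1
  have h2 : star (hopf r φ Y p) ∈ perp (r + 1) (Submodule.span ℂ
      {(toC ∘ Y) p, ∂z φ (toC ∘ Y) p, ∂b φ (toC ∘ Y) p, ∂b φ (∂z φ (toC ∘ Y)) p}) := by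
    rw [mem_perp_four] at h1 ⊢
    have := fun {x : Fin (n + 2) → ℂ} (hx : ip (r + 1) (hopf r φ Y p) x = 0) =>
      (star_ip (r + 1) (hopf r φ Y p) x).symm.trans (by rw [hx, star_zero])
    obtain ⟨e1, e2, e3, e4⟩ := h1
    have f1 := this e1
    have f2 := this e2
    have f3 := this e3
    have f4 := this e4
    rw [h.real p hp] at f1
    rw [h.star_dz hp] at f2
    rw [h.star_dzb hp] at f3
    rw [h.star_W hp] at f4
    exact ⟨f1, f3, f2, f4⟩
  -- The difference κ̄ - κ is normal, and by hypothesis it is also tangent.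
  refine sub_eq_zero.1 ((h.gram hp).nondeg _ ?_ (perp_sub h2 h1))
  rw [mem_span_four, hopf_eq h hp, star_add, star_smul, h.star_dzz hp, h.real p hp]
  generalize (2 * ip (r + 1) (∂z φ (∂z φ (toC ∘ Y)) p) (∂b φ (∂z φ (toC ∘ Y)) p)) = k
  refine ⟨-a + star k - k, -b, -c, 0, ?_⟩
  have : ∂b φ (∂b φ (toC ∘ Y)) p + star k • (toC ∘ Y) p - (∂z φ (∂z φ (toC ∘ Y)) p +
      k • (toC ∘ Y) p) = -(∂z φ (∂z φ (toC ∘ Y)) p - ∂b φ (∂b φ (toC ∘ Y)) p) +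
      star k • (toC ∘ Y) p - k • (toC ∘ Y) p := by abel
  rw [this, habc]
  module

lemma ip_hopf_hopf (h : Canon (r + 1) φ (toC ∘ Y)) {p : M} (hp : p ∈ φ.source) :
    ip (r + 1) (hopf r φ Y p) (hopf r φ Y p) =
      ip (r + 1) (∂z φ (∂z φ (toC ∘ Y)) p) (∂z φ (∂z φ (toC ∘ Y)) p) := by
  simp only [hopf_eq h hp, ip_add_left, ip_add_right, ip_smul_left, ip_smul_right,
    ip_comm _ _ ((toC ∘ Y) p), h.X_dzz hp, h.null p hp]
  ring

end Real

/-! ### The conformal class of a polar transform and its invariant metric. -/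

section Conformal

variable {M : Type*} [TopologicalSpace M] [ChartedSpace ℂ M] [IsManifold 𝓘(ℝ, ℂ) ∞ M]
variable {n r n' r' : ℕ}

/-- The surface `η` has a null lift obtained from `ψ` by an affine isometric embedding. -/
structure ConfModel (r r' : ℕ) (ψ : M → Fin (n + 2) → ℝ) (η : M → Quadric n' r') where
  F : M → Fin (n' + 2) → ℝ
  ι : (Fin (n + 2) → ℂ) →L[ℂ] (Fin (n' + 2) → ℂ)
  b : Fin (n' + 2) → ℂ
  isometry : ∀ x x', ip (r' + 1) (ι x) (ι x') = ip (r + 1) x x'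
  F_eq : ∀ p, toC (F p) = ι (toC (ψ p)) + b
  ne_zero : ∀ p, F p ≠ 0
  lift : ∀ p, Projectivization.mk ℝ (F p) (ne_zero p) = (η p).1

variable {φ : OpenPartialHomeomorph M ℂ} {y : M → Quadric n r} {Y ψ : M → Fin (n + 2) → ℝ} {c : ℝ}
variable {η : M → Quadric n' r'}

/-- Since ψ_z lies in V and κ is normal, h_z = ⟨ψ, κ_z⟩ = ⟨ψ, D_z κ⟩; the quotient in the metric is
therefore the logarithmic derivative of h. -/
lemma IsParallelSection.polarMetric_eq (hψ : IsParallelSection r y ψ) (hY : IsAdapted r y φ Y)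
    {p : M} (hp : p ∈ φ.source) :
    polarMetric r φ Y ψ p = ip (r + 1) (hopf r φ Y p) (hopf r φ Y p) +
      ∂b φ (fun q => ∂z φ (hFun r φ Y ψ) q / hFun r φ Y ψ q) p := by
  have H := hψ.localPolar hY
  have hX := H.canon
  rw [polarMetric, dzb_eq_dc]
  congr 1
  refine dc_congr _ (fun q hq => ?_) hp
  have g1 : ip (r + 1) (toC (ψ q)) (normalDz r φ Y (hopf r φ Y) q) =
      ∂z φ (hFun r φ Y ψ) q := by
    have sκ := sm_hopf hX
    have g2 : ip (r + 1) (toC (ψ q)) (normalDz r φ Y (hopf r φ Y) q) =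
        ip (r + 1) (toC (ψ q)) (∂z φ (hopf r φ Y) q) := by
      rw [normalDz, dz_eq_dc, confTangent_eq, (hX.gram hq).normalPart_eq, npart]
      obtain ⟨p1, p2, p3, p4⟩ := hψ.perp hY.1 hq
      simp only [Function.comp_apply (f := toC) (g := ψ)] at p1 p2 p3 p4
      simp only [ip_add_right, ip_sub_right, ip_smul_right, ip_comm _ (toC (ψ q)) ((toC ∘ Y) q),
        ip_comm _ (toC (ψ q)) (∂z φ (toC ∘ Y) q), ip_comm _ (toC (ψ q)) (∂b φ (toC ∘ Y) q),
        ip_comm _ (toC (ψ q)) (∂b φ (∂z φ (toC ∘ Y)) q), p1, p2, p3, p4]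
      ring
    have g3 := dc_ip (r + 1) (-Complex.I) H.sm sκ hq
    have g4 : ip (r + 1) (∂z φ (toC ∘ ψ) q) (hopf r φ Y q) = 0 := by
      have := hopf_mem_perp hX hq
      rw [confTangent_eq, mem_perp_four] at this
      rw [H.dz q hq, ip_comm]
      simp only [ip_sub_right, ip_smul_right, this.1, this.2.2.1]
      ring
    rw [g2]
    rw [g4, zero_add] at g3
    exact g3.symm
  rw [g1]
  rfl

namespace ConfModel

variable (C : ConfModel r r' ψ η) (hψ : IsPolar r y c ψ) (hY : IsAdapted r y φ Y)

include hψ hY in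
lemma sm : Sm φ C.F := by
  have h1 : Sm φ (toC ∘ C.F) := Sm.congr
    ((((hψ.section_.sm hY.1).toC.clm (C.ι.restrictScalars ℝ)).add (Sm.const C.b)))
    fun p _ => C.F_eq p
  exact Sm.pi fun i => (h1.apply i).re

include hψ hY in
lemma isLiftOn : IsLiftOn r' η φ.source C.F where
  smooth := (contMDiffOn_source_iff hY.1.chart).2 (C.sm hψ hY)
  lift := fun p _ => ⟨C.ne_zero p, C.lift p⟩

include hψ hY in
lemma dc_F (d : ℂ) {p : M} (hp : p ∈ φ.source) :
    dc d φ (toC ∘ C.F) p = C.ι (dc d φ (toC ∘ ψ) p) := by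
  have s := (hψ.section_.sm hY.1).toC
  have e : toC ∘ C.F = fun q => (C.ι.restrictScalars ℝ) ((toC ∘ ψ) q) + C.b :=
    funext C.F_eq
  rw [e, dc_add d (s.clm (C.ι.restrictScalars ℝ)) (Sm.const C.b) hp, dc_const, add_zero]
  exact dc_clm d s C.ι hp

include hψ hY in
lemma dc_dc_F (d e : ℂ) {p : M} (hp : p ∈ φ.source) :
    dc d φ (dc e φ (toC ∘ C.F)) p = C.ι (dc d φ (dc e φ (toC ∘ ψ)) p) := by
  rw [dc_congr d (fun q hq => C.dc_F hψ hY e hq) hp]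
  exact dc_clm d ((hψ.section_.sm hY.1).toC.dc e) C.ι hp

include hψ hY in
lemma F_F {p : M} (hp : p ∈ φ.source) : ip (r' + 1) ((toC ∘ C.F) p) ((toC ∘ C.F) p) = 0 :=
  (ip_toC _ _ _).trans (by rw [(C.isLiftOn hψ hY).null hp, Complex.ofReal_zero])

include hψ hY in
lemma F_dc (d : ℂ) {p : M} (hp : p ∈ φ.source) :
    ip (r' + 1) ((toC ∘ C.F) p) (dc d φ (toC ∘ C.F) p) = 0 :=
  ip_dc_self d (C.sm hψ hY).toC (fun _ hq => C.F_F hψ hY hq) hp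

include hψ hY in
lemma F_dzbz {p : M} (hp : p ∈ φ.source) :
    ip (r' + 1) ((toC ∘ C.F) p) (∂b φ (∂z φ (toC ∘ C.F)) p) = -(2 * hFun r φ Y ψ p ^ 2) := by
  have H := hψ.section_.localPolar hY
  have s := (C.sm hψ hY).toC
  have := ip_dc_eq_neg Complex.I s (s.dc (-Complex.I)) (fun _ hq => C.F_dc hψ hY _ hq) hp
  rw [C.dc_F hψ hY _ hp, C.dc_F hψ hY _ hp, C.isometry, ip_comm, H.dz_dzb hp] at this
  rw [this, neg_neg]

variable (hS : φ.source ⊆ immersionSet ψ)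

include hψ hY hS in
-- As F is null and orthogonal to its derivatives, derivatives of the factor a do not enter the
-- induced metric: rescaling multiplies it by a².
lemma canon_smul {a : M → ℝ} (ha : Sm φ a)
    (ha2 : ∀ p ∈ φ.source, (a p : ℂ) ^ 2 * (4 * hFun r φ Y ψ p ^ 2) = 1) :
    Canon (r' + 1) φ (toC ∘ fun p => a p • C.F p) := by
  have H := hψ.section_.localPolar hY
  have s := (C.sm hψ hY).toC
  have e : (toC ∘ fun p => a p • C.F p) = fun p => (a p : ℂ) • (toC ∘ C.F) p :=
    funext fun p => toC_smul _ _
  have hz : ∀ d, ∀ p ∈ φ.source, dc d φ (toC ∘ fun p => a p • C.F p) p =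
      dc d φ (fun q => (a q : ℂ)) p • (toC ∘ C.F) p + (a p : ℂ) • C.ι (dc d φ (toC ∘ ψ) p) :=
    fun d p hp => by rw [e, dc_smul d ha.ofReal s hp, C.dc_F hψ hY d hp]
  have h1 : ∀ d, ∀ p ∈ φ.source, ip (r' + 1) ((toC ∘ C.F) p) (C.ι (dc d φ (toC ∘ ψ) p)) = 0 :=
    fun d p hp => by rw [← C.dc_F hψ hY d hp, C.F_dc hψ hY d hp]
  refine ⟨(ha.rsmul (C.sm hψ hY)).toC, fun p _ => star_toC _, fun p hp => ?_, fun p hp => ?_,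
    fun p hp => ?_⟩
  · simp only [e, ip_smul_left, ip_smul_right, C.F_F hψ hY hp, mul_zero]
  · simp only [hz _ p hp, ip_add_left, ip_add_right, ip_smul_left, ip_smul_right, C.F_F hψ hY hp,
      h1 _ p hp, ip_comm _ _ ((toC ∘ C.F) p), C.isometry, H.dz_dz hp]
    ring
  · simp only [hz _ p hp, ip_add_left, ip_add_right, ip_smul_left, ip_smul_right, C.F_F hψ hY hp,
      h1 _ p hp, ip_comm _ _ ((toC ∘ C.F) p), C.isometry, H.dz_dzb hp]
    linear_combination (1 / 2 : ℂ) * ha2 p hp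

include hψ hY hS in
-- The isometric embedding gives F the metric 4h²|dz|² of ψ, whence the factor 1/(2h).
lemma isCanonicalLift : IsCanonicalLift r' η φ
    (fun p => (2 * (hFun r φ Y ψ p).re)⁻¹ • C.F p) := by
  have H := hψ.section_.localPolar hY
  have h0 : ∀ p ∈ φ.source, 2 * (hFun r φ Y ψ p).re ≠ 0 := fun p hp =>
    mul_ne_zero two_ne_zero (hψ.hFun_re_ne_zero hY hS hp)
  have ha : Sm φ fun p => (2 * (hFun r φ Y ψ p).re)⁻¹ :=
    ((Sm.const (2 : ℝ)).rmul H.smh.re).rinv h0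
  refine isCanonicalLift_of_canon hY.1.chart
    ((C.isLiftOn hψ hY).smul hY.1.chart ha fun p hp => inv_ne_zero (h0 p hp))
    (C.canon_smul hψ hY hS ha fun p hp => ?_)
  rw [hFun_eq_re hψ.section_ hY hp]
  have := hψ.hFun_re_ne_zero hY hS hp
  rw [← Complex.ofReal_ne_zero] at this
  push_cast
  simp only [Complex.ofReal_re]
  field_simp
  norm_num

include hψ hY hS in
-- The criterion `star_hopf_of_im_tangent` tolerates all terms in F, F_z, F_z̄ created by rescaling,
-- so only the second derivatives of F itself matter.
lemma isAdapted : IsAdapted r' η φ (fun p => (2 * (hFun r φ Y ψ p).re)⁻¹ • C.F p) := by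
  have hL := C.isCanonicalLift hψ hY hS
  refine isAdapted_iff.2 ⟨hL, fun p hp => ?_⟩
  have H := hψ.section_.localPolar hY
  have s := (C.sm hψ hY).toC
  have h0 := hψ.hFun_ne_zero hY hS hp
  have hr : ∀ p ∈ φ.source, 2 * (hFun r φ Y ψ p).re ≠ 0 := fun p hp =>
    mul_ne_zero two_ne_zero (hψ.hFun_re_ne_zero hY hS hp)
  have ha : Sm φ fun p => (2 * (hFun r φ Y ψ p).re)⁻¹ :=
    ((Sm.const (2 : ℝ)).rmul H.smh.re).rinv hr
  set a : M → ℝ := fun p => (2 * (hFun r φ Y ψ p).re)⁻¹ with ha_def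
  have ha0 : (a p : ℂ) ≠ 0 := Complex.ofReal_ne_zero.2 (inv_ne_zero (hr p hp))
  have e : (toC ∘ fun p => a p • C.F p) = fun p => (a p : ℂ) • (toC ∘ C.F) p :=
    funext fun p => toC_smul _ _
  have e1 : ∀ d, ∀ p ∈ φ.source, dc d φ (toC ∘ fun p => a p • C.F p) p =
      dc d φ (fun q => (a q : ℂ)) p • (toC ∘ C.F) p + (a p : ℂ) • dc d φ (toC ∘ C.F) p :=
    fun d p hp => by rw [e, dc_smul d ha.ofReal s hp]
  have e2 : ∀ d, dc d φ (dc d φ (toC ∘ fun p => a p • C.F p)) p =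
      dc d φ (dc d φ (fun q => (a q : ℂ))) p • (toC ∘ C.F) p +
      (2 * dc d φ (fun q => (a q : ℂ)) p) • dc d φ (toC ∘ C.F) p +
      (a p : ℂ) • dc d φ (dc d φ (toC ∘ C.F)) p := fun d => by
    rw [dc_congr d (e1 d) hp, dc_add d ((ha.ofReal.dc d).smul s) (ha.ofReal.smul (s.dc d)) hp,
      dc_smul d (ha.ofReal.dc d) s hp, dc_smul d ha.ofReal (s.dc d) hp]
    module
  -- The real vector `secondReal` cancels in ψ_zz - ψ_z̄z̄ and only tangential terms are left.
  have e3 : ∂z φ (∂z φ (toC ∘ C.F)) p - ∂b φ (∂b φ (toC ∘ C.F)) p =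
      (2 * (∂z φ (hFun r φ Y ψ) p / hFun r φ Y ψ p)) • ∂z φ (toC ∘ C.F) p -
      (2 * (∂b φ (hFun r φ Y ψ) p / hFun r φ Y ψ p)) • ∂b φ (toC ∘ C.F) p := by
    have f1 := H.dzz' hp h0
    have f2 : ∂b φ (∂b φ (toC ∘ ψ)) p = star (∂z φ (∂z φ (toC ∘ ψ)) p) := by
      rw [star_dc_dc H.sm H.real _ _ hp, star_neg_I]
    rw [C.dc_dc_F hψ hY _ _ hp, C.dc_dc_F hψ hY _ _ hp, C.dc_F hψ hY _ hp, C.dc_F hψ hY _ hp,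
      ← map_sub, ← map_smul, ← map_smul, ← map_sub, f2, f1]
    simp only [star_add, star_smul, star_div₀, star_neg, H.star_secondReal hp, H.star_dz hp,
      H.star_dzb hp, H.star_dzh hp, H.star_dzbh hp, H.realh p hp]
    congr 1
    module
  have e4 : ∀ d, dc d φ (toC ∘ C.F) p = (a p : ℂ)⁻¹ •
      (dc d φ (toC ∘ fun p => a p • C.F p) p - dc d φ (fun q => (a q : ℂ)) p • (toC ∘ C.F) p) :=
    fun d => by rw [e1 d p hp, add_sub_cancel_left, smul_smul, inv_mul_cancel₀ ha0, one_smul]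
  have e5 : (toC ∘ C.F) p = (a p : ℂ)⁻¹ • (toC ∘ fun p => a p • C.F p) p := by
    rw [e, smul_smul, inv_mul_cancel₀ ha0, one_smul]
  have e6 : ∂z φ (∂z φ (toC ∘ fun p => a p • C.F p)) p -
      ∂b φ (∂b φ (toC ∘ fun p => a p • C.F p)) p =
      (∂z φ (∂z φ (fun q => (a q : ℂ))) p - ∂b φ (∂b φ (fun q => (a q : ℂ))) p) •
        (toC ∘ C.F) p +
      (2 * ∂z φ (fun q => (a q : ℂ)) p + a p * (2 * (∂z φ (hFun r φ Y ψ) p / hFun r φ Y ψ p))) •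
        ∂z φ (toC ∘ C.F) p +
      (-(2 * ∂b φ (fun q => (a q : ℂ)) p +
        a p * (2 * (∂b φ (hFun r φ Y ψ) p / hFun r φ Y ψ p)))) • ∂b φ (toC ∘ C.F) p := by
    have f3 : ∀ x1 x2 x3 y1 y2 y3 : Fin (n' + 2) → ℂ, x1 + x2 + x3 - (y1 + y2 + y3) =
      x1 - y1 + (x2 - y2) + (x3 - y3) := fun _ _ _ _ _ _ => by abel
    rw [e2, e2, f3, ← smul_sub, e3]
    module
  rw [e4, e4, e5] at e6
  have lin : ∀ (k l : ℂ) (k1 k2 k3 l' : ℂ) (x u v : Fin (n' + 2) → ℂ),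
      k1 • k • x + k2 • k • (u - l • k • x) + k3 • k • (v - l' • k • x) =
      (k1 * k - k2 * k * l * k - k3 * k * l' * k) • x + (k2 * k) • u + (k3 * k) • v :=
    fun _ _ _ _ _ _ _ _ _ => by module
  exact star_hopf_of_im_tangent hL.canon hp (e6.trans (lin _ _ _ _ _ _ _ _ _))

include C hψ hY hS in
-- Any canonical lift is A F with 4A²h² = 1. The sign of A is not fixed, so the computation of
-- ⟨(AF)_zz̄, (AF)_zz̄⟩ uses only A² and logarithmic derivatives of A. The term ⟨κ, κ⟩ comes from
-- ⟨F_zz̄, F_zz̄⟩ = 4h²⟨κ, κ⟩.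
lemma confMetric_eq {Y' : M → Fin (n' + 2) → ℝ} (hY' : IsCanonicalLift r' η φ Y') {p : M}
    (hp : p ∈ φ.source) : confMetric r' φ Y' p = polarMetric r φ Y ψ p := by
  have H := hψ.section_.localPolar hY
  have hX := H.canon
  have s := (C.sm hψ hY).toC
  obtain ⟨a, ha, ha'⟩ := (C.isLiftOn hψ hY).exists_ratio hY.1.chart hY'.lift
  set A : M → ℂ := fun q => (a q : ℂ) with hA
  have sA : Sm φ A := ha.ofReal
  have h0 : ∀ q ∈ φ.source, hFun r φ Y ψ q ≠ 0 := fun q hq => hψ.hFun_ne_zero hY hS hq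
  have e : ∀ q ∈ φ.source, (toC ∘ Y') q = A q • (toC ∘ C.F) q := fun q hq => by
    rw [Function.comp_apply, (ha' q hq).2, toC_smul]; rfl
  have e1 : ∀ d, ∀ q ∈ φ.source, dc d φ (toC ∘ Y') q = dc d φ A q • (toC ∘ C.F) q +
      A q • dc d φ (toC ∘ C.F) q := fun d q hq => by
    rw [dc_congr d e hq, dc_smul d sA s hq]
  have hA2 : ∀ q ∈ φ.source, A q ^ 2 * (4 * hFun r φ Y ψ q ^ 2) = 1 := fun q hq => by
    have := hY'.canon.unit q hq
    rw [e1 _ q hq, e1 _ q hq] at this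
    simp only [ip_add_left, ip_add_right, ip_smul_left, ip_smul_right, C.F_F hψ hY hq,
      C.F_dc hψ hY _ hq, ip_comm _ _ ((toC ∘ C.F) q)] at this
    rw [C.dc_F hψ hY _ hq, C.dc_F hψ hY _ hq, C.isometry, H.dz_dzb hq] at this
    linear_combination 2 * this
  -- The derivative of A h vanishes: its square is the constant 1/4, and A h has no zeros.
  have hd : ∀ d, ∀ q ∈ φ.source,
      dc d φ A q * hFun r φ Y ψ q + A q * dc d φ (hFun r φ Y ψ) q = 0 := fun d q hq => by
    have sAh := sA.mul H.smh
    have : dc d φ (fun q => (A q * hFun r φ Y ψ q) * (A q * hFun r φ Y ψ q)) q = 0 := by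
      rw [dc_congr d (G := fun _ => 1 / 4) (fun x hx => by linear_combination hA2 x hx / 4) hq,
        dc_const]
    rw [dc_mul d sAh sAh hq, dc_mul d sA H.smh hq] at this
    have h1 : A q * hFun r φ Y ψ q ≠ 0 := fun h => by
      have := hA2 q hq
      rw [show A q ^ 2 * (4 * hFun r φ Y ψ q ^ 2) = 4 * (A q * hFun r φ Y ψ q) ^ 2 by ring, h]
        at this
      norm_num at this
    have h2 : (dc d φ A q * hFun r φ Y ψ q + A q * dc d φ (hFun r φ Y ψ) q) *
        (A q * hFun r φ Y ψ q) = 0 := by linear_combination this / 2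
    exact (mul_eq_zero.1 h2).resolve_right h1
  have hdd : ∂b φ (∂z φ A) p * hFun r φ Y ψ p + ∂z φ A p * ∂b φ (hFun r φ Y ψ) p +
      (∂b φ A p * ∂z φ (hFun r φ Y ψ) p + A p * ∂b φ (∂z φ (hFun r φ Y ψ)) p) = 0 := by
    have s1 := (sA.dc (-Complex.I)).mul H.smh
    have s2 := sA.mul (H.smh.dc (-Complex.I))
    rw [← dc_mul _ (sA.dc _) H.smh hp, ← dc_mul _ sA (H.smh.dc _) hp, ← dc_add _ s1 s2 hp,
      dc_congr _ (hd (-Complex.I)) hp, dc_const]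
  have e2 : ∂b φ (∂z φ (toC ∘ Y')) p = ∂b φ (∂z φ A) p • (toC ∘ C.F) p +
      ∂z φ A p • ∂b φ (toC ∘ C.F) p + ∂b φ A p • ∂z φ (toC ∘ C.F) p +
      A p • ∂b φ (∂z φ (toC ∘ C.F)) p := by
    rw [dc_congr _ (e1 _) hp, dc_add _ ((sA.dc _).smul s) (sA.smul (s.dc _)) hp,
      dc_smul _ (sA.dc _) s hp, dc_smul _ sA (s.dc _) hp]
    abel
  have f1 : ip (r' + 1) (∂z φ (toC ∘ C.F) p) (∂b φ (∂z φ (toC ∘ C.F)) p) = 0 := by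
    rw [C.dc_F hψ hY _ hp, C.dc_dc_F hψ hY _ _ hp, C.isometry]
    exact ip_dc_self _ (H.sm.dc _) (fun q hq => H.dz_dz hq) hp
  have f2 : ip (r' + 1) (∂b φ (toC ∘ C.F) p) (∂b φ (∂z φ (toC ∘ C.F)) p) = 0 := by
    rw [C.dc_F hψ hY _ hp, C.dc_dc_F hψ hY _ _ hp, C.isometry, dc_comm _ _ H.sm hp]
    exact ip_dc_self _ (H.sm.dc _) (fun q hq => H.dzb_dzb hq) hp
  have f3 : ip (r' + 1) (∂b φ (∂z φ (toC ∘ C.F)) p) (∂b φ (∂z φ (toC ∘ C.F)) p) =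
      4 * hFun r φ Y ψ p ^ 2 * ip (r + 1) (hopf r φ Y p) (hopf r φ Y p) := by
    have g1 : ip (r + 1) ((toC ∘ Y) p) (∂b φ (∂b φ (toC ∘ Y)) p) = 0 := by
      have := congrArg star (hX.X_dzz hp)
      rwa [star_ip, hX.star_dzz hp, hX.real p hp, star_zero] at this
    have g2 : ip (r + 1) (∂b φ (∂b φ (toC ∘ Y)) p) (∂b φ (∂b φ (toC ∘ Y)) p) =
        ip (r + 1) (hopf r φ Y p) (hopf r φ Y p) := by
      rw [← hX.star_dzz hp, ← star_ip, ← ip_hopf_hopf hX hp, star_ip, (isAdapted_iff.1 hY).2 p hp]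
    rw [C.dc_dc_F hψ hY _ _ hp, C.isometry, H.dzbz hp]
    simp only [ip_sub_left, ip_sub_right, ip_smul_left, ip_smul_right, g1, g2, hX.null p hp,
      ip_comm _ _ ((toC ∘ Y) p)]
    ring
  have f4 : ∀ d, ip (r' + 1) (dc d φ (toC ∘ C.F) p) (dc d φ (toC ∘ C.F) p) =
      ip (r + 1) (dc d φ (toC ∘ ψ) p) (dc d φ (toC ∘ ψ) p) := fun d => by
    rw [C.dc_F hψ hY _ hp, C.isometry]
  have f5 : ip (r' + 1) (∂z φ (toC ∘ C.F) p) (∂b φ (toC ∘ C.F) p) = 2 * hFun r φ Y ψ p ^ 2 := by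
    rw [C.dc_F hψ hY _ hp, C.dc_F hψ hY _ hp, C.isometry, H.dz_dzb hp]
  rw [Polar.confMetric_eq hY'.canon hp, hψ.section_.polarMetric_eq hY hp, dc_div _ (H.smh.dc _) H.smh h0 hp, e2]
  simp only [ip_add_left, ip_add_right, ip_smul_left, ip_smul_right, C.F_F hψ hY hp,
    C.F_dc hψ hY _ hp, C.F_dzbz hψ hY hp, ip_comm _ _ ((toC ∘ C.F) p), f4, H.dz_dz hp,
    H.dzb_dzb hp, f5, ip_comm _ (∂b φ (toC ∘ C.F) p) (∂z φ (toC ∘ C.F) p),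
    ip_comm _ (∂b φ (∂z φ (toC ∘ C.F)) p) (∂z φ (toC ∘ C.F) p),
    ip_comm _ (∂b φ (∂z φ (toC ∘ C.F)) p) (∂b φ (toC ∘ C.F) p), f1, f2, f3]
  have k0 := h0 p hp
  have k1 := hA2 p hp
  have k2 := hd (-Complex.I) p hp
  have k3 := hd Complex.I p hp
  generalize hFun r φ Y ψ = h at *
  generalize ip (r + 1) (hopf r φ Y p) (hopf r φ Y p) = κ at *
  -- Derivatives of A are replaced by derivatives of h; afterwards A occurs only as A², which `k1`
  -- eliminates.
  have k4 : ∂z φ A p = -(A p * ∂z φ h p) / h p := by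
    rw [eq_div_iff k0]; linear_combination k2
  have k5 : ∂b φ A p = -(A p * ∂b φ h p) / h p := by
    rw [eq_div_iff k0]; linear_combination k3
  have k6 : ∂b φ (∂z φ A) p = -(∂z φ A p * ∂b φ h p +
      (∂b φ A p * ∂z φ h p + A p * ∂b φ (∂z φ h) p)) / h p := by
    rw [eq_div_iff k0]; linear_combination hdd
  rw [k6, k4, k5]
  field_simp
  linear_combination (-(∂z φ h p * ∂b φ h p * h p ^ 2) + h p ^ 3 * ∂b φ (∂z φ h) p +
    h p ^ 4 * κ) * k1

include C hψ in
/-- The conformal class of a polar transform has the same adapted coordinates. -/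
lemma sharesAdapted (hy : IsIsothermicOn r y univ) : SharesAdapted y ψ η (immersionSet ψ) where
  isothermic := fun p hp => by
    obtain ⟨φ, Y, h1, h2, h3⟩ := hy.exists_adapted (isOpen_immersionSet hy hψ.section_) hp
    exact ⟨φ, _, h1, h2, C.isAdapted hψ h3 h2⟩
  adapted := fun φ Y hY hS => ⟨_, C.isAdapted hψ hY hS⟩
  metric := fun φ Y hY hS Y' hY' p hp => C.confMetric_eq hψ hY hS hY' hp

end ConfModel

/-- The model of the conformal class for `c = 0`. -/
def IsPolar.model0 (hψ : IsPolar r y c ψ) (hc : c = 0) : ConfModel r r ψ (hψ.conf0 hc) where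
  F := ψ
  ι := ContinuousLinearMap.id ℂ _
  b := 0
  isometry := fun _ _ => rfl
  F_eq := fun p => by simp
  ne_zero := hψ.ne_zero
  lift := fun _ => rfl

/-- The inclusion of `ℂ ^ m` into `ℂ ^ (m + 1)` as the first coordinates. -/
def snocL (m : ℕ) : (Fin m → ℂ) →L[ℂ] (Fin (m + 1) → ℂ) :=
  LinearMap.toContinuousLinearMap
    { toFun := fun x => Fin.snoc (α := fun _ => ℂ) x 0
      map_add' := fun x x' => by
        funext i
        refine Fin.lastCases ?_ (fun j => ?_) i <;> simp
      map_smul' := fun a x => by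
        funext i
        refine Fin.lastCases ?_ (fun j => ?_) i <;> simp }

/-- The inclusion of `ℂ ^ m` into `ℂ ^ (m + 1)` as the last coordinates. -/
def consL (m : ℕ) : (Fin m → ℂ) →L[ℂ] (Fin (m + 1) → ℂ) :=
  LinearMap.toContinuousLinearMap
    { toFun := fun x => Fin.cons (α := fun _ => ℂ) 0 x
      map_add' := fun x x' => by
        funext i
        refine Fin.cases ?_ (fun j => ?_) i <;> simp
      map_smul' := fun a x => by
        funext i
        refine Fin.cases ?_ (fun j => ?_) i <;> simp }

lemma snocL_apply {m : ℕ} (x : Fin m → ℂ) : snocL m x = Fin.snoc (α := fun _ => ℂ) x 0 := rfl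

lemma consL_apply {m : ℕ} (x : Fin m → ℂ) : consL m x = Fin.cons (α := fun _ => ℂ) 0 x := rfl

/-- The model of the conformal class for `c > 0`. -/
def IsPolar.modelPos (hψ : IsPolar r y c ψ) (hc : 0 < c) :
    ConfModel (n' := n + 1) r (r + 1) ψ (hψ.confPos hc) where
  F := fun p => Fin.snoc (α := fun _ => ℝ) (ψ p) (Real.sqrt c)
  ι := snocL (n + 2)
  b := Fin.snoc (α := fun _ => ℂ) (0 : Fin (n + 2) → ℂ) (Real.sqrt c : ℂ)
  isometry := fun x x' => by
    unfold ip
    rw [Fin.sum_univ_castSucc]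
    simp only [snocL_apply, Fin.snoc_castSucc, Fin.snoc_last, Fin.val_castSucc, mul_zero, add_zero]
    refine Finset.sum_congr rfl fun i _ => ?_
    have : ((i : ℕ) + (r + 1 + 1) < n + 1 + 2) = ((i : ℕ) + (r + 1) < n + 2) :=
      propext (by omega)
    simp only [this]
  F_eq := fun p => by
    funext i
    refine Fin.lastCases ?_ (fun j => ?_) i <;> simp [toC, snocL_apply]
  ne_zero := fun p h0 => by
    have := congrFun h0 (Fin.last (n + 2))
    simp only [Fin.snoc_last, Pi.zero_apply] at this
    exact (Real.sqrt_pos.2 hc).ne' this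
  lift := fun _ => rfl

/-- The model of the conformal class for `c < 0`. -/
def IsPolar.modelNeg (hψ : IsPolar r y c ψ) (hc : c < 0) (hr : r + 2 ≤ n) :
    ConfModel (n' := n + 1) r r ψ (hψ.confNeg hc hr) where
  F := fun p => Fin.cons (α := fun _ => ℝ) (Real.sqrt (-c)) (ψ p)
  ι := consL (n + 2)
  b := Fin.cons (α := fun _ => ℂ) (Real.sqrt (-c) : ℂ) (0 : Fin (n + 2) → ℂ)
  isometry := fun x x' => by
    unfold ip
    rw [Fin.sum_univ_succ]
    simp only [consL_apply, Fin.cons_zero, Fin.cons_succ, Fin.val_succ, mul_zero, zero_add]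
    refine Finset.sum_congr rfl fun i _ => ?_
    have : ((i : ℕ) + 1 + (r + 1) < n + 1 + 2) = ((i : ℕ) + (r + 1) < n + 2) :=
      propext (by omega)
    simp only [this]
  F_eq := fun p => by
    funext i
    refine Fin.cases ?_ (fun j => ?_) i <;> simp [toC, consL_apply]
  ne_zero := fun p h0 => by
    have := congrFun h0 0
    simp only [Fin.cons_zero, Pi.zero_apply] at this
    exact (Real.sqrt_pos.2 (neg_pos.2 hc)).ne' this
  lift := fun _ => rfl

end Conformal

end

section

local notation "∂z" => dc (-Complex.I)
local notation "∂b" => dc Complex.I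

/-! ### Change of coordinates: the chain rule. -/

section ChartChange

variable {M : Type*} [TopologicalSpace M] [ChartedSpace ℂ M] [IsManifold 𝓘(ℝ, ℂ) ∞ M]
variable {V : Type*} [NormedAddCommGroup V] [NormedSpace ℂ V]
variable {E : Type*} [NormedAddCommGroup E] [NormedSpace ℝ E]
variable {φ φ' : OpenPartialHomeomorph M ℂ}

lemma Sm.of_source_subset (hφ : φ ∈ IsManifold.maximalAtlas 𝓘(ℝ, ℂ) ∞ M)
    (hφ' : φ' ∈ IsManifold.maximalAtlas 𝓘(ℝ, ℂ) ∞ M) (hs : φ'.source ⊆ φ.source) {F : M → E}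
    (hF : Sm φ F) : Sm φ' F :=
  (contMDiffOn_source_iff hφ').1 (((contMDiffOn_source_iff hφ).2 hF).mono hs)

lemma sm_chart (hφ : φ ∈ IsManifold.maximalAtlas 𝓘(ℝ, ℂ) ∞ M) : Sm φ φ :=
  (contMDiffOn_source_iff hφ).1 (contMDiffOn_of_mem_maximalAtlas hφ)

variable (hφ : φ ∈ IsManifold.maximalAtlas 𝓘(ℝ, ℂ) ∞ M)
  (hφ' : φ' ∈ IsManifold.maximalAtlas 𝓘(ℝ, ℂ) ∞ M) (hs : φ'.source ⊆ φ.source)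

include hφ hφ' hs in
lemma fderiv_change {F : M → E} (hF : Sm φ F) {p : M} (hp : p ∈ φ'.source) (v : ℂ) :
    fderiv ℝ (F ∘ φ'.symm) (φ' p) v =
      fderiv ℝ (F ∘ φ.symm) (φ p) (fderiv ℝ (φ ∘ φ'.symm) (φ' p) v) := by
  have h1 : F ∘ φ'.symm =ᶠ[nhds (φ' p)] (F ∘ φ.symm) ∘ (φ ∘ φ'.symm) := by
    filter_upwards [φ'.open_target.mem_nhds (φ'.map_source hp)] with w hw
    simp [φ.left_inv (hs (φ'.map_target hw))]
  have h2 : (φ ∘ φ'.symm) (φ' p) = φ p := by simp [φ'.left_inv hp]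
  have h3 := (Sm.of_source_subset hφ hφ' hs (sm_chart hφ)).hasFDerivAt hp
  have h4 := hF.hasFDerivAt (hs hp)
  rw [← h2] at h4
  rw [h1.fderiv_eq, (h4.comp _ h3).fderiv, h2]
  rfl

include hφ hφ' hs in
/-- The chain rule for complex coordinates. -/
lemma dc_change (c : ℂ) {F : M → V} (hF : Sm φ F) {p : M} (hp : p ∈ φ'.source) :
    dc c φ' F p = dc c φ' φ p • ∂z φ F p + dc c φ' (fun q => star (φ q)) p • ∂b φ F p := by
  have hs' := Sm.of_source_subset hφ hφ' hs (sm_chart hφ)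
  rw [dc_star c hs' hp]
  have e : ∀ v : ℂ, fderiv ℝ (F ∘ φ'.symm) (φ' p) v = fderiv ℝ (φ ∘ φ'.symm) (φ' p) v • ∂z φ F p +
      star (fderiv ℝ (φ ∘ φ'.symm) (φ' p) v) • ∂b φ F p := fun v => by
    rw [fderiv_change hφ hφ' hs hF hp v, fderiv_eq_dc p (fderiv ℝ (φ ∘ φ'.symm) (φ' p) v)]
  have h1 : dc c φ' φ p = (1 / 2 : ℂ) * (fderiv ℝ (φ ∘ φ'.symm) (φ' p) 1 +
      c * fderiv ℝ (φ ∘ φ'.symm) (φ' p) Complex.I) := rfl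
  have h2 : star (dc (star c) φ' φ p) = (1 / 2 : ℂ) * (star (fderiv ℝ (φ ∘ φ'.symm) (φ' p) 1) +
      c * star (fderiv ℝ (φ ∘ φ'.symm) (φ' p) Complex.I)) := by
    simp [dc]
  have h0 : dc c φ' F p = (1 / 2 : ℂ) • (fderiv ℝ (F ∘ φ'.symm) (φ' p) 1 +
      c • fderiv ℝ (F ∘ φ'.symm) (φ' p) Complex.I) := rfl
  rw [h0, e, e, h1, h2]
  module

end ChartChange

/-! ### Change of conformal coordinate and of canonical lift. -/

section CanonChange

variable {M : Type*} [TopologicalSpace M] [ChartedSpace ℂ M] [IsManifold 𝓘(ℝ, ℂ) ∞ M]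
variable {φ φ' : OpenPartialHomeomorph M ℂ} {m s : ℕ} {X X' : M → Fin m → ℂ} {a : M → ℂ}

/-- Two complex coordinates with the same domain and canonical lifts of the same surface. -/
structure CanonPair (s : ℕ) (φ φ' : OpenPartialHomeomorph M ℂ) (X X' : M → Fin m → ℂ)
    (a : M → ℂ) : Prop where
  mem : φ ∈ IsManifold.maximalAtlas 𝓘(ℝ, ℂ) ∞ M
  mem' : φ' ∈ IsManifold.maximalAtlas 𝓘(ℝ, ℂ) ∞ M
  source : φ'.source = φ.source
  canon : Canon s φ X
  canon' : Canon s φ' X'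
  sm : Sm φ a
  real : ∀ p ∈ φ.source, star (a p) = a p
  eq : ∀ p ∈ φ.source, X' p = a p • X p
  ne_zero : ∀ p ∈ φ.source, a p ≠ 0

/-- The derivative `∂z/∂w` of a change of coordinates. -/
def chA (φ φ' : OpenPartialHomeomorph M ℂ) (p : M) : ℂ := ∂z φ' φ p

/-- The derivative `∂z̄/∂w` of a change of coordinates. -/
def chB (φ φ' : OpenPartialHomeomorph M ℂ) (p : M) : ℂ := ∂z φ' (fun q => star (φ q)) p

namespace CanonPair

variable (H : CanonPair s φ φ' X X' a)
include H

lemma symm : CanonPair s φ' φ X' X (fun p => (a p)⁻¹) where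
  mem := H.mem'
  mem' := H.mem
  source := H.source.symm
  canon := H.canon'
  canon' := H.canon
  sm := (H.sm.inv H.ne_zero).of_source_subset H.mem H.mem' H.source.le
  real := fun p hp => by rw [star_inv₀, H.real p (H.source ▸ hp)]
  eq := fun p hp => by
    rw [H.source] at hp
    rw [H.eq p hp, smul_smul, inv_mul_cancel₀ (H.ne_zero p hp), one_smul]
  ne_zero := fun p hp => inv_ne_zero (H.ne_zero p (H.source ▸ hp))

lemma sm' {E : Type*} [NormedAddCommGroup E] [NormedSpace ℝ E] {F : M → E} (hF : Sm φ F) :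
    Sm φ' F := hF.of_source_subset H.mem H.mem' H.source.le

lemma sm_chart' : Sm φ' φ := H.sm' (sm_chart H.mem)

lemma dz_change {V : Type*} [NormedAddCommGroup V] [NormedSpace ℂ V] {F : M → V} (hF : Sm φ F)
    {p : M} (hp : p ∈ φ.source) :
    ∂z φ' F p = chA φ φ' p • ∂z φ F p + chB φ φ' p • ∂b φ F p :=
  dc_change H.mem H.mem' H.source.le _ hF (H.source ▸ hp)

lemma dzb_change {V : Type*} [NormedAddCommGroup V] [NormedSpace ℂ V] {F : M → V} (hF : Sm φ F)
    {p : M} (hp : p ∈ φ.source) :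
    ∂b φ' F p = star (chB φ φ' p) • ∂z φ F p + star (chA φ φ' p) • ∂b φ F p := by
  have hp' : p ∈ φ'.source := H.source ▸ hp
  rw [dc_change H.mem H.mem' H.source.le _ hF hp', chA, chB, dc_star _ H.sm_chart' hp',
    dc_star _ H.sm_chart' hp', star_neg_I, star_star, star_I]

lemma dc_X' (c : ℂ) {p : M} (hp : p ∈ φ.source) :
    dc c φ' X' p = dc c φ' a p • X p + a p • dc c φ' X p := by
  have hp' : p ∈ φ'.source := H.source ▸ hp
  rw [dc_congr c (fun q hq => H.eq q (H.source ▸ hq)) hp',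
    dc_smul c (H.sm' H.sm) (H.sm' H.canon.sm) hp']

/-- Both coordinates are conformal for the same surface, so at each point their transition is
complex linear or antilinear. The antilinear case has to be kept: coordinates are only real charts
and no orientation is given. -/
lemma chA_mul_chB {p : M} (hp : p ∈ φ.source) : chA φ φ' p * chB φ φ' p = 0 := by
  have h1 := H.canon'.conf p (H.source ▸ hp)
  have g := H.canon.gram hp
  rw [H.dc_X' _ hp, H.dz_change H.canon.sm hp] at h1
  simp only [ip_add_left, ip_add_right, ip_smul_left, ip_smul_right, g.YY, g.YA, g.YB, g.AA,
    g.AB, g.BB, ip_comm s _ (X p), ip_comm s (∂b φ X p) (∂z φ X p)] at h1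
  have h2 : a p ^ 2 * (chA φ φ' p * chB φ φ' p) = 0 := by linear_combination h1
  exact (mul_eq_zero.1 h2).resolve_left (pow_ne_zero 2 (H.ne_zero p hp))

lemma chA_mul_star_chB {p : M} (hp : p ∈ φ.source) : chA φ φ' p * star (chB φ φ' p) = 0 := by
  rcases mul_eq_zero.1 (H.chA_mul_chB hp) with h | h <;> simp [h]

lemma star_chA_mul_chB {p : M} (hp : p ∈ φ.source) : star (chA φ φ' p) * chB φ φ' p = 0 := by
  rcases mul_eq_zero.1 (H.chA_mul_chB hp) with h | h <;> simp [h]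

/-- Both lifts being canonical, the factor a compensates for |∂z/∂w| (or |∂z̄/∂w|). -/
lemma scale {p : M} (hp : p ∈ φ.source) : a p ^ 2 *
    (chA φ φ' p * star (chA φ φ' p) + chB φ φ' p * star (chB φ φ' p)) = 1 := by
  have h1 := H.canon'.unit p (H.source ▸ hp)
  have g := H.canon.gram hp
  rw [H.dc_X' _ hp, H.dc_X' _ hp, H.dz_change H.canon.sm hp, H.dzb_change H.canon.sm hp] at h1
  simp only [ip_add_left, ip_add_right, ip_smul_left, ip_smul_right, g.YY, g.YA, g.YB, g.AA,
    g.AB, g.BB, ip_comm s _ (X p), ip_comm s (∂b φ X p) (∂z φ X p)] at h1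
  linear_combination 2 * h1

/-- Second derivatives in the new coordinate. -/
lemma dc_dc_X' (c : ℂ) {p : M} (hp : p ∈ φ.source) : ∃ x b d : ℂ, dc c φ' (∂z φ' X') p =
    x • X p + b • ∂z φ X p + d • ∂b φ X p + a p • (chA φ φ' p • dc c φ' (∂z φ X) p +
      chB φ φ' p • dc c φ' (∂b φ X) p) := by
  have hp' : p ∈ φ'.source := H.source ▸ hp
  have hsA : Sm φ' (chA φ φ') := H.sm_chart'.dc _
  have hsB : Sm φ' (chB φ φ') := H.sm_chart'.star.dc _
  have sa := H.sm' H.sm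
  have sX := H.sm' H.canon.sm
  have sz := H.sm' (H.canon.sm.dc (-Complex.I))
  have sb := H.sm' (H.canon.sm.dc Complex.I)
  have e : ∀ q ∈ φ'.source, ∂z φ' X' q = ∂z φ' a q • X q +
      a q • (chA φ φ' q • ∂z φ X q + chB φ φ' q • ∂b φ X q) := fun q hq => by
    rw [H.dc_X' _ (H.source ▸ hq), H.dz_change H.canon.sm (H.source ▸ hq)]
  rw [dc_congr c e hp', dc_add c ((sa.dc _).smul sX) (sa.smul ((hsA.smul sz).add (hsB.smul sb))) hp',
    dc_smul c (sa.dc _) sX hp', dc_smul c sa ((hsA.smul sz).add (hsB.smul sb)) hp',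
    dc_add c (hsA.smul sz) (hsB.smul sb) hp', dc_smul c hsA sz hp', dc_smul c hsB sb hp',
    dc_change H.mem H.mem' H.source.le c H.canon.sm hp']
  refine ⟨dc c φ' (∂z φ' a) p, ∂z φ' a p * dc c φ' φ p + dc c φ' a p * chA φ φ' p +
    a p * dc c φ' (chA φ φ') p, ∂z φ' a p * dc c φ' (fun q => star (φ q)) p +
    dc c φ' a p * chB φ φ' p + a p * dc c φ' (chB φ φ') p, ?_⟩
  module

lemma dzz_X' {p : M} (hp : p ∈ φ.source) : ∃ x b d : ℂ, ∂z φ' (∂z φ' X') p =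
    x • X p + b • ∂z φ X p + d • ∂b φ X p + (a p * chA φ φ' p ^ 2) • ∂z φ (∂z φ X) p +
      (a p * chB φ φ' p ^ 2) • ∂b φ (∂b φ X) p := by
  obtain ⟨x, b, d, h⟩ := H.dc_dc_X' (-Complex.I) hp
  refine ⟨x, b, d, ?_⟩
  have h0 := H.chA_mul_chB hp
  rw [h, H.dz_change (H.canon.sm.dc _) hp, H.dz_change (H.canon.sm.dc _) hp,
    dc_comm (-Complex.I) Complex.I H.canon.sm hp]
  match_scalars
  · ring
  · ring
  · ring
  · ring
  · linear_combination 2 * a p * h0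
  · ring

lemma W_X' {p : M} (hp : p ∈ φ.source) : ∃ x b d e : ℂ, ∂b φ' (∂z φ' X') p =
    x • X p + b • ∂z φ X p + d • ∂b φ X p + e • ∂b φ (∂z φ X) p := by
  obtain ⟨x, b, d, h⟩ := H.dc_dc_X' Complex.I hp
  refine ⟨x, b, d, a p * (chA φ φ' p * star (chA φ φ' p) + chB φ φ' p * star (chB φ φ' p)), ?_⟩
  have h1 := H.chA_mul_star_chB hp
  have h2 := H.star_chA_mul_chB hp
  rw [h, H.dzb_change (H.canon.sm.dc _) hp, H.dzb_change (H.canon.sm.dc _) hp,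
    dc_comm (-Complex.I) Complex.I H.canon.sm hp]
  match_scalars
  · ring
  · ring
  · ring
  · linear_combination a p * h1
  · ring
  · linear_combination a p * h2

lemma span_le {p : M} (hp : p ∈ φ.source) :
    Submodule.span ℂ {X' p, ∂z φ' X' p, ∂b φ' X' p, ∂b φ' (∂z φ' X') p} ≤
      Submodule.span ℂ {X p, ∂z φ X p, ∂b φ X p, ∂b φ (∂z φ X) p} := by
  rw [Submodule.span_le]
  rintro v (rfl | rfl | rfl | rfl)
  · exact mem_span_four.2 ⟨a p, 0, 0, 0, by rw [H.eq p hp]; module⟩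
  · exact mem_span_four.2 ⟨∂z φ' a p, a p * chA φ φ' p, a p * chB φ φ' p, 0, by
      rw [H.dc_X' _ hp, H.dz_change H.canon.sm hp]; module⟩
  · exact mem_span_four.2 ⟨∂b φ' a p, a p * star (chB φ φ' p), a p * star (chA φ φ' p), 0, by
      rw [H.dc_X' _ hp, H.dzb_change H.canon.sm hp]; module⟩
  · exact mem_span_four.2 (H.W_X' hp)

lemma span_eq {p : M} (hp : p ∈ φ.source) :
    Submodule.span ℂ {X' p, ∂z φ' X' p, ∂b φ' X' p, ∂b φ' (∂z φ' X') p} =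
      Submodule.span ℂ {X p, ∂z φ X p, ∂b φ X p, ∂b φ (∂z φ X) p} :=
  le_antisymm (H.span_le hp) (H.symm.span_le (H.source ▸ hp))

end CanonPair

/-- The Jacobian of a change of coordinates. -/
def jac (φ φ' : OpenPartialHomeomorph M ℂ) (p : M) : ℝ :=
  |(fderiv ℝ (φ ∘ φ'.symm) (φ' p)).det|

lemma det_complex (α β : ℂ) (L : ℂ →L[ℝ] ℂ) (hL : ∀ v, L v = v * α + star v * star β) :
    (L.det : ℂ) = α * star α - β * star β := by
  have h : L.det = (LinearMap.toMatrix Complex.basisOneI Complex.basisOneI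
      (L : ℂ →ₗ[ℝ] ℂ)).det := (LinearMap.det_toMatrix _ _).symm
  rw [h, Matrix.det_fin_two]
  simp only [LinearMap.toMatrix_apply, Complex.coe_basisOneI_repr, Complex.coe_basisOneI,
    ContinuousLinearMap.coe_coe, hL]
  apply Complex.ext <;> simp <;> ring

/-- The determinant is |α|² - |β|² with α = ∂z/∂w and β = ∂z̄/∂w; as one of them vanishes, its
absolute value is the sum. -/
lemma CanonPair.jac_eq (H : CanonPair s φ φ' X X' a) {p : M} (hp : p ∈ φ.source) :
    (jac φ φ' p : ℂ) =
      chA φ φ' p * star (chA φ φ' p) + chB φ φ' p * star (chB φ φ' p) := by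
  have hp' : p ∈ φ'.source := H.source ▸ hp
  have h1 := det_complex (chA φ φ' p) (chB φ φ' p) (fderiv ℝ (φ ∘ φ'.symm) (φ' p)) (fun v => by
    rw [fderiv_eq_dc, chA, chB, dc_star _ H.sm_chart' hp', star_neg_I, star_star]
    simp)
  have e : ∀ x : ℂ, x * star x = ((‖x‖ ^ 2 : ℝ) : ℂ) := fun x => (normSq_cast x).symm
  rw [e, e] at h1 ⊢
  rw [← Complex.ofReal_sub] at h1
  rw [jac, Complex.ofReal_injective h1, ← Complex.ofReal_add]
  congr 1
  rcases mul_eq_zero.1 (H.chA_mul_chB hp) with h | h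
  · rw [h]
    simp only [norm_zero]
    rw [show (0 : ℝ) ^ 2 - ‖chB φ φ' p‖ ^ 2 = -(‖chB φ φ' p‖ ^ 2) by ring, abs_neg,
      abs_of_nonneg (by positivity)]
    ring
  · rw [h]
    simp

end CanonChange

/-! ### Transformation of κ and of the conformal metric. -/

section HopfChange

variable {M : Type*} [TopologicalSpace M] [ChartedSpace ℂ M] [IsManifold 𝓘(ℝ, ℂ) ∞ M] {n r : ℕ}
variable {φ φ' : OpenPartialHomeomorph M ℂ} {y : M → Quadric n r} {Y Y' : M → Fin (n + 2) → ℝ}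

lemma IsCanonicalLift.exists_pair (hY : IsCanonicalLift r y φ Y) (hY' : IsCanonicalLift r y φ' Y')
    (hs : φ'.source = φ.source) :
    ∃ a : M → ℂ, CanonPair (r + 1) φ φ' (toC ∘ Y) (toC ∘ Y') a := by
  have hl := hY'.lift
  rw [hs] at hl
  obtain ⟨a, sa, ha⟩ := hY.lift.exists_ratio hY.chart hl
  refine ⟨fun p => (a p : ℂ), hY.chart, hY'.chart, hs, hY.canon, hY'.canon, sa.ofReal,
    fun p _ => Complex.conj_ofReal _, fun p hp => ?_,
    fun p hp => Complex.ofReal_ne_zero.2 (ha p hp).1⟩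
  rw [Function.comp_apply, (ha p hp).2, toC_smul]
  rfl

lemma star_mem_perp (h : Canon (r + 1) φ (toC ∘ Y)) {p : M} (hp : p ∈ φ.source)
    {x : Fin (n + 2) → ℂ} (hx : x ∈ perp (r + 1) (confTangent φ Y p)) :
    star x ∈ perp (r + 1) (confTangent φ Y p) := by
  rw [confTangent_eq, mem_perp_four] at hx ⊢
  have := fun {v : Fin (n + 2) → ℂ} (hv : ip (r + 1) x v = 0) =>
    (star_ip (r + 1) x v).symm.trans (by rw [hv, star_zero])
  obtain ⟨e1, e2, e3, e4⟩ := hx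
  have f1 := this e1
  have f2 := this e2
  have f3 := this e3
  have f4 := this e4
  rw [h.real p hp] at f1
  rw [h.star_dz hp] at f2
  rw [h.star_dzb hp] at f3
  rw [h.star_W hp] at f4
  exact ⟨f1, f3, f2, f4⟩

/-- `CanonPair` requires equal domains, so both coordinates are restricted to the overlap; this
changes no derivative there. -/
lemma confTangent_change (hY : IsCanonicalLift r y φ Y) (hY' : IsCanonicalLift r y φ' Y') {p : M}
    (hp : p ∈ φ.source) (hp' : p ∈ φ'.source) : confTangent φ' Y' p = confTangent φ Y p := by
  have h1 := hY.restr φ'.open_source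
  have h2 := hY'.restr φ.open_source
  obtain ⟨a, H⟩ := h1.exists_pair h2 (by
    rw [φ.restr_source' _ φ'.open_source, φ'.restr_source' _ φ.open_source, inter_comm])
  have := H.span_eq (p := p) (by rw [φ.restr_source' _ φ'.open_source]; exact ⟨hp, hp'⟩)
  rw [← confTangent_eq, ← confTangent_eq] at this
  exact this

/-- Of the second derivatives of X' only those with factors α² and β² have normal components; the
latter brings in Y_z̄z̄ and hence κ̄. -/
lemma hopf_change {a : M → ℂ}
    (H : CanonPair (r + 1) φ φ' (toC ∘ Y) (toC ∘ Y') a) {p : M} (hp : p ∈ φ.source) :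
    hopf r φ' Y' p = (a p * chA φ φ' p ^ 2) • hopf r φ Y p +
      (a p * chB φ φ' p ^ 2) • star (hopf r φ Y p) := by
  have hκ := hopf_mem_perp H.canon hp
  have hκ' := star_mem_perp H.canon hp hκ
  have hT := (H.canon.gram hp).nondeg
  rw [hopf, dz_eq_dc, dz_eq_dc, confTangent_eq, H.span_eq hp]
  rw [confTangent_eq] at hκ hκ'
  refine normalPart_eq hT ?_ ?_
  · rw [mem_perp_four] at hκ hκ' ⊢
    simp only [ip_add_left, ip_smul_left, hκ.1, hκ.2.1, hκ.2.2.1, hκ.2.2.2, hκ'.1, hκ'.2.1,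
      hκ'.2.2.1, hκ'.2.2.2, mul_zero, add_zero, and_self]
  · obtain ⟨x, b, d, h⟩ := H.dzz_X' hp
    rw [h, hopf_eq H.canon hp, star_add, star_smul, H.canon.star_dzz hp, H.canon.real p hp]
    generalize 2 * ip (r + 1) (∂z φ (∂z φ (toC ∘ Y)) p) (∂b φ (∂z φ (toC ∘ Y)) p) = k
    exact mem_span_four.2 ⟨x - a p * chA φ φ' p ^ 2 * k - a p * chB φ φ' p ^ 2 * star k, b, d, 0,
      by module⟩

/-- With αβ = 0 the factor is a²(|α|⁴ + |β|⁴) = a²(|α|² + |β|²)², and `CanonPair.scale` removes a²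
and one power. -/
lemma confMetric_change' {a : M → ℂ}
    (H : CanonPair (r + 1) φ φ' (toC ∘ Y) (toC ∘ Y') a) {p : M} (hp : p ∈ φ.source) :
    confMetric r φ' Y' p = jac φ φ' p * confMetric r φ Y p := by
  have h0 := H.chA_mul_star_chB hp
  have h0' := H.star_chA_mul_chB hp
  have h1 := H.scale hp
  rw [confMetric, hopf_change H hp, H.jac_eq hp, confMetric]
  simp only [star_add, star_smul, star_star, star_mul', star_pow, H.real p hp, ip_add_left,
    ip_add_right, ip_smul_left, ip_smul_right, ip_comm _ (star (hopf r φ Y p)) (hopf r φ Y p)]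
  generalize ip (r + 1) (hopf r φ Y p) (star (hopf r φ Y p)) = k at *
  generalize ip (r + 1) (hopf r φ Y p) (hopf r φ Y p) = k1 at *
  generalize ip (r + 1) (star (hopf r φ Y p)) (star (hopf r φ Y p)) = k2 at *
  generalize chA φ φ' p = α at *
  generalize chB φ φ' p = β at *
  generalize star α = α' at *
  generalize star β = β' at *
  linear_combination (k * (α * α' + β * β')) * h1 - 2 * a p ^ 2 * k * β * α' * h0 +
    a p ^ 2 * k1 * α * β' * h0 + a p ^ 2 * k2 * α' * β * h0'

lemma confMetric_change (hY : IsCanonicalLift r y φ Y) (hY' : IsCanonicalLift r y φ' Y') {p : M}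
    (hp : p ∈ φ.source) (hp' : p ∈ φ'.source) :
    confMetric r φ' Y' p = jac φ φ' p * confMetric r φ Y p := by
  have h1 := hY.restr φ'.open_source
  have h2 := hY'.restr φ.open_source
  obtain ⟨a, H⟩ := h1.exists_pair h2 (by
    rw [φ.restr_source' _ φ'.open_source, φ'.restr_source' _ φ.open_source, inter_comm])
  exact confMetric_change' H (p := p) (by
    rw [φ.restr_source' _ φ'.open_source]; exact ⟨hp, hp'⟩)

end HopfChange

end

section

local notation "∂z" => dc (-Complex.I)
local notation "∂b" => dc Complex.I

/-! ### Integration of densities with partitions of unity. -/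

section Density

variable {M : Type*} [TopologicalSpace M] [ChartedSpace ℂ M] [IsManifold 𝓘(ℝ, ℂ) ∞ M]
variable {φ φ' : OpenPartialHomeomorph M ℂ}

/-- The integral over a coordinate domain of a function with respect to the coordinate area. -/
def chartInt (φ : OpenPartialHomeomorph M ℂ) (F : M → ℝ) : ℝ := ∫ w in φ.target, F (φ.symm w)

lemma chartInt_congr {F G : M → ℝ} (h : ∀ p ∈ φ.source, F p = G p) :
    chartInt φ F = chartInt φ G :=
  setIntegral_congr_fun φ.open_target.measurableSet fun _ hw => h _ (φ.map_target hw)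

/-- The change of variables formula. -/
lemma chartInt_change (hφ : φ ∈ IsManifold.maximalAtlas 𝓘(ℝ, ℂ) ∞ M)
    (hφ' : φ' ∈ IsManifold.maximalAtlas 𝓘(ℝ, ℂ) ∞ M) {F F' : M → ℝ}
    (h0 : ∀ p ∈ φ.source, p ∉ φ'.source → F p = 0)
    (h0' : ∀ p ∈ φ'.source, p ∉ φ.source → F' p = 0)
    (h : ∀ p ∈ φ.source, p ∈ φ'.source → F' p = jac φ φ' p * F p) :
    chartInt φ F = chartInt φ' F' := by
  have e1 : chartInt φ F = ∫ w in φ.target ∩ φ.symm ⁻¹' φ'.source, F (φ.symm w) :=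
    (setIntegral_eq_of_subset_of_forall_sdiff_eq_zero φ.open_target.measurableSet inter_subset_left
      fun w hw => h0 _ (φ.map_target hw.1) fun hn => hw.2 ⟨hw.1, hn⟩)
  have e2 : chartInt φ' F' = ∫ w in φ'.target ∩ φ'.symm ⁻¹' φ.source, F' (φ'.symm w) :=
    (setIntegral_eq_of_subset_of_forall_sdiff_eq_zero φ'.open_target.measurableSet
      inter_subset_left fun w hw => h0' _ (φ'.map_target hw.1) fun hn => hw.2 ⟨hw.1, hn⟩)
  have e3 : φ.target ∩ φ.symm ⁻¹' φ'.source =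
      (φ ∘ φ'.symm) '' (φ'.target ∩ φ'.symm ⁻¹' φ.source) := by
    ext w
    constructor
    · rintro ⟨h1, h2⟩
      exact ⟨φ' (φ.symm w), ⟨φ'.map_source h2, by
        rw [mem_preimage, φ'.left_inv h2]; exact φ.map_target h1⟩, by
        rw [Function.comp_apply, φ'.left_inv h2, φ.right_inv h1]⟩
    · rintro ⟨x, ⟨h1, h2⟩, rfl⟩
      exact ⟨φ.map_source h2, by
        rw [mem_preimage, Function.comp_apply, φ.left_inv h2]; exact φ'.map_target h1⟩
  have hinj : InjOn (φ ∘ φ'.symm) (φ'.target ∩ φ'.symm ⁻¹' φ.source) := fun x hx x' hx' hxx =>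
    φ'.symm.injOn hx.1 hx'.1 (φ.injOn hx.2 hx'.2 hxx)
  have hd : ∀ x ∈ φ'.target ∩ φ'.symm ⁻¹' φ.source, HasFDerivWithinAt (φ ∘ φ'.symm)
      (fderiv ℝ (φ ∘ φ'.symm) x) (φ'.target ∩ φ'.symm ⁻¹' φ.source) x := fun x hx => by
    have hs : (φ'.restr φ.source).source = φ'.source ∩ φ.source :=
      φ'.restr_source' _ φ.open_source
    have h1 := (Sm.of_source_subset hφ (restr_mem_maximalAtlas hφ' φ.open_source)
      (by rw [hs]; exact inter_subset_right) (sm_chart hφ)).hasFDerivAt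
      (p := φ'.symm x) (by rw [hs]; exact ⟨φ'.map_target hx.1, hx.2⟩)
    have h2 : (φ'.restr φ.source) (φ'.symm x) = x := φ'.right_inv hx.1
    rw [h2] at h1
    exact h1.hasFDerivWithinAt
  rw [e1, e2, e3, integral_image_eq_integral_abs_det_fderiv_smul volume
    (φ'.isOpen_inter_preimage_symm φ.open_source).measurableSet hd hinj]
  refine setIntegral_congr_fun (φ'.isOpen_inter_preimage_symm φ.open_source).measurableSet
    fun x hx => ?_
  simp only [Function.comp_apply, smul_eq_mul]
  rw [h _ hx.2 (φ'.map_target hx.1), jac, φ'.right_inv hx.1, φ.left_inv hx.2]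

lemma integrableOn_chart {F : M → ℝ} (hF : ContinuousOn F φ.source) {K : Set M} (hK : IsCompact K)
    (hKs : K ⊆ φ.source) (h0 : ∀ p ∈ φ.source, p ∉ K → F p = 0) :
    IntegrableOn (fun w => F (φ.symm w)) φ.target := by
  have h1 : IsCompact (φ '' K) := hK.image_of_continuousOn (φ.continuousOn.mono hKs)
  have h2 : φ '' K ⊆ φ.target := by
    rintro _ ⟨p, hp, rfl⟩; exact φ.map_source (hKs hp)
  have h3 : ContinuousOn (fun w => F (φ.symm w)) φ.target :=
    hF.comp φ.continuousOn_symm fun w hw => φ.map_target hw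
  refine ((h3.mono h2).integrableOn_compact h1).of_forall_sdiff_eq_zero
    φ.open_target.measurableSet fun w hw => h0 _ (φ.map_target hw.1) fun hn => hw.2 ?_
  exact ⟨_, hn, φ.right_inv hw.1⟩

lemma chartInt_sum {ι : Type*} (t : Finset ι) {F : ι → M → ℝ}
    (h : ∀ i ∈ t, IntegrableOn (fun w => F i (φ.symm w)) φ.target) :
    chartInt φ (fun p => ∑ i ∈ t, F i p) = ∑ i ∈ t, chartInt φ (F i) :=
  integral_finsetSum t h

variable {k k' : ℕ} [CompactSpace M]

lemma mul_eq_zero_of_notMem_tsupport {f : M → ℝ} {p : M} (hp : p ∉ tsupport f) (x : ℝ) :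
    f p * x = 0 := by
  rw [image_eq_zero_of_notMem_tsupport hp, zero_mul]

/-- The integral of a density does not depend on the coordinates and the partition of unity that
are used to compute it. -/
lemma sum_chartInt {ρ' : SmoothPartitionOfUnity (Fin k') 𝓘(ℝ, ℂ) M univ}
    {φ' : Fin k' → OpenPartialHomeomorph M ℂ}
    (hφ' : ∀ j, φ' j ∈ IsManifold.maximalAtlas 𝓘(ℝ, ℂ) ∞ M)
    (hρ' : ρ'.IsSubordinate fun j => (φ' j).source)
    {φ : Fin k → OpenPartialHomeomorph M ℂ}
    (hφ : ∀ i, φ i ∈ IsManifold.maximalAtlas 𝓘(ℝ, ℂ) ∞ M)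
    {K : Fin k → Set M} (hK : ∀ i, IsCompact (K i)) (hKs : ∀ i, K i ⊆ (φ i).source)
    {F : Fin k → M → ℝ} (hc : ∀ i, ContinuousOn (F i) (φ i).source)
    (h0 : ∀ i, ∀ p ∈ (φ i).source, p ∉ K i → F i p = 0)
    {F' : Fin k → Fin k' → M → ℝ} (hc' : ∀ i j, ContinuousOn (F' i j) (φ' j).source)
    (h0' : ∀ i j, ∀ p ∈ (φ' j).source, p ∉ K i → F' i j p = 0)
    (hF' : ∀ i j, ∀ p ∈ (φ i).source, p ∈ (φ' j).source →
      F' i j p = jac (φ i) (φ' j) p * F i p) :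
    ∑ i, chartInt (φ i) (F i) = ∑ j, chartInt (φ' j) (fun p => ρ' j p * ∑ i, F' i j p) := by
  have c' : ∀ j, Continuous (ρ' j) := fun j => (ρ' j).contMDiff.continuous
  -- Insert 1 = ∑ ρ'_j and carry each term to the coordinate φ'_j. The compact sets K i give
  -- integrability, and make the terms vanish outside the overlaps.
  have e1 : ∀ i, chartInt (φ i) (F i) = ∑ j, chartInt (φ' j) (fun p => ρ' j p * F' i j p) := by
    intro i
    rw [chartInt_congr (G := fun p => ∑ j, ρ' j p * F i p), chartInt_sum]
    · refine Finset.sum_congr rfl fun j _ => chartInt_change (hφ i) (hφ' j) ?_ ?_ ?_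
      · intro p _ hp
        exact mul_eq_zero_of_notMem_tsupport (fun hn => hp (hρ' j hn)) _
      · intro p hp hn
        rw [h0' i j p hp fun h => hn (hKs i h), mul_zero]
      · intro p hp hp'
        rw [hF' i j p hp hp']; ring
    · intro j _
      exact integrableOn_chart ((c' j).continuousOn.mul (hc i)) (hK i) (hKs i) fun p hp hn => by
        rw [Pi.mul_apply, h0 i p hp hn, mul_zero]
    · intro p _
      rw [← Finset.sum_mul, ← finsum_eq_sum_of_fintype, ρ'.sum_eq_one (mem_univ p), one_mul]
  simp only [e1]
  rw [Finset.sum_comm]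
  refine Finset.sum_congr rfl fun j _ => ?_
  rw [← chartInt_sum]
  · simp only [Finset.mul_sum]
  · intro i _
    refine integrableOn_chart ((c' j).continuousOn.mul (hc' i j))
      (isClosed_tsupport (ρ' j)).isCompact (hρ' j) fun p _ hn => mul_eq_zero_of_notMem_tsupport hn _

/-- The integral of a derivative of a compactly supported function vanishes. -/
lemma chartInt_fderiv_eq_zero {f : M → ℝ} [T2Space M] (hf : Sm φ f) {K : Set M} (hK : IsCompact K)
    (hKs : K ⊆ φ.source) (h0 : ∀ p ∈ φ.source, p ∉ K → f p = 0) (v : ℂ) :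
    IntegrableOn (fun w => fderiv ℝ (f ∘ φ.symm) (φ (φ.symm w)) v) φ.target ∧
      chartInt φ (fun p => fderiv ℝ (f ∘ φ.symm) (φ p) v) = 0 := by
  classical
  -- Extension by zero is C¹ on the whole plane because the support is a compact subset of the
  -- coordinate domain.
  set g : ℂ → ℝ := φ.target.indicator (f ∘ φ.symm) with hg
  have hKc : IsCompact (φ '' K) := hK.image_of_continuousOn (φ.continuousOn.mono hKs)
  have hgs : Function.support g ⊆ φ '' K := fun w hw => by
    have h1 : w ∈ φ.target := by
      by_contra hn; exact hw (indicator_of_notMem hn _)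
    by_contra hn
    refine hw ?_
    rw [hg, indicator_of_mem h1]
    exact h0 _ (φ.map_target h1) fun h => hn ⟨_, h, φ.right_inv h1⟩
  have hcs : HasCompactSupport g := HasCompactSupport.of_support_subset_isCompact hKc hgs
  have hev : ∀ w ∈ φ.target, g =ᶠ[nhds w] f ∘ φ.symm := fun w hw => by
    filter_upwards [φ.open_target.mem_nhds hw] with x hx using indicator_of_mem hx _
  have hsm : ContDiff ℝ 1 g := by
    rw [contDiff_iff_contDiffAt]
    intro w
    by_cases hw : w ∈ φ.target
    · have h1 := hf.contDiffAt (φ.map_target hw)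
      rw [φ.right_inv hw] at h1
      exact (h1.of_le (by exact_mod_cast le_top)).congr_of_eventuallyEq (hev w hw)
    · have h1 : g =ᶠ[nhds w] fun _ => 0 := by
        have : w ∉ φ '' K := fun ⟨p, hp, e⟩ => hw (e ▸ φ.map_source (hKs hp))
        filter_upwards [hKc.isClosed.isOpen_compl.mem_nhds this] with x hx
        by_contra hn
        exact hx (hgs hn)
      exact contDiffAt_const.congr_of_eventuallyEq h1
  have e0 : ∀ w ∈ φ.target, fderiv ℝ g w v = fderiv ℝ (f ∘ φ.symm) (φ (φ.symm w)) v :=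
    fun w hw => by rw [φ.right_inv hw, (hev w hw).fderiv_eq]
  have e1 : chartInt φ (fun p => fderiv ℝ (f ∘ φ.symm) (φ p) v) = ∫ w, fderiv ℝ g w v := by
    refine (setIntegral_congr_fun φ.open_target.measurableSet fun w hw => (e0 w hw).symm).trans
      (setIntegral_eq_integral_of_forall_compl_eq_zero fun w hw => ?_)
    have : w ∉ tsupport g := fun h => hw (by
      obtain ⟨p, hp, rfl⟩ := closure_minimal hgs hKc.isClosed h
      exact φ.map_source (hKs hp))
    rw [image_eq_zero_of_notMem_tsupport (f := fderiv ℝ g) fun h =>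
      this (tsupport_fderiv_subset ℝ h)]
    rfl
  have hgd : Differentiable ℝ g := hsm.differentiable (by simp)
  have i1 : Integrable (fun w => fderiv ℝ g w v) :=
    ((hsm.continuous_fderiv (by simp)).clm_apply continuous_const).integrable_of_hasCompactSupport
      (hcs.fderiv_apply ℝ v)
  have i2 : Integrable g := hsm.continuous.integrable_of_hasCompactSupport hcs
  -- Integration by parts against the constant function 1.
  have := integral_mul_fderiv_eq_neg_fderiv_mul_of_integrable (μ := (volume : Measure ℂ))
    (f := fun _ => (1 : ℝ)) (g := g) (v := v) (by simp) (by simpa using i1) (by simpa using i2)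
    (fun _ _ => differentiableAt_const _) (fun _ _ => hgd _)
  refine ⟨i1.integrableOn.congr_fun e0 φ.open_target.measurableSet, ?_⟩
  rw [e1]
  simpa using this

lemma fderiv_re {f : M → ℂ} (hf : Sm φ f) {p : M} (hp : p ∈ φ.source) (v : ℂ) :
    fderiv ℝ ((fun q => (f q).re) ∘ φ.symm) (φ p) v = (fderiv ℝ (f ∘ φ.symm) (φ p) v).re := by
  have := (Complex.reCLM.hasFDerivAt.comp (φ p) (hf.hasFDerivAt hp)).fderiv
  exact congrArg (fun L : ℂ →L[ℝ] ℝ => L v) this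

/-- The integral of a `∂/∂z̄`-derivative of a compactly supported function vanishes. -/
lemma chartInt_dzb_eq_zero [T2Space M] {f : M → ℂ} (hf : Sm φ f) {K : Set M} (hK : IsCompact K)
    (hKs : K ⊆ φ.source) (h0 : ∀ p ∈ φ.source, p ∉ K → f p = 0) :
    chartInt φ (fun p => (∂b φ f p).re) = 0 := by
  have sI := (Sm.const (φ := φ) Complex.I).mul hf
  obtain ⟨i1, e1⟩ := chartInt_fderiv_eq_zero hf.re hK hKs (fun p hp hn => by simp [h0 p hp hn]) 1
  obtain ⟨i2, e2⟩ := chartInt_fderiv_eq_zero sI.re hK hKs (fun p hp hn => by simp [h0 p hp hn])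
    Complex.I
  -- For z = u + iv, Re f_z̄ is half of ∂_u Re f + ∂_v Re(i f).
  have e3 : chartInt φ (fun p => (∂b φ f p).re) =
      chartInt φ (fun p => (1 / 2) * (fderiv ℝ ((fun q => (f q).re) ∘ φ.symm) (φ p) 1 +
        fderiv ℝ ((fun q => (Complex.I * f q).re) ∘ φ.symm) (φ p) Complex.I)) := by
    refine chartInt_congr fun p hp => ?_
    have h1 : fderiv ℝ ((fun q => Complex.I * f q) ∘ φ.symm) (φ p) =
        Complex.I • fderiv ℝ (f ∘ φ.symm) (φ p) :=
      ((hf.hasFDerivAt hp).const_smul Complex.I).fderiv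
    rw [fderiv_re hf hp, fderiv_re sI hp, h1]
    simp only [dc, smul_eq_mul, smul_apply, ← Complex.add_re]
    rw [show (1 / 2 : ℂ) = ((1 / 2 : ℝ) : ℂ) by push_cast; rfl, Complex.re_ofReal_mul]
  rw [e3]
  unfold chartInt at e1 e2 ⊢
  rw [integral_const_mul, integral_add i1 i2, e1, e2]
  simp

end Density

end

section

local notation "∂z" => dc (-Complex.I)
local notation "∂b" => dc Complex.I

/-! ### The logarithmic derivative of ⟨ψ, κ⟩ under change of coordinates. -/

section LogDerivative

variable {M : Type*} [TopologicalSpace M] [ChartedSpace ℂ M] [IsManifold 𝓘(ℝ, ℂ) ∞ M] {n r : ℕ}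
variable {φ φ' : OpenPartialHomeomorph M ℂ} {y : M → Quadric n r}
variable {Y Y' ψ : M → Fin (n + 2) → ℝ}

/-- The logarithmic derivative of `⟨ψ, κ⟩`. -/
def logDz (r : ℕ) (φ : OpenPartialHomeomorph M ℂ) (Y ψ : M → Fin (n + 2) → ℝ) (p : M) : ℂ :=
  ∂z φ (hFun r φ Y ψ) p / hFun r φ Y ψ p

/-- A multiple of a null lift that is a combination of `ψ_z` and `ψ_z̄` vanishes. -/
lemma LocalPolar.eq_zero_of_smul_eq {m s : ℕ} {X P : M → Fin m → ℂ} {h : M → ℂ}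
    (L : LocalPolar s φ X P h) {p : M} (hp : p ∈ φ.source) (h0 : h p ≠ 0) {k k1 k2 : ℂ}
    (e : k • X p = k1 • ∂z φ P p + k2 • ∂b φ P p) : k = 0 := by
  have g := L.canon.gram hp
  -- The vector h X_zz̄ - h_z̄ X_z - h_z X_z̄ is orthogonal to P_z and P_z̄, while its product with
  -- X is -h/2.
  have e1 := congrArg (ip s (h p • ∂b φ (∂z φ X) p - ∂b φ h p • ∂z φ X p - ∂z φ h p • ∂b φ X p)) e
  rw [L.dz p hp, L.dzb hp] at e1
  simp only [ip_add_right, ip_sub_left, ip_sub_right, ip_smul_left, ip_smul_right,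
    ip_comm s (∂b φ (∂z φ X) p), ip_comm s (∂z φ X p) (X p), ip_comm s (∂b φ X p) (X p),
    ip_comm s (∂b φ X p) (∂z φ X p), g.YA, g.YB, g.YW, g.AA, g.BB, g.AB, g.AW, g.BW] at e1
  have e2 : k * h p = 0 := by linear_combination (-2) * e1
  exact (mul_eq_zero.1 e2).resolve_right h0

/-- The logarithmic derivative of `⟨ψ, κ⟩` is a differential form of type `(1, 0)`, up to
conjugation of the coordinate. -/
lemma logDz_change (hψ : IsParallelSection r y ψ) (hY : IsAdapted r y φ Y)
    (hY' : IsAdapted r y φ' Y') {A : M → ℂ}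
    (H : CanonPair (r + 1) φ φ' (toC ∘ Y) (toC ∘ Y') A)
    (h0 : ∀ p ∈ φ.source, hFun r φ Y ψ p ≠ 0) (h0' : ∀ p ∈ φ'.source, hFun r φ' Y' ψ p ≠ 0)
    {p : M} (hp : p ∈ φ.source) :
    logDz r φ' Y' ψ p = chA φ φ' p * logDz r φ Y ψ p + chB φ φ' p * star (logDz r φ Y ψ p) := by
  have L := hψ.localPolar hY
  have L' := hψ.localPolar hY'
  have hp' : p ∈ φ'.source := H.source ▸ hp
  have hs : ∀ {q}, q ∈ φ'.source → q ∈ φ.source := fun hq => H.source ▸ hq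
  have hβ : star (logDz r φ Y ψ p) = ∂b φ (hFun r φ Y ψ) p / hFun r φ Y ψ p := by
    rw [logDz, star_div₀, L.star_dzh hp, L.realh p hp]
  rw [hβ]
  simp only [logDz]
  generalize hFun r φ Y ψ = h at *
  generalize hFun r φ' Y' ψ = h' at *
  have sA : Sm φ' A := H.sm' H.sm
  have sh : Sm φ' h := H.sm' L.smh
  -- Both h and h' describe the one metric induced by ψ.
  have hh : ∀ q ∈ φ.source, A q ^ 2 * h' q ^ 2 = h q ^ 2 := fun q hq => by
    have hq' : q ∈ φ'.source := H.source ▸ hq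
    have e1 := L'.dz_dzb hq'
    rw [H.dz_change L.sm hq, H.dzb_change L.sm hq] at e1
    simp only [ip_add_left, ip_add_right, ip_smul_left, ip_smul_right, L.dz_dz hq, L.dzb_dzb hq,
      L.dz_dzb hq, ip_comm _ (∂b φ (toC ∘ ψ) q) (∂z φ (toC ∘ ψ) q)] at e1
    have e2 := H.scale hq
    linear_combination -(A q ^ 2 / 2) * e1 + h q ^ 2 * e2
  -- μ is the ratio of the two dual surfaces Y'/h' and Y/h. Both have differentials tangent to ψ,
  -- which will force μ to have derivative zero.
  set μ : M → ℂ := fun q => A q * h q * (h' q)⁻¹ with hμ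
  have sμ : Sm φ' μ := (sA.mul sh).mul (L'.smh.inv h0')
  have hμ2 : ∀ q ∈ φ'.source, μ q * μ q = A q * A q * (A q * A q) := fun q hq => by
    have e1 := hh q (hs hq)
    have e2 := h0' q hq
    simp only [hμ]
    field_simp
    linear_combination -(A q ^ 2) * e1
  have hG : ∀ q ∈ φ'.source, (h' q)⁻¹ • (toC ∘ Y') q = μ q • ((h q)⁻¹ • (toC ∘ Y) q) :=
    fun q hq => by
      rw [H.eq q (hs hq), smul_smul, smul_smul]
      congr 1
      have e1 := h0 q (hs hq)
      have e2 := h0' q hq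
      simp only [hμ]
      field_simp
  have sG : Sm φ (fun q => (h q)⁻¹ • (toC ∘ Y) q) := (L.smh.inv h0).smul L.canon.sm
  -- Comparing the two duality formulas leaves μ_z Y/h as a combination of ψ_z and ψ_z̄, and Y is
  -- independent of these.
  have hμz : ∂z φ' μ p = 0 := by
    have e1 := L'.dz_dual h0' hp'
    rw [dc_congr _ hG hp', dc_smul _ sμ (H.sm' sG) hp', H.dz_change sG hp, L.dz_dual h0 hp,
      L.dzb_dual h0 hp, H.dzb_change L.sm hp] at e1
    have e2 : (∂z φ' μ p * (h p)⁻¹) • (toC ∘ Y) p =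
        (-(1 / (2 * h' p ^ 2)) * star (chB φ φ' p) + μ p * chB φ φ' p * (1 / (2 * h p ^ 2))) •
          ∂z φ (toC ∘ ψ) p +
        (-(1 / (2 * h' p ^ 2)) * star (chA φ φ' p) + μ p * chA φ φ' p * (1 / (2 * h p ^ 2))) •
          ∂b φ (toC ∘ ψ) p := by
      rw [← smul_smul, eq_sub_of_add_eq e1]
      module
    have := L.eq_zero_of_smul_eq hp (h0 p hp) e2
    exact (mul_eq_zero.1 this).resolve_right (inv_ne_zero (h0 p hp))
  have hA0 := H.ne_zero p hp
  -- Since μ² = A⁴, the scale factor A inherits the vanishing derivative.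
  have hAz : ∂z φ' A p = 0 := by
    have e1 := dc_congr (-Complex.I) hμ2 hp'
    rw [dc_mul _ sμ sμ hp', dc_mul _ (sA.mul sA) (sA.mul sA) hp', dc_mul _ sA sA hp', hμz] at e1
    have e2 : ∂z φ' A p * (4 * A p ^ 3) = 0 := by linear_combination -e1
    exact (mul_eq_zero.1 e2).resolve_right (by simpa using hA0)
  have e1 : ∂z φ' (fun q => μ q * h' q) p = ∂z φ' (fun q => A q * h q) p :=
    dc_congr _ (fun q hq => by
      have := h0' q hq
      simp only [hμ]
      field_simp) hp'
  rw [dc_mul _ sμ L'.smh hp', dc_mul _ sA sh hp', hμz, hAz, H.dz_change L.smh hp] at e1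
  have k1 := h0 p hp
  have k2 := h0' p hp'
  have e2 : ∂z φ' h' p * h p = (chA φ φ' p * ∂z φ h p + chB φ φ' p * ∂b φ h p) * h' p := by
    have e3 : A p * h p * (h' p)⁻¹ * ∂z φ' h' p =
      A p * (chA φ φ' p * ∂z φ h p + chB φ φ' p * ∂b φ h p) := by
        simp only [smul_eq_mul, hμ] at e1
        linear_combination e1
    have e4 : A p * (h p * ∂z φ' h' p) =
      A p * ((chA φ φ' p * ∂z φ h p + chB φ φ' p * ∂b φ h p) * h' p) := by
        field_simp at e3
        linear_combination A p * e3
    linear_combination mul_left_cancel₀ hA0 e4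
  field_simp
  linear_combination e2

/-- The real part of `f_z̄ ⟨ψ, κ⟩_z / ⟨ψ, κ⟩` is a density. -/
lemma re_dzb_mul_logDz_change (hψ : IsParallelSection r y ψ) (hY : IsAdapted r y φ Y)
    (hY' : IsAdapted r y φ' Y') (h0 : ∀ p ∈ φ.source, hFun r φ Y ψ p ≠ 0)
    (h0' : ∀ p ∈ φ'.source, hFun r φ' Y' ψ p ≠ 0) {f : M → ℝ} (hf : Sm φ f) {p : M}
    (hp : p ∈ φ.source) (hp' : p ∈ φ'.source) :
    (∂b φ' (fun q => (f q : ℂ)) p * logDz r φ' Y' ψ p).re =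
      jac φ φ' p * (∂b φ (fun q => (f q : ℂ)) p * logDz r φ Y ψ p).re := by
  have h1 := hY.restr φ'.open_source
  have h2 := hY'.restr φ.open_source
  have s1 : (φ.restr φ'.source).source = φ.source ∩ φ'.source := φ.restr_source' _ φ'.open_source
  have s2 : (φ'.restr φ.source).source = φ'.source ∩ φ.source := φ'.restr_source' _ φ.open_source
  obtain ⟨a, H⟩ := h1.1.exists_pair h2.1 (by rw [s1, s2, inter_comm])
  have hq : p ∈ (φ.restr φ'.source).source := by rw [s1]; exact ⟨hp, hp'⟩
  have e1 := logDz_change hψ h1 h2 H (fun q hq => h0 q (s1 ▸ hq).1)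
    (fun q hq => h0' q (s2 ▸ hq).1) hq
  have sf : Sm (φ.restr φ'.source) (fun q => (f q : ℂ)) := hf.ofReal.restr
  have e2 := H.dzb_change sf hq
  have e3 : star (∂b (φ.restr φ'.source) (fun q => (f q : ℂ)) p) =
      ∂z (φ.restr φ'.source) (fun q => (f q : ℂ)) p := by
    rw [star_dc_of_real_fun sf (fun q _ => Complex.conj_ofReal _) _ hq, star_I]
  have e4 := H.jac_eq hq
  have c1 := H.chA_mul_star_chB hq
  have c2 := H.star_chA_mul_chB hq
  -- Derivatives do not see the restriction of a coordinate to a smaller domain.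
  change (∂b (φ'.restr φ.source) (fun q => (f q : ℂ)) p *
    logDz r (φ'.restr φ.source) Y' ψ p).re = jac (φ.restr φ'.source) (φ'.restr φ.source) p *
      (∂b (φ.restr φ'.source) (fun q => (f q : ℂ)) p * logDz r (φ.restr φ'.source) Y ψ p).re
  rw [e1, e2, ← e3]
  generalize chA (φ.restr φ'.source) (φ'.restr φ.source) p = α at *
  generalize chB (φ.restr φ'.source) (φ'.restr φ.source) p = β at *
  generalize logDz r (φ.restr φ'.source) Y ψ p = l at *
  generalize ∂b (φ.restr φ'.source) (fun q => (f q : ℂ)) p = g at *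
  -- The mixed terms vanish. An antilinear change of coordinate conjugates the product, which is why
  -- only the real part is a density.
  have e5 : (star β • star g + star α • g) * (α * l + β * star l) =
      (α * star α) * (g * l) + (β * star β) * star (g * l) := by
    simp only [smul_eq_mul, star_mul']
    linear_combination (star g * l) * c1 + (g * star l) * c2
  have e : ∀ x : ℂ, x * star x = ((‖x‖ ^ 2 : ℝ) : ℂ) := fun x => (normSq_cast x).symm
  rw [e, e, ← Complex.ofReal_add] at e4
  rw [e5, Complex.ofReal_injective e4, e, e, Complex.add_re, Complex.re_ofReal_mul,
    Complex.re_ofReal_mul, Complex.star_def, Complex.conj_re]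
  ring

end LogDerivative

/-! ### Invariance of the Willmore functional. -/

section Willmore

variable {M : Type*} [TopologicalSpace M] [ChartedSpace ℂ M] [IsManifold 𝓘(ℝ, ℂ) ∞ M]
variable [T2Space M] [CompactSpace M] {n r n' r' : ℕ} {y : M → Quadric n r}

/-- The Willmore functional does not depend on the cover that is used to compute it. -/
lemma CoordCover.willmore_eq (C C' : CoordCover r y) : C.willmore = C'.willmore := by
  have key := sum_chartInt (fun j => (C'.canonical j).chart) C'.subordinate
    (fun i => (C.canonical i).chart) (K := fun i => tsupport (C.ρ i))
    (fun i => (isClosed_tsupport _).isCompact) C.subordinate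
    (F := fun i p => C.ρ i p * (confMetric r (C.φ i) (C.Y i) p).re)
    (fun i => (C.ρ i).contMDiff.continuous.continuousOn.mul
      (sm_confMetric (C.canonical i).canon).re.continuousOn)
    (fun i p _ hn => mul_eq_zero_of_notMem_tsupport hn _)
    (F' := fun i j p => C.ρ i p * (confMetric r (C'.φ j) (C'.Y j) p).re)
    (fun i j => (C.ρ i).contMDiff.continuous.continuousOn.mul
      (sm_confMetric (C'.canonical j).canon).re.continuousOn)
    (fun i j p _ hn => mul_eq_zero_of_notMem_tsupport hn _)
    (fun i j p hp hp' => by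
      rw [confMetric_change (C.canonical i) (C'.canonical j) hp hp', Complex.re_ofReal_mul]
      ring)
  have e1 : C.willmore = 4 * ∑ i, chartInt (C.φ i)
      (fun p => C.ρ i p * (confMetric r (C.φ i) (C.Y i) p).re) := by
    rw [Finset.mul_sum]; rfl
  have e2 : C'.willmore = 4 * ∑ i, chartInt (C'.φ i)
      (fun p => C'.ρ i p * (confMetric r (C'.φ i) (C'.Y i) p).re) := by
    rw [Finset.mul_sum]; rfl
  rw [e1, e2, key]
  congr 1
  refine Finset.sum_congr rfl fun j _ => chartInt_congr fun p _ => ?_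
  rw [← Finset.sum_mul, ← finsum_eq_sum_of_fintype, C.ρ.sum_eq_one (mem_univ p), one_mul]

lemma IsIsothermicOn.exists_cover (hy : IsIsothermicOn r y univ) :
    ∃ C : CoordCover r y, ∀ i, IsAdapted r y (C.φ i) (C.Y i) := by
  choose φ Y hp _ hY using fun p => hy p (mem_univ p)
  obtain ⟨t, ht⟩ := isCompact_univ.elim_finite_subcover (fun p => (φ p).source)
    (fun p => (φ p).open_source) fun p _ => mem_iUnion.2 ⟨p, hp p⟩
  let e := t.equivFin.symm
  obtain ⟨ρ, hρ⟩ := SmoothPartitionOfUnity.exists_isSubordinate (I := 𝓘(ℝ, ℂ)) isClosed_univ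
    (fun i : Fin t.card => (φ (e i)).source) (fun i => (φ (e i)).open_source) fun p _ => by
      obtain ⟨q, hq, hpq⟩ := mem_iUnion₂.1 (ht (mem_univ p))
      exact mem_iUnion.2 ⟨e.symm ⟨q, hq⟩, by simpa using hpq⟩
  exact ⟨⟨_, fun i => φ (e i), fun i => Y (e i), fun i => (hY _).1, ρ, hρ⟩, fun i => hY _⟩

variable {ψ : M → Fin (n + 2) → ℝ} {c : ℝ} {η : M → Quadric n' r'}

/-- The total integral of the divergence `(⟨ψ, κ⟩_z / ⟨ψ, κ⟩)_z̄` vanishes. -/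
lemma CoordCover.sum_chartInt_dzb_logDz (C : CoordCover r y)
    (hC : ∀ i, IsAdapted r y (C.φ i) (C.Y i)) (hψ : IsPolar r y c ψ)
    (hS : immersionSet ψ = univ) :
    ∑ i, chartInt (C.φ i) (fun p => C.ρ i p * (∂b (C.φ i) (logDz r (C.φ i) (C.Y i) ψ) p).re) =
      0 := by
  have h0 : ∀ i, ∀ p ∈ (C.φ i).source, hFun r (C.φ i) (C.Y i) ψ p ≠ 0 := fun i p hp =>
    hψ.hFun_ne_zero (hC i) (by rw [hS]; exact subset_univ _) hp
  have sL : ∀ i, Sm (C.φ i) (logDz r (C.φ i) (C.Y i) ψ) := fun i =>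
    have L := hψ.section_.localPolar (hC i)
    (L.smh.dc _).div L.smh (h0 i)
  have sρ : ∀ i j, Sm (C.φ j) (C.ρ i) := fun i j =>
    Sm.of_contMDiff (hC j).1.chart (C.ρ i).contMDiff
  have hK : ∀ i, IsCompact (tsupport (C.ρ i)) := fun i => (isClosed_tsupport _).isCompact
  have hz : ∀ i j, ∀ p ∈ (C.φ j).source, p ∉ tsupport (C.ρ i) →
      ∂b (C.φ j) (fun q => (C.ρ i q : ℂ)) p = 0 := fun i j p hp hn => by
    have h1 : (fun q => (C.ρ i q : ℂ)) ∘ (C.φ j).symm =ᶠ[nhds (C.φ j p)] fun _ => 0 := by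
      have h2 := (isClosed_tsupport (C.ρ i)).isOpen_compl.mem_nhds hn
      have h3 := ((C.φ j).continuousAt_symm ((C.φ j).map_source hp))
      rw [ContinuousAt, (C.φ j).left_inv hp] at h3
      filter_upwards [h3 h2] with w hw
      simp [image_eq_zero_of_notMem_tsupport hw]
    simp [dc, h1.fderiv_eq]
  -- Integrate by parts to move ∂/∂z̄ onto the partition function.
  have e1 : ∀ i, chartInt (C.φ i)
      (fun p => C.ρ i p * (∂b (C.φ i) (logDz r (C.φ i) (C.Y i) ψ) p).re) = -chartInt (C.φ i)
      (fun p => (∂b (C.φ i) (fun q => (C.ρ i q : ℂ)) p * logDz r (C.φ i) (C.Y i) ψ p).re) := by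
    intro i
    have sf := (sρ i i).ofReal.mul (sL i)
    have e := chartInt_dzb_eq_zero sf (hK i) (C.subordinate i) fun p _ hn => by
      rw [image_eq_zero_of_notMem_tsupport hn, Complex.ofReal_zero, zero_mul]
    rw [chartInt_congr (G := fun p =>
      (∂b (C.φ i) (fun q => (C.ρ i q : ℂ)) p * logDz r (C.φ i) (C.Y i) ψ p).re +
      C.ρ i p * (∂b (C.φ i) (logDz r (C.φ i) (C.Y i) ψ) p).re) fun p hp => by
        rw [dc_mul _ (sρ i i).ofReal (sL i) hp, Complex.add_re, Complex.re_ofReal_mul]] at e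
    have i1 := integrableOn_chart
      (F := fun p => (∂b (C.φ i) (fun q => (C.ρ i q : ℂ)) p * logDz r (C.φ i) (C.Y i) ψ p).re)
      (((sρ i i).ofReal.dc _).mul (sL i)).re.continuousOn (hK i) (C.subordinate i)
      fun p hp hn => by rw [hz i i p hp hn, zero_mul, Complex.zero_re]
    have i2 := integrableOn_chart
      (F := fun p => C.ρ i p * (∂b (C.φ i) (logDz r (C.φ i) (C.Y i) ψ) p).re)
      ((sρ i i).rmul ((sL i).dc _).re).continuousOn (hK i) (C.subordinate i)
      fun p hp hn => mul_eq_zero_of_notMem_tsupport hn _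
    have e' := integral_add i1 i2
    unfold chartInt at e ⊢
    linarith
  -- Each Re((ρ_i)_z̄ h_z/h) is a density supported in one coordinate domain, so the sum may be
  -- regrouped with all i in the same coordinate φ_j.
  have key := sum_chartInt (fun j => (C.canonical j).chart) C.subordinate
    (fun i => (C.canonical i).chart) (K := fun i => tsupport (C.ρ i)) hK C.subordinate
    (F := fun i p =>
      (∂b (C.φ i) (fun q => (C.ρ i q : ℂ)) p * logDz r (C.φ i) (C.Y i) ψ p).re)
    (fun i => (((sρ i i).ofReal.dc _).mul (sL i)).re.continuousOn)
    (fun i p hp hn => by rw [hz i i p hp hn, zero_mul, Complex.zero_re])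
    (F' := fun i j p =>
      (∂b (C.φ j) (fun q => (C.ρ i q : ℂ)) p * logDz r (C.φ j) (C.Y j) ψ p).re)
    (fun i j => (((sρ i j).ofReal.dc _).mul (sL j)).re.continuousOn)
    (fun i j p hp hn => by rw [hz i j p hp hn, zero_mul, Complex.zero_re])
    (fun i j p hp hp' => re_dzb_mul_logDz_change hψ.section_ (hC i) (hC j) (h0 i) (h0 j)
      (sρ i i) hp hp')
  simp only [e1, Finset.sum_neg_distrib]
  rw [key, neg_eq_zero]
  -- In a fixed coordinate the derivatives of the ρ_i add up to the derivative of 1.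
  refine Finset.sum_eq_zero fun j _ => ?_
  rw [chartInt_congr (G := fun _ => 0)]
  · simp [chartInt]
  · intro p hp
    rw [← Complex.re_sum, ← Finset.sum_mul, ← dc_sum _ _ (fun i _ => (sρ i j).ofReal) hp]
    have : (fun q => ∑ i, (C.ρ i q : ℂ)) = fun _ => 1 := by
      funext q
      rw [← Complex.ofReal_sum, ← finsum_eq_sum_of_fintype, C.ρ.sum_eq_one (mem_univ q),
        Complex.ofReal_one]
    rw [this, dc_const, zero_mul, Complex.zero_re, mul_zero]

/-- A globally immersed polar transform has the same Willmore functional. -/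
lemma ConfModel.exists_willmore (D : ConfModel r r' ψ η) (hψ : IsPolar r y c ψ)
    (hy : IsIsothermicOn r y univ) (hS : immersionSet ψ = univ) :
    ∃ w, HasWillmore r y w ∧ HasWillmore r' η w := by
  obtain ⟨C, hC⟩ := hy.exists_cover
  have hS' : ∀ i, (C.φ i).source ⊆ immersionSet ψ := fun i => by rw [hS]; exact subset_univ _
  -- Adapted coordinates are shared, so the same coordinates and partition compute both functionals.
  let C' : CoordCover r' η := ⟨C.k, C.φ, _, fun i => (D.isAdapted hψ (hC i) (hS' i)).1, C.ρ,
    C.subordinate⟩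
  refine ⟨C.willmore, ⟨⟨C⟩, fun C₁ => C₁.willmore_eq C⟩, ⟨⟨C'⟩, fun C₁ => ?_⟩⟩
  rw [C₁.willmore_eq C']
  have e1 : C.willmore = 4 * ∑ i, chartInt (C.φ i)
      (fun p => C.ρ i p * (confMetric r (C.φ i) (C.Y i) p).re) := by
    rw [Finset.mul_sum]; rfl
  have e2 : C'.willmore = 4 * ∑ i, chartInt (C.φ i)
      (fun p => C.ρ i p * (confMetric r' (C.φ i) (C'.Y i) p).re) := by
    rw [Finset.mul_sum]; rfl
  rw [e1, e2]
  congr 1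
  rw [← add_zero (∑ i, chartInt (C.φ i) fun p => C.ρ i p * (confMetric r (C.φ i) (C.Y i) p).re),
    ← C.sum_chartInt_dzb_logDz hC hψ hS, ← Finset.sum_add_distrib]
  refine Finset.sum_congr rfl fun i _ => ?_
  have L := hψ.section_.localPolar (hC i)
  have h0 := fun p hp => hψ.hFun_ne_zero (hC i) (hS' i) (p := p) hp
  have sL : Sm (C.φ i) (logDz r (C.φ i) (C.Y i) ψ) := (L.smh.dc _).div L.smh h0
  have sρ : Sm (C.φ i) (C.ρ i) := Sm.of_contMDiff (hC i).1.chart (C.ρ i).contMDiff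
  have hK : IsCompact (tsupport (C.ρ i)) := (isClosed_tsupport _).isCompact
  have i1 := integrableOn_chart
    (F := fun p => C.ρ i p * (confMetric r (C.φ i) (C.Y i) p).re)
    (sρ.rmul (sm_confMetric (hC i).1.canon).re).continuousOn hK (C.subordinate i)
    fun p hp hn => mul_eq_zero_of_notMem_tsupport hn _
  have i2 := integrableOn_chart
    (F := fun p => C.ρ i p * (∂b (C.φ i) (logDz r (C.φ i) (C.Y i) ψ) p).re)
    (sρ.rmul (sL.dc _).re).continuousOn hK (C.subordinate i)
    fun p hp hn => mul_eq_zero_of_notMem_tsupport hn _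
  refine Eq.trans (chartInt_congr (G := fun p => C.ρ i p * (confMetric r (C.φ i) (C.Y i) p).re +
    C.ρ i p * (∂b (C.φ i) (logDz r (C.φ i) (C.Y i) ψ) p).re) fun p hp => ?_) (integral_add i1 i2)
  have e3 := D.confMetric_eq hψ (hC i) (hS' i) (C'.canonical i) hp
  rw [hψ.section_.polarMetric_eq (hC i) hp] at e3
  -- For real κ, ⟨κ, κ⟩ = ⟨κ, κ̄⟩, so the two integrands differ by the divergence alone.
  rw [← mul_add, ← Complex.add_re, e3, confMetric, (isAdapted_iff.1 (hC i)).2 p hp]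
  rfl

end Willmore

end

/-! ### Parallel sections of a flat bundle that is the range of a projection. -/

section FlatProjection

variable {E : Type*} [NormedAddCommGroup E] [NormedSpace ℝ E] [CompleteSpace E]

/-- Truncation to the interval `[-δ, δ]`. -/
def clamp (δ t : ℝ) : ℝ := max (-δ) (min δ t)

lemma continuous_clamp (δ : ℝ) : Continuous (clamp δ) := by unfold clamp; fun_prop

lemma clamp_of_abs_le {δ t : ℝ} (h : |t| ≤ δ) : clamp δ t = t := by
  rw [abs_le] at h
  rw [clamp, min_eq_right h.2, max_eq_right h.1]

lemma abs_clamp_le {δ : ℝ} (hδ : 0 ≤ δ) (t : ℝ) : |clamp δ t| ≤ δ := by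
  rw [abs_le, clamp]
  exact ⟨le_max_left _ _, max_le (by linarith) (min_le_left _ _)⟩

/-- Solving a linear equation first along the first axis and then in the second direction. -/
lemma exists_double_integral_eq {a₁ a₂ : ℝ × ℝ → E →L[ℝ] E} (h₁ : Continuous a₁)
    (h₂ : Continuous a₂) {C δ : ℝ} (hC₁ : ∀ w, ‖a₁ w‖ ≤ C) (hC₂ : ∀ w, ‖a₂ w‖ ≤ C) (hδ : 0 ≤ δ)
    (hC : 0 ≤ C) (hδC : 4 * δ * C ≤ 1) (x : E) :
    ∃ ψ : ℝ × ℝ → E, Continuous ψ ∧ (∃ B, ∀ w, ‖ψ w‖ ≤ B) ∧ ∀ u v, |u| ≤ δ → |v| ≤ δ →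
      ψ (u, v) = x + (∫ s in 0..u, a₁ (s, 0) (ψ (s, 0))) + ∫ t in 0..v, a₂ (u, t) (ψ (u, t)) := by
  have bd : ∀ (a : ℝ → E →L[ℝ] E) (f : ℝ → E) (B : ℝ), (∀ t, ‖a t‖ ≤ C) → (∀ t, ‖f t‖ ≤ B) →
      ∀ t, ‖∫ s in 0..clamp δ t, a s (f s)‖ ≤ C * B * δ := fun a f B ha hf t => by
    refine (intervalIntegral.norm_integral_le_of_norm_le_const (C := C * B) fun s _ => ?_).trans ?_
    · exact ((a s).le_opNorm _).trans (mul_le_mul (ha s) (hf s) (norm_nonneg _) hC)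
    · rw [sub_zero]
      exact mul_le_mul_of_nonneg_left (abs_clamp_le hδ t)
        (mul_nonneg hC ((norm_nonneg _).trans (hf 0)))
  -- Clamping the variables makes the integral operator act on bounded functions on the whole plane
  -- without changing the equation for |u|, |v| ≤ δ.
  let G : (BoundedContinuousFunction (ℝ × ℝ) E) → ℝ × ℝ → E := fun ψ w =>
    x + (∫ s in 0..clamp δ w.1, a₁ (s, 0) (ψ (s, 0))) +
      ∫ t in 0..clamp δ w.2, a₂ (clamp δ w.1, t) (ψ (clamp δ w.1, t))
  have hGc : ∀ ψ, Continuous (G ψ) := fun ψ => by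
    have c0 : Continuous (clamp δ) := continuous_clamp δ
    have c1 : Continuous fun s : ℝ => a₁ (s, 0) (ψ (s, 0)) :=
      (h₁.comp (by fun_prop)).clm_apply (ψ.continuous.comp (by fun_prop))
    have c2 : Continuous (Function.uncurry fun (w : ℝ × ℝ) (t : ℝ) =>
        a₂ (clamp δ w.1, t) (ψ (clamp δ w.1, t))) :=
      (h₂.comp (by fun_prop)).clm_apply (ψ.continuous.comp (by fun_prop))
    refine (continuous_const.add ?_).add ?_
    · exact intervalIntegral.continuous_parametric_intervalIntegral_of_continuous
        (f := fun (_ : ℝ × ℝ) s => a₁ (s, 0) (ψ (s, 0))) (c1.comp continuous_snd)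
        (c0.comp continuous_fst)
    · exact intervalIntegral.continuous_parametric_intervalIntegral_of_continuous c2
        (c0.comp continuous_snd)
  let T : (BoundedContinuousFunction (ℝ × ℝ) E) → BoundedContinuousFunction (ℝ × ℝ) E := fun ψ =>
    BoundedContinuousFunction.ofNormedAddCommGroup (G ψ) (hGc ψ)
      (‖x‖ + C * ‖ψ‖ * δ + C * ‖ψ‖ * δ) fun w =>
        (norm_add_le _ _).trans (add_le_add ((norm_add_le _ _).trans (add_le_add le_rfl
          (bd (fun s => a₁ (s, 0)) (fun s => ψ (s, 0)) _ (fun _ => hC₁ _)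
            (fun _ => ψ.norm_coe_le_norm _) _)))
          (bd (fun t => a₂ (clamp δ w.1, t)) (fun t => ψ (clamp δ w.1, t)) _ (fun _ => hC₂ _)
            (fun _ => ψ.norm_coe_le_norm _) _))
  -- Each of the two integrals contributes a factor Cδ ≤ 1/4.
  have hT : ContractingWith (1 / 2) T := by
    refine ⟨by rw [← NNReal.coe_lt_coe]; norm_num, LipschitzWith.of_dist_le_mul fun ψ χ => ?_⟩
    refine (BoundedContinuousFunction.dist_le (by positivity)).2 fun w => ?_
    have i1 : ∀ ψ : BoundedContinuousFunction (ℝ × ℝ) E,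
        IntervalIntegrable (fun s => a₁ (s, 0) (ψ (s, 0))) volume 0 (clamp δ w.1) := fun ψ =>
      ((h₁.comp (by fun_prop)).clm_apply (ψ.continuous.comp (by fun_prop))).intervalIntegrable _ _
    have i2 : ∀ ψ : BoundedContinuousFunction (ℝ × ℝ) E, IntervalIntegrable
        (fun t => a₂ (clamp δ w.1, t) (ψ (clamp δ w.1, t))) volume 0 (clamp δ w.2) := fun ψ =>
      ((h₂.comp (by fun_prop)).clm_apply (ψ.continuous.comp (by fun_prop))).intervalIntegrable _ _
    have e : T ψ w - T χ w = (∫ s in 0..clamp δ w.1, a₁ (s, 0) ((ψ - χ) (s, 0))) +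
        ∫ t in 0..clamp δ w.2, a₂ (clamp δ w.1, t) ((ψ - χ) (clamp δ w.1, t)) := by
      simp only [BoundedContinuousFunction.coe_sub, Pi.sub_apply, map_sub]
      rw [intervalIntegral.integral_sub (i1 _) (i1 _), intervalIntegral.integral_sub (i2 _) (i2 _)]
      change G ψ w - G χ w = _
      simp only [G]
      abel
    rw [dist_eq_norm, e, dist_eq_norm]
    refine (norm_add_le _ _).trans ((add_le_add
      (bd (fun s => a₁ (s, 0)) (fun s => (ψ - χ) (s, 0)) _ (fun _ => hC₁ _)
        (fun _ => (ψ - χ).norm_coe_le_norm _) _)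
      (bd (fun t => a₂ (clamp δ w.1, t)) (fun t => (ψ - χ) (clamp δ w.1, t)) _ (fun _ => hC₂ _)
        (fun _ => (ψ - χ).norm_coe_le_norm _) _)).trans ?_)
    push_cast
    nlinarith [norm_nonneg (ψ - χ)]
  have hfix : T hT.fixedPoint = hT.fixedPoint := hT.fixedPoint_isFixedPt
  refine ⟨hT.fixedPoint, hT.fixedPoint.continuous, ⟨_, hT.fixedPoint.norm_coe_le_norm⟩,
    fun u v hu hv => ?_⟩
  conv_lhs => rw [← hfix]
  change G hT.fixedPoint (u, v) = _
  simp only [G, clamp_of_abs_le hu, clamp_of_abs_le hv]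

lemma eq_zero_of_linear_ode {f : ℝ → E} {A : ℝ → E →L[ℝ] E} {δ C : ℝ} (hδ : 0 < δ)
    (hA : ∀ t ∈ Ioo (-δ) δ, ‖A t‖ ≤ C)
    (hf : ∀ t ∈ Ioo (-δ) δ, HasDerivAt f (A t (f t)) t) (h0 : f 0 = 0) :
    ∀ t ∈ Ioo (-δ) δ, f t = 0 := by
  refine ODE_solution_unique_of_mem_Ioo (v := fun t x => A t x) (s := fun _ => univ)
    (K := C.toNNReal) (g := fun _ => 0) (t₀ := 0) (fun t ht => ?_) ⟨by linarith, hδ⟩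
    (fun t ht => ⟨hf t ht, mem_univ _⟩)
    (fun t _ => ⟨by simpa using hasDerivAt_const t (0 : E), mem_univ _⟩) h0
  refine ((A t).lipschitz.weaken ?_).lipschitzOnWith
  rw [← norm_toNNReal]
  exact Real.toNNReal_le_toNNReal (hA t ht)

lemma hasDerivAt_fst {G : Type*} [NormedAddCommGroup G] [NormedSpace ℝ G] {F : ℝ × ℝ → G} {u v : ℝ}
    (h : DifferentiableAt ℝ F (u, v)) :
    HasDerivAt (fun s => F (s, v)) (fderiv ℝ F (u, v) (1, 0)) u :=
  HasFDerivAt.comp_hasDerivAt (f := fun s => (s, v)) u h.hasFDerivAt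
    ((hasDerivAt_id u).prodMk (hasDerivAt_const u v))

lemma hasDerivAt_snd {G : Type*} [NormedAddCommGroup G] [NormedSpace ℝ G] {F : ℝ × ℝ → G} {u v : ℝ}
    (h : DifferentiableAt ℝ F (u, v)) :
    HasDerivAt (fun t => F (u, t)) (fderiv ℝ F (u, v) (0, 1)) v :=
  HasFDerivAt.comp_hasDerivAt (f := fun t => (u, t)) v h.hasFDerivAt
    ((hasDerivAt_const v u).prodMk (hasDerivAt_id v))

variable {P : ℝ × ℝ → E →L[ℝ] E} {Ω : Set (ℝ × ℝ)}

/-- This is the derivative of P² = P. It makes the defect z - Pz of a solution of z' = P'z obey a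
homogeneous linear equation, so that solutions starting in the range of P stay there. -/
lemma fderiv_idem (hΩ : IsOpen Ω) (hP : DifferentiableOn ℝ P Ω)
    (hidem : ∀ w ∈ Ω, ∀ x, P w (P w x) = P w x) {w : ℝ × ℝ} (hw : w ∈ Ω) (v : ℝ × ℝ) (x : E) :
    P w (fderiv ℝ P w v x) + fderiv ℝ P w v (P w x) = fderiv ℝ P w v x := by
  have h1 := (hP.differentiableAt (hΩ.mem_nhds hw)).hasFDerivAt
  have h2 : HasFDerivAt (fun w => P w x) ((fderiv ℝ P w).flip x) w := by
    simpa using h1.clm_apply (hasFDerivAt_const x w)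
  have h3 := h1.clm_apply h2
  have e : (fun w => P w (P w x)) =ᶠ[nhds w] fun w => P w x := by
    filter_upwards [hΩ.mem_nhds hw] with q hq using hidem q hq x
  have h4 := (h3.congr_of_eventuallyEq e.symm).unique h2
  have := congrArg (fun L : ℝ × ℝ →L[ℝ] E => L v) h4
  simpa using this

/-- Existence of parallel sections of the bundle `range P`, if its connection is flat. -/
theorem exists_parallel_of_flat (hΩ : IsOpen Ω) (h0 : (0, 0) ∈ Ω) (hP : ContDiffOn ℝ ∞ P Ω)
    (hidem : ∀ w ∈ Ω, ∀ x, P w (P w x) = P w x)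
    (hflat : ∀ w ∈ Ω, ∀ x, P w x = x → fderiv ℝ P w (1, 0) (fderiv ℝ P w (0, 1) x) =
      fderiv ℝ P w (0, 1) (fderiv ℝ P w (1, 0) x)) :
    ∃ U, IsOpen U ∧ (0, 0) ∈ U ∧ U ⊆ Ω ∧ ∀ x, P (0, 0) x = x → ∃ ψ : ℝ × ℝ → E, ψ (0, 0) = x ∧
      ContDiffOn ℝ ∞ ψ U ∧ (∀ w ∈ U, P w (ψ w) = ψ w) ∧
      ∀ w ∈ U, ∀ v, fderiv ℝ ψ w v = fderiv ℝ P w v (ψ w) := by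
  have hPd : DifferentiableOn ℝ P Ω := hP.differentiableOn (by simp)
  have hP' : ContDiffOn ℝ ∞ (fderiv ℝ P) Ω := hP.fderiv_of_isOpen hΩ (by simp)
  -- For a section with Pψ = ψ, parallelism P dψ = 0 is equivalent to dψ = (dP)ψ, an overdetermined
  -- linear system with coefficients p₁ and p₂.
  set p₁ : ℝ × ℝ → E →L[ℝ] E := fun w => fderiv ℝ P w (1, 0) with hp₁
  set p₂ : ℝ × ℝ → E →L[ℝ] E := fun w => fderiv ℝ P w (0, 1) with hp₂
  have s₁ : ContDiffOn ℝ ∞ p₁ Ω := hP'.clm_apply contDiffOn_const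
  have s₂ : ContDiffOn ℝ ∞ p₂ Ω := hP'.clm_apply contDiffOn_const
  set q : ℝ × ℝ → E →L[ℝ] E := fun w => fderiv ℝ p₁ w (0, 1) with hq
  have sq : ContDiffOn ℝ ∞ q Ω := (s₁.fderiv_of_isOpen hΩ (m := ∞) (by simp)).clm_apply contDiffOn_const
  have hq' : ∀ w ∈ Ω, fderiv ℝ p₂ w (1, 0) = q w := fun w hw => by
    have hd : DifferentiableAt ℝ (fderiv ℝ P) w :=
      (hP'.differentiableOn (by simp)).differentiableAt (hΩ.mem_nhds hw)
    have hs : IsSymmSndFDerivAt ℝ P w := (hP.contDiffAt (hΩ.mem_nhds hw)).isSymmSndFDerivAt (by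
      rw [minSmoothness_of_isRCLikeNormedField]; exact WithTop.coe_le_coe.2 le_top)
    have hv : ∀ v : ℝ × ℝ, fderiv ℝ (fun w => fderiv ℝ P w v) w =
        (fderiv ℝ (fderiv ℝ P) w).flip v := fun v => by
      have := (hd.hasFDerivAt.clm_apply (hasFDerivAt_const v w)).fderiv
      simpa using this
    simp only [hq, hp₁, hp₂, hv]
    exact hs.eq _ _
  obtain ⟨ε, hε, hb⟩ := Metric.nhds_basis_closedBall.mem_iff.1 (hΩ.mem_nhds h0)
  have hcpt : IsCompact (Metric.closedBall ((0, 0) : ℝ × ℝ) ε) := isCompact_closedBall _ _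
  obtain ⟨C₁, hC₁⟩ := hcpt.exists_bound_of_continuousOn (s₁.continuousOn.mono hb)
  obtain ⟨C₂, hC₂⟩ := hcpt.exists_bound_of_continuousOn (s₂.continuousOn.mono hb)
  obtain ⟨C₃, hC₃⟩ := hcpt.exists_bound_of_continuousOn (sq.continuousOn.mono hb)
  -- The lower bound 1 ensures δ ≤ 1/4, which the final estimate needs in addition to 4δC ≤ 1.
  set C : ℝ := max 1 (max C₁ (max C₂ C₃)) with hCdef
  have hC1 : 1 ≤ C := le_max_left _ _
  have hCC₁ : C₁ ≤ C := (le_max_left _ _).trans (le_max_right _ _)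
  have hCC₂ : C₂ ≤ C := (le_max_left _ _).trans ((le_max_right _ _).trans (le_max_right _ _))
  have hCC₃ : C₃ ≤ C := (le_max_right _ _).trans ((le_max_right _ _).trans (le_max_right _ _))
  have hC0 : 0 < C := by linarith
  set δ : ℝ := min ε (1 / (4 * C)) with hδdef
  have hδ : 0 < δ := lt_min hε (by positivity)
  have hδε : δ ≤ ε := min_le_left _ _
  have hδC : 4 * δ * C ≤ 1 := by
    have : δ ≤ 1 / (4 * C) := min_le_right _ _
    rw [le_div_iff₀ (by positivity)] at this
    linarith
  have hδ1 : δ ≤ 1 := by nlinarith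
  have mem_ball : ∀ {u v : ℝ}, (u, v) ∈ Metric.ball ((0, 0) : ℝ × ℝ) δ ↔ |u| < δ ∧ |v| < δ := by
    intro u v
    rw [mem_ball_iff_norm, Prod.mk_sub_mk, sub_zero, sub_zero, Prod.norm_def, max_lt_iff]
    rfl
  have mem_cball : ∀ {u v : ℝ}, (u, v) ∈ Metric.closedBall ((0, 0) : ℝ × ℝ) ε ↔
      |u| ≤ ε ∧ |v| ≤ ε := by
    intro u v
    rw [mem_closedBall_iff_norm, Prod.mk_sub_mk, sub_zero, sub_zero, Prod.norm_def, max_le_iff]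
    rfl
  set cl : ℝ × ℝ → ℝ × ℝ := fun w => (clamp δ w.1, clamp δ w.2) with hcl
  have ccl : Continuous cl :=
    ((continuous_clamp δ).comp continuous_fst).prodMk ((continuous_clamp δ).comp continuous_snd)
  have hclm : ∀ w, cl w ∈ Metric.closedBall ((0, 0) : ℝ × ℝ) ε := fun w =>
    mem_cball.2 ⟨(abs_clamp_le hδ.le _).trans hδε, (abs_clamp_le hδ.le _).trans hδε⟩
  have hcleq : ∀ w ∈ Metric.ball ((0, 0) : ℝ × ℝ) δ, cl w = w := by
    rintro ⟨u, v⟩ hw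
    have := mem_ball.1 hw
    simp only [hcl, clamp_of_abs_le this.1.le, clamp_of_abs_le this.2.le]
  have hU : Metric.ball ((0, 0) : ℝ × ℝ) δ ⊆ Ω := fun w hw => by
    rw [← hcleq w hw]; exact hb (hclm w)
  set a₁ : ℝ × ℝ → E →L[ℝ] E := fun w => p₁ (cl w) with ha₁
  set a₂ : ℝ × ℝ → E →L[ℝ] E := fun w => p₂ (cl w) with ha₂
  set a₃ : ℝ × ℝ → E →L[ℝ] E := fun w => q (cl w) with ha₃
  have c₁ : Continuous a₁ := s₁.continuousOn.comp_continuous ccl fun w => hb (hclm w)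
  have c₂ : Continuous a₂ := s₂.continuousOn.comp_continuous ccl fun w => hb (hclm w)
  have c₃ : Continuous a₃ := sq.continuousOn.comp_continuous ccl fun w => hb (hclm w)
  have b₁ : ∀ w, ‖a₁ w‖ ≤ C := fun w => (hC₁ _ (hclm w)).trans hCC₁
  have b₂ : ∀ w, ‖a₂ w‖ ≤ C := fun w => (hC₂ _ (hclm w)).trans hCC₂
  have b₃ : ∀ w, ‖a₃ w‖ ≤ C := fun w => (hC₃ _ (hclm w)).trans hCC₃
  have e₁ : ∀ w ∈ Metric.ball ((0, 0) : ℝ × ℝ) δ, a₁ w = p₁ w := fun w hw => by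
    simp only [ha₁, hcleq w hw]
  have e₂ : ∀ w ∈ Metric.ball ((0, 0) : ℝ × ℝ) δ, a₂ w = p₂ w := fun w hw => by
    simp only [ha₂, hcleq w hw]
  have e₃ : ∀ w ∈ Metric.ball ((0, 0) : ℝ × ℝ) δ, a₃ w = q w := fun w hw => by
    simp only [ha₃, hcleq w hw]
  refine ⟨Metric.ball (0, 0) δ, Metric.isOpen_ball, Metric.mem_ball_self hδ, hU, fun x hx => ?_⟩
  obtain ⟨ψ, cψ, ⟨B, hB⟩, hψ⟩ :=
    exists_double_integral_eq c₁ c₂ b₁ b₂ hδ.le hC0.le hδC x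
  have hψ0 : ψ (0, 0) = x := by
    have := hψ 0 0 (by simpa using hδ.le) (by simpa using hδ.le)
    simpa using this
  have hψu : ∀ u, |u| ≤ δ → ψ (u, 0) = x + ∫ s in 0..u, a₁ (s, 0) (ψ (s, 0)) := fun u hu => by
    have := hψ u 0 hu (by simpa using hδ.le)
    simpa using this
  have hψv : ∀ u v, |u| ≤ δ → |v| ≤ δ → ψ (u, v) = ψ (u, 0) + ∫ t in 0..v, a₂ (u, t) (ψ (u, t)) :=
    fun u v hu hv => by rw [hψ u v hu hv, hψu u hu]
  have absIoo : ∀ {t : ℝ}, t ∈ Ioo (-δ) δ ↔ |t| < δ := fun {t} => abs_lt.symm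
  have ftc : ∀ {f : ℝ → E}, Continuous f → ∀ b, HasDerivAt (fun u => ∫ s in 0..u, f s) (f b) b :=
    fun {f} hf b => intervalIntegral.integral_hasDerivAt_right (hf.intervalIntegrable _ _)
      hf.aestronglyMeasurable.stronglyMeasurableAtFilter hf.continuousAt
  have du0 : ∀ u, |u| < δ → HasDerivAt (fun s => ψ (s, 0)) (p₁ (u, 0) (ψ (u, 0))) u :=
    fun u hu => by
      have h1 := (ftc (f := fun s => a₁ (s, 0) (ψ (s, 0)))
        ((c₁.comp (by fun_prop)).clm_apply (cψ.comp (by fun_prop))) u).const_add x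
      rw [← e₁ _ (mem_ball.2 ⟨hu, by simpa using hδ⟩)]
      refine h1.congr_of_eventuallyEq ?_
      filter_upwards [isOpen_Ioo.mem_nhds (absIoo.2 hu)] with s hs
      exact hψu s (absIoo.1 hs).le
  have dv : ∀ u v, |u| < δ → |v| < δ →
      HasDerivAt (fun t => ψ (u, t)) (p₂ (u, v) (ψ (u, v))) v := fun u v hu hv => by
    have h1 := (ftc (f := fun t => a₂ (u, t) (ψ (u, t)))
      ((c₂.comp (by fun_prop)).clm_apply (cψ.comp (by fun_prop))) v).const_add (ψ (u, 0))
    rw [← e₂ _ (mem_ball.2 ⟨hu, hv⟩)]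
    refine h1.congr_of_eventuallyEq ?_
    filter_upwards [isOpen_Ioo.mem_nhds (absIoo.2 hv)] with s hs
    exact hψv u s hu.le (absIoo.1 hs).le
  have dP : ∀ {u v : ℝ}, |u| < δ → |v| < δ → DifferentiableAt ℝ P (u, v) := fun hu hv =>
    hPd.differentiableAt (hΩ.mem_nhds (hU (mem_ball.2 ⟨hu, hv⟩)))
  have idem := fun {w} (hw : w ∈ Ω) => fderiv_idem hΩ hPd hidem hw
  -- The left side is the derivative of z - Pz along z' = P'z.
  have sub_idem : ∀ {w}, w ∈ Ω → ∀ v z, fderiv ℝ P w v z -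
      (fderiv ℝ P w v z + P w (fderiv ℝ P w v z)) = (-(fderiv ℝ P w v)) (z - P w z) :=
    fun hw v z => by
      rw [neg_apply, map_sub]
      have := idem hw v z
      rw [← eq_sub_iff_add_eq] at this
      rw [this]; abel
  have z0 : |(0 : ℝ)| < δ := by simpa using hδ
  -- the solution stays in the range of the projection
  have hm0 : ∀ u, |u| < δ → ψ (u, 0) - P (u, 0) (ψ (u, 0)) = 0 := fun u hu => by
    refine eq_zero_of_linear_ode (f := fun s => ψ (s, 0) - P (s, 0) (ψ (s, 0)))
      (A := fun s => -(p₁ (s, 0))) (C := C) hδ (fun t ht => ?_) (fun t ht => ?_) ?_ u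
      (absIoo.2 hu)
    · rw [norm_neg, ← e₁ _ (mem_ball.2 ⟨absIoo.1 ht, z0⟩)]; exact b₁ _
    · have ht' := absIoo.1 ht
      have h1 := (du0 t ht').sub ((hasDerivAt_fst (dP ht' z0)).clm_apply (du0 t ht'))
      rw [hp₁, sub_idem (hU (mem_ball.2 ⟨ht', z0⟩))] at h1
      exact h1
    · simp only [hψ0, hx, sub_self]
  have hm : ∀ u v, |u| < δ → |v| < δ → P (u, v) (ψ (u, v)) = ψ (u, v) := fun u v hu hv => by
    refine (sub_eq_zero.1 ?_).symm
    refine eq_zero_of_linear_ode (f := fun t => ψ (u, t) - P (u, t) (ψ (u, t)))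
      (A := fun t => -(p₂ (u, t))) (C := C) hδ (fun t ht => ?_) (fun t ht => ?_) (hm0 u hu) v
      (absIoo.2 hv)
    · rw [norm_neg, ← e₂ _ (mem_ball.2 ⟨hu, absIoo.1 ht⟩)]; exact b₂ _
    · have ht' := absIoo.1 ht
      have h1 := (dv u t hu ht').sub ((hasDerivAt_snd (dP hu ht')).clm_apply (dv u t hu ht'))
      rw [hp₂, sub_idem (hU (mem_ball.2 ⟨hu, ht'⟩))] at h1
      exact h1
  -- the derivative in the first direction
  set Z : ℝ × ℝ → E := fun w => a₁ w (ψ w) with hZ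
  have cZ : Continuous Z := c₁.clm_apply cψ
  -- Off the axis v = 0 only the v-derivative of ψ is known so far. Ψ has the required u-derivative
  -- a₁ψ by construction, and the goal is ψ = Ψ; differentiability of ψ in u is never presupposed.
  set Ψ : ℝ → ℝ → E := fun u v => ψ (0, v) + ∫ s in 0..u, Z (s, v) with hΨ
  have cΨ : Continuous (Function.uncurry Ψ) := by
    refine (cψ.comp (by fun_prop)).add ?_
    exact intervalIntegral.continuous_parametric_intervalIntegral_of_continuous
      (f := fun (w : ℝ × ℝ) s => Z (s, w.2)) (cZ.comp (by fun_prop)) continuous_fst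
  have dΨ : ∀ u v, HasDerivAt (fun s => Ψ s v) (Z (u, v)) u := fun u v =>
    (ftc (f := fun s => Z (s, v)) (cZ.comp (by fun_prop)) u).const_add _
  have uIcc_lt : ∀ {b t : ℝ}, |b| < δ → t ∈ uIcc 0 b → |t| < δ := fun hb ht => by
    have := abs_sub_left_of_mem_uIcc ht
    rw [sub_zero, sub_zero] at this
    exact this.trans_lt hb
  -- Flatness enters here: it exchanges p₁p₂ψ for p₂p₁ψ in the v-derivative of Z.
  have id1 : ∀ s v, |s| < δ → |v| < δ →
      Z (s, v) = Z (s, 0) + ∫ t in 0..v, (a₃ (s, t) (ψ (s, t)) + a₂ (s, t) (Z (s, t))) := by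
    intro s v hs hv
    have cs : Continuous fun t : ℝ => (s, t) := by fun_prop
    have ci : Continuous fun t => a₃ (s, t) (ψ (s, t)) + a₂ (s, t) (Z (s, t)) :=
      ((c₃.comp cs).clm_apply (cψ.comp cs)).add ((c₂.comp cs).clm_apply (cZ.comp cs))
    rw [intervalIntegral.integral_eq_sub_of_hasDerivAt (f := fun t => Z (s, t)) (fun t ht => ?_)
      (ci.intervalIntegrable _ _)]
    · abel
    have ht' := uIcc_lt hv ht
    have hw := mem_ball.2 ⟨hs, ht'⟩
    have h1 := (hasDerivAt_snd ((s₁.differentiableOn (by simp)).differentiableAt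
      (hΩ.mem_nhds (hU hw)))).clm_apply (dv s t hs ht')
    have h2 := hflat _ (hU hw) _ (hm s t hs ht')
    have h3 : a₃ (s, t) (ψ (s, t)) + a₂ (s, t) (Z (s, t)) =
        fderiv ℝ p₁ (s, t) (0, 1) (ψ (s, t)) + p₁ (s, t) (p₂ (s, t) (ψ (s, t))) := by
      simp only [hZ]
      rw [e₃ _ hw, e₂ _ hw, e₁ _ hw, ← h2]
    rw [h3]
    refine h1.congr_of_eventuallyEq ?_
    filter_upwards [isOpen_Ioo.mem_nhds (absIoo.2 ht')] with t' ht''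
    simp only [hZ]
    rw [e₁ _ (mem_ball.2 ⟨hs, absIoo.1 ht''⟩)]
  have id2 : ∀ u t, |u| < δ → |t| < δ → a₂ (u, t) (Ψ u t) = a₂ (0, t) (ψ (0, t)) +
      ∫ s in 0..u, (a₃ (s, t) (Ψ s t) + a₂ (s, t) (Z (s, t))) := by
    intro u t hu ht
    have cs : Continuous fun s : ℝ => (s, t) := by fun_prop
    have ci : Continuous fun s => a₃ (s, t) (Ψ s t) + a₂ (s, t) (Z (s, t)) :=
      ((c₃.comp cs).clm_apply (cΨ.comp cs)).add ((c₂.comp cs).clm_apply (cZ.comp cs))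
    rw [intervalIntegral.integral_eq_sub_of_hasDerivAt (f := fun s => a₂ (s, t) (Ψ s t))
      (fun s hs => ?_) (ci.intervalIntegrable _ _)]
    · simp [hΨ]
    have hs' := uIcc_lt hu hs
    have hw := mem_ball.2 ⟨hs', ht⟩
    have h1 := (hasDerivAt_fst ((s₂.differentiableOn (by simp)).differentiableAt
      (hΩ.mem_nhds (hU hw)))).clm_apply (dΨ s t)
    rw [hq' _ (hU hw), ← e₃ _ hw, ← e₂ _ hw] at h1
    refine h1.congr_of_eventuallyEq ?_
    filter_upwards [isOpen_Ioo.mem_nhds (absIoo.2 hs')] with s' hs''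
    rw [e₂ _ (mem_ball.2 ⟨absIoo.1 hs'', ht⟩)]
  -- Exchanging the order of integration gives a homogeneous linear integral equation for ψ - Ψ.
  have id3 : ∀ u v, |u| < δ → |v| < δ → ψ (u, v) - Ψ u v =
      ∫ t in 0..v, (a₂ (u, t) (ψ (u, t) - Ψ u t) +
        ∫ s in 0..u, a₃ (s, t) (Ψ s t - ψ (s, t))) := by
    intro u v hu hv
    have cG : Continuous (Function.uncurry fun s t : ℝ =>
        a₃ (s, t) (ψ (s, t)) + a₂ (s, t) (Z (s, t))) :=
      (c₃.clm_apply cψ).add (c₂.clm_apply cZ)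
    have i0 : ∀ u, Continuous fun t => a₂ (u, t) (ψ (u, t)) := fun u =>
      (c₂.comp (by fun_prop)).clm_apply (cψ.comp (by fun_prop))
    have iG : Continuous fun t => ∫ s in 0..u, (a₃ (s, t) (ψ (s, t)) + a₂ (s, t) (Z (s, t))) :=
      intervalIntegral.continuous_parametric_intervalIntegral_of_continuous'
        (f := fun t s => a₃ (s, t) (ψ (s, t)) + a₂ (s, t) (Z (s, t)))
        (cG.comp continuous_swap) 0 u
    have iG' : Continuous fun s => ∫ t in 0..v, (a₃ (s, t) (ψ (s, t)) + a₂ (s, t) (Z (s, t))) :=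
      intervalIntegral.continuous_parametric_intervalIntegral_of_continuous'
        (f := fun s t => a₃ (s, t) (ψ (s, t)) + a₂ (s, t) (Z (s, t))) cG 0 v
    have k1 : Ψ u v = ψ (u, 0) + (∫ t in 0..v, a₂ (0, t) (ψ (0, t))) +
        ∫ t in 0..v, ∫ s in 0..u, (a₃ (s, t) (ψ (s, t)) + a₂ (s, t) (Z (s, t))) := by
      have k2 : ∫ s in 0..u, Z (s, v) = (∫ s in 0..u, Z (s, 0)) +
          ∫ s in 0..u, ∫ t in 0..v, (a₃ (s, t) (ψ (s, t)) + a₂ (s, t) (Z (s, t))) := by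
        have cZ0 : Continuous fun s : ℝ => Z (s, 0) := cZ.comp (by fun_prop)
        rw [← intervalIntegral.integral_add (cZ0.intervalIntegrable _ _)
          (iG'.intervalIntegrable _ _)]
        refine intervalIntegral.integral_congr fun s hs => id1 s v (uIcc_lt hu hs) hv
      have k3 := intervalIntegral_intervalIntegral_swap (a := 0) (b := u) (c := 0) (d := v)
        (cG.continuousOn.integrableOn_compact
          (isCompact_uIcc.prod isCompact_uIcc) |>.mono_set
            (prod_mono uIoc_subset_uIcc uIoc_subset_uIcc))
      simp only [hΨ]
      rw [k2, k3, hψv 0 v z0.le hv.le, hψ0, hψu u hu.le]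
      abel
    rw [hψv u v hu.le hv.le, k1]
    have k4 : ∫ t in 0..v, (a₂ (u, t) (ψ (u, t) - Ψ u t) +
        ∫ s in 0..u, a₃ (s, t) (Ψ s t - ψ (s, t))) = ∫ t in 0..v, (a₂ (u, t) (ψ (u, t)) -
        a₂ (0, t) (ψ (0, t)) -
        ∫ s in 0..u, (a₃ (s, t) (ψ (s, t)) + a₂ (s, t) (Z (s, t)))) := by
      refine intervalIntegral.integral_congr fun t ht => ?_
      rw [map_sub, id2 u t hu (uIcc_lt hv ht)]
      have k5 : ∫ s in 0..u, (a₃ (s, t) (Ψ s t) + a₂ (s, t) (Z (s, t))) =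
          (∫ s in 0..u, a₃ (s, t) (Ψ s t - ψ (s, t))) +
            ∫ s in 0..u, (a₃ (s, t) (ψ (s, t)) + a₂ (s, t) (Z (s, t))) := by
        have cs : Continuous fun s : ℝ => (s, t) := by fun_prop
        have i3 : Continuous fun s => a₃ (s, t) (Ψ s t - ψ (s, t)) :=
          (c₃.comp cs).clm_apply ((cΨ.comp cs).sub (cψ.comp cs))
        have i4 : Continuous fun s => a₃ (s, t) (ψ (s, t)) + a₂ (s, t) (Z (s, t)) := cG.comp cs
        rw [← intervalIntegral.integral_add (i3.intervalIntegrable _ _) (i4.intervalIntegrable _ _)]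
        refine intervalIntegral.integral_congr fun s _ => ?_
        simp only [map_sub]
        abel
      rw [k5]
      abel
    have i5 : Continuous fun t => a₂ (u, t) (ψ (u, t)) - a₂ (0, t) (ψ (0, t)) := (i0 u).sub (i0 0)
    rw [k4, intervalIntegral.integral_sub (i5.intervalIntegrable _ _) (iG.intervalIntegrable _ _),
      intervalIntegral.integral_sub ((i0 u).intervalIntegrable _ _)
      ((i0 0).intervalIntegrable _ _)]
    abel
  have uIoc_lt : ∀ {b t : ℝ}, |b| < δ → t ∈ uIoc 0 b → |t| < δ := fun hb ht =>
    uIcc_lt hb (uIoc_subset_uIcc ht)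
  -- The equation `id3` halves any uniform bound, since (CN + CNδ)δ = δC·N(1 + δ) ≤ N/2; iteration
  -- forces ψ = Ψ.
  have half : ∀ N, (∀ u v, |u| < δ → |v| < δ → ‖ψ (u, v) - Ψ u v‖ ≤ N) →
      ∀ u v, |u| < δ → |v| < δ → ‖ψ (u, v) - Ψ u v‖ ≤ N / 2 := by
    intro N hN u v hu hv
    have hN0 : 0 ≤ N := (norm_nonneg _).trans (hN u v hu hv)
    rw [id3 u v hu hv]
    refine (intervalIntegral.norm_integral_le_of_norm_le_const (C := C * N + C * N * δ)
      fun t ht => ?_).trans ?_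
    · have ht' := uIoc_lt hv ht
      refine (norm_add_le _ _).trans (add_le_add ?_ ?_)
      · exact ((a₂ _).le_opNorm _).trans
          (mul_le_mul (b₂ _) (hN u t hu ht') (norm_nonneg _) hC0.le)
      · refine (intervalIntegral.norm_integral_le_of_norm_le_const (C := C * N)
          fun s hs => ?_).trans ?_
        · rw [← norm_neg, ← map_neg, neg_sub]
          exact ((a₃ _).le_opNorm _).trans
            (mul_le_mul (b₃ _) (hN s t (uIoc_lt hu hs) ht') (norm_nonneg _) hC0.le)
        · rw [sub_zero]
          exact mul_le_mul_of_nonneg_left hu.le (by positivity)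
    · rw [sub_zero]
      calc (C * N + C * N * δ) * |v| ≤ (C * N + C * N * δ) * δ :=
            mul_le_mul_of_nonneg_left hv.le (by positivity)
        _ = (δ * C) * N * (1 + δ) := by ring
        _ ≤ (1 / 4) * N * 2 := by
            refine mul_le_mul (mul_le_mul_of_nonneg_right (by linarith) hN0) (by linarith)
              (by positivity) (by positivity)
        _ = N / 2 := by ring
  have hD : ∀ u v, |u| < δ → |v| < δ → ψ (u, v) = Ψ u v := by
    have b0 : ∀ u v, |u| < δ → |v| < δ → ‖ψ (u, v) - Ψ u v‖ ≤ B + (B + C * B * δ) := by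
      intro u v hu hv
      have hB0 : 0 ≤ B := (norm_nonneg _).trans (hB 0)
      refine (norm_sub_le _ _).trans (add_le_add (hB _) ((norm_add_le _ _).trans
        (add_le_add (hB _) ?_)))
      refine (intervalIntegral.norm_integral_le_of_norm_le_const (C := C * B)
        fun s _ => ?_).trans ?_
      · exact ((a₁ _).le_opNorm _).trans (mul_le_mul (b₁ _) (hB _) (norm_nonneg _) hC0.le)
      · rw [sub_zero]
        exact mul_le_mul_of_nonneg_left hu.le (by positivity)
    have bk : ∀ k : ℕ, ∀ u v, |u| < δ → |v| < δ →
        ‖ψ (u, v) - Ψ u v‖ ≤ (B + (B + C * B * δ)) * (1 / 2) ^ k := by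
      intro k
      induction k with
      | zero => simpa using b0
      | succ k ih =>
        intro u v hu hv
        refine (half _ ih u v hu hv).trans (le_of_eq ?_)
        rw [pow_succ]; ring
    intro u v hu hv
    rw [← sub_eq_zero, ← norm_le_zero_iff]
    have ht : Filter.Tendsto (fun k : ℕ => (B + (B + C * B * δ)) * (1 / 2 : ℝ) ^ k) Filter.atTop
        (nhds ((B + (B + C * B * δ)) * 0)) :=
      (tendsto_pow_atTop_nhds_zero_of_lt_one (by norm_num) (by norm_num)).const_mul _
    rw [mul_zero] at ht
    exact ge_of_tendsto' ht fun k => bk k u v hu hv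
  have hfd : ∀ w ∈ Metric.ball ((0, 0) : ℝ × ℝ) δ,
      HasFDerivAt ψ ((fderiv ℝ P w).flip (ψ w)) w := by
    rintro ⟨u, v⟩ hw
    have hw' := mem_ball.1 hw
    have hnb := Metric.isOpen_ball.mem_nhds hw
    -- Both partial derivatives now exist near w and are continuous there, which gives
    -- differentiability.
    have key := hasStrictFDerivAt_uncurry_coprod (𝕜 := ℝ) (u := (u, v)) (f := fun u v => ψ (u, v))
      (f₁ := fun u v => ContinuousLinearMap.toSpanSingleton ℝ (a₁ (u, v) (ψ (u, v))))
      (f₂ := fun u v => ContinuousLinearMap.toSpanSingleton ℝ (a₂ (u, v) (ψ (u, v))))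
      (by
        filter_upwards [hnb] with w hw
        have hw' := mem_ball.1 (show (w.1, w.2) ∈ _ from hw)
        refine HasDerivAt.hasFDerivAt ((dΨ w.1 w.2).congr_of_eventuallyEq ?_)
        filter_upwards [isOpen_Ioo.mem_nhds (absIoo.2 hw'.1)] with s hs
        exact hD s w.2 (absIoo.1 hs) hw'.2)
      (by
        filter_upwards [hnb] with w hw
        have hw' := mem_ball.1 (show (w.1, w.2) ∈ _ from hw)
        refine HasDerivAt.hasFDerivAt ?_
        have := dv w.1 w.2 hw'.1 hw'.2
        rwa [← e₂ _ hw] at this)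
      ((ContinuousLinearMap.toSpanSingletonCLE.continuous.comp (c₁.clm_apply cψ)).continuousAt)
      ((ContinuousLinearMap.toSpanSingletonCLE.continuous.comp (c₂.clm_apply cψ)).continuousAt)
    have key' := key.hasFDerivAt
    refine key'.congr_fderiv ?_
    ext
    · simp [Function.HasUncurry.uncurry, e₁ _ hw, hp₁]
    · simp [Function.HasUncurry.uncurry, e₂ _ hw, hp₂]
  refine ⟨ψ, hψ0, ?_, ?_, ?_⟩
  -- Bootstrapping: dψ = (dP)ψ is as regular as ψ, so each step gains one derivative.
  · rw [contDiffOn_infty]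
    intro k
    induction k with
    | zero => exact contDiffOn_zero.2 cψ.continuousOn
    | succ k ih =>
      push_cast
      rw [contDiffOn_succ_iff_fderiv_of_isOpen Metric.isOpen_ball]
      refine ⟨fun w hw => (hfd w hw).differentiableAt.differentiableWithinAt, by simp, ?_⟩
      rw [contDiffOn_clm_apply]
      intro v
      have h1 : ContDiffOn ℝ k (fun w => fderiv ℝ P w v) (Metric.ball (0, 0) δ) :=
        ((hP'.mono hU).of_le (WithTop.coe_le_coe.2 le_top)).clm_apply contDiffOn_const
      exact (h1.clm_apply ih).congr fun w hw => by rw [(hfd w hw).fderiv]; rfl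
  · rintro ⟨u, v⟩ hw
    have hw' := mem_ball.1 hw
    exact hm u v hw'.1 hw'.2
  · intro w hw v
    rw [(hfd w hw).fderiv]
    rfl

end FlatProjection

section

local notation "∂z" => dc (-Complex.I)
local notation "∂b" => dc Complex.I

/-! ### Derivatives of operator-valued functions. -/

section OperatorCalculus

variable {M : Type*} [TopologicalSpace M] {m : ℕ} {φ : OpenPartialHomeomorph M ℂ}

/-- Endomorphisms of `ℂ ^ m` by their columns. -/
def ofColumns (m : ℕ) : (Fin m → Fin m → ℂ) →L[ℂ] (Fin m → ℂ) →L[ℂ] Fin m → ℂ :=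
  LinearMap.toContinuousLinearMap
    { toFun := fun w => ∑ j, (ContinuousLinearMap.proj j : (Fin m → ℂ) →L[ℂ] ℂ).smulRight (w j)
      map_add' := fun v w => by
        ext; simp [Finset.sum_add_distrib]
      map_smul' := fun a w => by
        ext; simp [Finset.mul_sum, mul_left_comm] }

lemma ofColumns_apply (w : Fin m → Fin m → ℂ) (x : Fin m → ℂ) :
    ofColumns m w x = ∑ j, x j • w j := by
  simp [ofColumns]

lemma Sm.of_forall_apply {L : M → (Fin m → ℂ) →L[ℂ] Fin m → ℂ} (h : ∀ x, Sm φ fun q => L q x) :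
    Sm φ L := by
  have h1 : Sm φ fun q => fun j => L q (Pi.single j 1) := Sm.pi fun j => h _
  refine (h1.clm ((ofColumns m).restrictScalars ℝ)).congr fun q _ => ?_
  ext1 x
  rw [ContinuousLinearMap.coe_restrictScalars', ofColumns_apply]
  conv_lhs => rw [pi_eq_sum_univ' x, map_sum]
  exact Finset.sum_congr rfl fun j _ => by rw [map_smul]

lemma dc_clm_apply {L : M → (Fin m → ℂ) →L[ℂ] Fin m → ℂ} {F : M → Fin m → ℂ} (c : ℂ)
    (hL : Sm φ L) (hF : Sm φ F) {p : M} (hp : p ∈ φ.source) :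
    dc c φ (fun q => L q (F q)) p = dc c φ L p (F p) + L p (dc c φ F p) := by
  have key : ∀ (A : (Fin m → ℂ) →L[ℂ] Fin m → ℂ) x, A x = ∑ j, x j • A (Pi.single j 1) :=
    fun A x => by
      conv_lhs => rw [pi_eq_sum_univ' x, map_sum]
      exact Finset.sum_congr rfl fun j _ => by rw [map_smul]
  have hc : ∀ j, Sm φ fun q => L q (Pi.single j 1) := fun j =>
    hL.clm ((ContinuousLinearMap.apply ℂ (Fin m → ℂ) (Pi.single j 1)).restrictScalars ℝ)
  rw [dc_congr c (fun q _ => key (L q) (F q)) hp,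
    dc_sum c _ (fun j _ => (hF.apply j).smul (hc j)) hp, key (dc c φ L p), key (L p),
    ← Finset.sum_add_distrib]
  refine Finset.sum_congr rfl fun j _ => ?_
  rw [dc_smul c (hF.apply j) (hc j) hp, dc_apply c hF hp, add_comm]
  congr 2
  exact dc_clm c hL (ContinuousLinearMap.apply ℂ (Fin m → ℂ) (Pi.single j 1)) hp

lemma dc_apply_const {L : M → (Fin m → ℂ) →L[ℂ] Fin m → ℂ} (c : ℂ) (hL : Sm φ L)
    (x : Fin m → ℂ) {p : M} (hp : p ∈ φ.source) :
    dc c φ L p x = dc c φ (fun q => L q x) p := by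
  rw [dc_clm_apply c hL (Sm.const x) hp, dc_const, map_zero, add_zero]

end OperatorCalculus

/-! ### The normal projection and the Ricci equation. -/

section NormalProjection

variable {M : Type*} [TopologicalSpace M] {m s : ℕ} {φ : OpenPartialHomeomorph M ℂ}

/-- The projection onto the conformal normal space. -/
def nproj (s : ℕ) (φ : OpenPartialHomeomorph M ℂ) (X : M → Fin m → ℂ) (p : M) :
    (Fin m → ℂ) →L[ℂ] Fin m → ℂ :=
  LinearMap.toContinuousLinearMap
    { toFun := npart s (X p) (∂z φ X p) (∂b φ X p) (∂b φ (∂z φ X) p)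
      map_add' := fun x y => by
        simp only [npart, ip_add_left]; module
      map_smul' := fun a x => by
        simp only [npart, ip_smul_left, RingHom.id_apply]; module }

variable {X : M → Fin m → ℂ}

lemma nproj_apply (p : M) (x : Fin m → ℂ) : nproj s φ X p x =
    npart s (X p) (∂z φ X p) (∂b φ X p) (∂b φ (∂z φ X) p) x := rfl

namespace Canon

variable (h : Canon s φ X)
include h

lemma sm_nproj : Sm φ (nproj s φ X) := by
  refine Sm.of_forall_apply fun x => ?_
  have c2 : Sm φ fun _ : M => (2 : ℂ) := Sm.const 2
  have hx : Sm φ fun _ : M => x := Sm.const x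
  have hA := h.sm.dc (-Complex.I)
  have hB := h.sm.dc Complex.I
  have hW := hA.dc Complex.I
  exact ((((hx.sub ((c2.mul (hx.ip s hB)).smul hA)).sub ((c2.mul (hx.ip s hA)).smul hB)).add
    ((c2.mul (hx.ip s hW)).smul h.sm)).add ((c2.mul (hx.ip s h.sm)).smul hW)).add
    ((((Sm.const 4).mul (hW.ip s hW)).mul (hx.ip s h.sm)).smul h.sm)

/-- The derivatives of the normal projection on normal vectors. -/
lemma dc_nproj_of_perp (c : ℂ) {p : M} (hp : p ∈ φ.source) {x : Fin m → ℂ}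
    (hx : x ∈ perp s (Submodule.span ℂ {X p, ∂z φ X p, ∂b φ X p, ∂b φ (∂z φ X) p})) :
    dc c φ (nproj s φ X) p x = (-(2 * ip s x (dc c φ (∂b φ X) p))) • ∂z φ X p +
      (-(2 * ip s x (dc c φ (∂z φ X) p))) • ∂b φ X p +
      (2 * ip s x (dc c φ (∂b φ (∂z φ X)) p)) • X p +
      (2 * ip s x (dc c φ X p)) • ∂b φ (∂z φ X) p +
      (4 * ip s (∂b φ (∂z φ X) p) (∂b φ (∂z φ X) p) * ip s x (dc c φ X p)) • X p := by
  obtain ⟨h1, h2, h3, h4⟩ := mem_perp_four.1 hx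
  have c2 : Sm φ fun _ : M => (2 : ℂ) := Sm.const 2
  have hx : Sm φ fun _ : M => x := Sm.const x
  have hA := h.sm.dc (-Complex.I)
  have hB := h.sm.dc Complex.I
  have hW := hA.dc Complex.I
  have d : ∀ {F : M → Fin m → ℂ}, Sm φ F →
      dc c φ (fun q => ip s x (F q)) p = ip s x (dc c φ F p) := fun hF => by
    rw [dc_ip s c hx hF hp, dc_const, ip_zero_left, zero_add]
  have t1 := c2.mul (hx.ip s hB)
  have t2 := c2.mul (hx.ip s hA)
  have t3 := c2.mul (hx.ip s hW)
  have t4 := c2.mul (hx.ip s h.sm)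
  have t5 := ((Sm.const (4 : ℂ)).mul (hW.ip s hW)).mul (hx.ip s h.sm)
  rw [dc_apply_const c h.sm_nproj x hp]
  simp only [nproj_apply, npart]
  rw [dc_add c ((((hx.sub (t1.smul hA)).sub (t2.smul hB)).add (t3.smul h.sm)).add (t4.smul hW))
      (t5.smul h.sm) hp,
    dc_add c (((hx.sub (t1.smul hA)).sub (t2.smul hB)).add (t3.smul h.sm)) (t4.smul hW) hp,
    dc_add c ((hx.sub (t1.smul hA)).sub (t2.smul hB)) (t3.smul h.sm) hp,
    dc_sub c (hx.sub (t1.smul hA)) (t2.smul hB) hp, dc_sub c hx (t1.smul hA) hp, dc_const,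
    dc_smul c t1 hA hp, dc_smul c t2 hB hp, dc_smul c t3 h.sm hp, dc_smul c t4 hW hp,
    dc_smul c t5 h.sm hp, dc_const_mul c 2 (hx.ip s hB) hp, dc_const_mul c 2 (hx.ip s hA) hp,
    dc_const_mul c 2 (hx.ip s hW) hp, dc_const_mul c 2 (hx.ip s h.sm) hp,
    dc_mul c ((Sm.const (4 : ℂ)).mul (hW.ip s hW)) (hx.ip s h.sm) hp, d hA, d hB, d hW, d h.sm,
    h1, h2, h3, h4]
  module

/-- The pairings of a normal x with the tangent frame vanish, so only differentiated coefficients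
survive. In particular the derivative maps normal vectors to tangent ones, as a second fundamental
form does. -/
lemma dz_nproj {p : M} (hp : p ∈ φ.source) {x : Fin m → ℂ}
    (hx : x ∈ perp s (Submodule.span ℂ {X p, ∂z φ X p, ∂b φ X p, ∂b φ (∂z φ X) p})) :
    ∂z φ (nproj s φ X) p x = (-(2 * ip s x (∂z φ (∂z φ X) p))) • ∂b φ X p +
      (2 * ip s x (∂z φ (∂b φ (∂z φ X)) p)) • X p := by
  obtain ⟨h1, h2, h3, h4⟩ := mem_perp_four.1 hx
  rw [h.dc_nproj_of_perp _ hp hx, dc_comm (-Complex.I) Complex.I h.sm hp, h2, h4]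
  module

lemma dzb_nproj {p : M} (hp : p ∈ φ.source) {x : Fin m → ℂ}
    (hx : x ∈ perp s (Submodule.span ℂ {X p, ∂z φ X p, ∂b φ X p, ∂b φ (∂z φ X) p})) :
    ∂b φ (nproj s φ X) p x = (-(2 * ip s x (∂b φ (∂b φ X) p))) • ∂z φ X p +
      (2 * ip s x (∂b φ (∂b φ (∂z φ X)) p)) • X p := by
  obtain ⟨h1, h2, h3, h4⟩ := mem_perp_four.1 hx
  rw [h.dc_nproj_of_perp _ hp hx, h3, h4]
  module

lemma nproj_of_mem {p : M} (hp : p ∈ φ.source) {x : Fin m → ℂ}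
    (hx : x ∈ Submodule.span ℂ {X p, ∂z φ X p, ∂b φ X p, ∂b φ (∂z φ X) p}) :
    nproj s φ X p x = 0 := by
  rw [nproj_apply, ← (h.gram hp).normalPart_eq]
  exact Polar.normalPart_eq (h.gram hp).nondeg (fun v _ => ip_zero_left _ v) (by rwa [sub_zero])

/-- The derivative of the normal projection on tangent vector fields. -/
lemma dc_nproj_tangent (c : ℂ) {F : M → Fin m → ℂ} (hF : Sm φ F)
    (h0 : ∀ q ∈ φ.source, F q ∈ Submodule.span ℂ {X q, ∂z φ X q, ∂b φ X q, ∂b φ (∂z φ X) q})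
    {p : M} (hp : p ∈ φ.source) :
    dc c φ (nproj s φ X) p (F p) = - nproj s φ X p (dc c φ F p) := by
  have := dc_clm_apply c h.sm_nproj hF hp
  rw [dc_congr c (G := fun _ => 0) (fun q hq => h.nproj_of_mem hq (h0 q hq)) hp, dc_const] at this
  exact eq_neg_of_add_eq_zero_left this.symm

/-- The Ricci equation, if `κ` is real. -/
lemma dc_nproj_comm {p : M} (hp : p ∈ φ.source)
    (hκ : star (nproj s φ X p (∂z φ (∂z φ X) p)) = nproj s φ X p (∂z φ (∂z φ X) p))
    {x : Fin m → ℂ}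
    (hx : x ∈ perp s (Submodule.span ℂ {X p, ∂z φ X p, ∂b φ X p, ∂b φ (∂z φ X) p})) :
    ∂z φ (nproj s φ X) p (∂b φ (nproj s φ X) p x) =
      ∂b φ (nproj s φ X) p (∂z φ (nproj s φ X) p x) := by
  obtain ⟨h1, h2, h3, h4⟩ := mem_perp_four.1 hx
  have mX : ∀ q ∈ φ.source,
      X q ∈ Submodule.span ℂ {X q, ∂z φ X q, ∂b φ X q, ∂b φ (∂z φ X) q} :=
    fun q _ => Submodule.subset_span (by simp)
  have mA : ∀ q ∈ φ.source,
      ∂z φ X q ∈ Submodule.span ℂ {X q, ∂z φ X q, ∂b φ X q, ∂b φ (∂z φ X) q} :=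
    fun q _ => Submodule.subset_span (by simp)
  have mB : ∀ q ∈ φ.source,
      ∂b φ X q ∈ Submodule.span ℂ {X q, ∂z φ X q, ∂b φ X q, ∂b φ (∂z φ X) q} :=
    fun q _ => Submodule.subset_span (by simp)
  -- The projection commutes with conjugation, so for real κ the vectors X_z̄z̄ and X_zz have the
  -- same normal part.
  have k1 : nproj s φ X p (∂b φ (∂b φ X) p) = nproj s φ X p (∂z φ (∂z φ X) p) := by
    rw [← hκ]
    simp only [nproj_apply, npart, star_add, star_sub, star_smul, star_mul', star_ofNat, star_ip,
      h.star_dzz hp, h.real p hp, h.star_dz hp, h.star_dzb hp, h.star_W hp]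
    abel
  have k2 : ip s x (∂z φ (∂z φ X) p) = ip s x (nproj s φ X p (∂z φ (∂z φ X) p)) := by
    rw [nproj_apply, h.npart_dzz hp, ip_add_right, ip_smul_right, h1, mul_zero, add_zero]
  have k3 : ip s x (∂b φ (∂b φ X) p) = ip s x (nproj s φ X p (∂b φ (∂b φ X) p)) := by
    rw [nproj_apply, npart]
    simp only [ip_add_right, ip_sub_right, ip_smul_right, h1, h2, h3, h4, mul_zero, sub_zero,
      add_zero]
  rw [h.dz_nproj hp hx, h.dzb_nproj hp hx]
  simp only [map_add, map_smul]
  -- The left side becomes 2⟨x, κ̄⟩κ and the right side 2⟨x, κ⟩κ̄; terms with X contribute nothing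
  -- because its first derivatives are tangent.
  rw [h.dc_nproj_tangent (-Complex.I) (h.sm.dc _) mA hp, h.dc_nproj_tangent _ h.sm mX hp,
    h.dc_nproj_tangent Complex.I (h.sm.dc _) mB hp, h.dc_nproj_tangent _ h.sm mX hp,
    h.nproj_of_mem hp (mA p hp), h.nproj_of_mem hp (mB p hp), k1, k2, k3, k1]
  simp

end Canon

end NormalProjection

end

section

local notation "∂z" => dc (-Complex.I)
local notation "∂b" => dc Complex.I

/-! ### Parallel sections over open sets. -/

section ParallelOn

variable {M : Type*} [TopologicalSpace M] [ChartedSpace ℂ M] [IsManifold 𝓘(ℝ, ℂ) ∞ M] {n r : ℕ}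
variable {φ φ' : OpenPartialHomeomorph M ℂ} {y : M → Quadric n r} {Y : M → Fin (n + 2) → ℝ}
variable {U V : Set M} {ψ χ : M → Fin (n + 2) → ℝ}

/-- `ψ` is a parallel section of the conformal normal bundle over `U`. -/
def IsParallelOn (r : ℕ) (y : M → Quadric n r) (U : Set M) (ψ : M → Fin (n + 2) → ℝ) : Prop :=
  ∀ φ Y, IsCanonicalLift r y φ Y → φ.source ⊆ U → Sm φ ψ ∧ ∀ p ∈ φ.source,
    toC (ψ p) ∈ perp (r + 1) (confTangent φ Y p) ∧ ∂z φ (toC ∘ ψ) p ∈ confTangent φ Y p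

lemma IsParallelOn.mono (h : IsParallelOn r y U ψ) (hV : V ⊆ U) : IsParallelOn r y V ψ :=
  fun φ Y hY hs => h φ Y hY (hs.trans hV)

lemma isParallelOn_of_local
    (h : ∀ p ∈ U, ∃ V, IsOpen V ∧ p ∈ V ∧ IsParallelOn r y V ψ) : IsParallelOn r y U ψ := by
  intro φ Y hY hs
  have key : ∀ p ∈ φ.source, ∃ V : Set M, IsOpen V ∧ p ∈ (φ.restr V).source ∧
      Sm (φ.restr V) ψ ∧ toC (ψ p) ∈ perp (r + 1) (confTangent φ Y p) ∧
      ∂z φ (toC ∘ ψ) p ∈ confTangent φ Y p := fun p hp => by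
    obtain ⟨V, hV, hpV, h1⟩ := h p (hs hp)
    have hp' : p ∈ (φ.restr V).source := by rw [φ.restr_source' V hV]; exact ⟨hp, hpV⟩
    obtain ⟨h2, h3⟩ := h1 _ _ (hY.restr hV) (by
      rw [φ.restr_source' V hV]; exact inter_subset_right)
    exact ⟨V, hV, hp', h2, h3 p hp'⟩
  refine ⟨fun w hw => ?_, fun p hp => ?_⟩
  · obtain ⟨V, hV, hp, h1, -⟩ := key _ (φ.map_target hw)
    have h2 := h1.contDiffAt hp
    have e : (φ.restr V) (φ.symm w) = w := φ.right_inv hw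
    rw [e] at h2
    exact h2.contDiffWithinAt
  · obtain ⟨V, hV, -, -, h1⟩ := key p hp
    exact h1

/-- The conformal normal space. -/
def normalSpace (r : ℕ) (y : M → Quadric n r) (p : M) : Submodule ℝ (Fin (n + 2) → ℝ) where
  carrier := {x | ∀ φ Y, IsCanonicalLift r y φ Y → p ∈ φ.source →
    toC x ∈ perp (r + 1) (confTangent φ Y p)}
  add_mem' := fun {a b} ha hb φ Y hY hp v hv => by
    rw [toC_add, ip_add_left, ha φ Y hY hp v hv, hb φ Y hY hp v hv, add_zero]
  zero_mem' := fun φ Y _ _ v _ => by rw [toC_zero, ip_zero_left]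
  smul_mem' := fun c x hx φ Y hY hp v hv => by
    rw [toC_smul, ip_smul_left, hx φ Y hY hp v hv, mul_zero]

lemma mem_normalSpace_iff (hY : IsCanonicalLift r y φ Y) {p : M} (hp : p ∈ φ.source)
    {x : Fin (n + 2) → ℝ} :
    x ∈ normalSpace r y p ↔ toC x ∈ perp (r + 1) (confTangent φ Y p) :=
  ⟨fun h => h φ Y hY hp, fun h φ' Y' hY' hp' => by rwa [confTangent_change hY hY' hp hp']⟩

lemma toC_comp_add : toC ∘ (ψ + χ) = fun p => (toC ∘ ψ) p + (toC ∘ χ) p :=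
  funext fun _ => toC_add _ _

lemma toC_comp_smul (a : ℝ) : toC ∘ (a • ψ) = fun p => (a : ℂ) • (toC ∘ ψ) p :=
  funext fun _ => toC_smul _ _

/-- The parallel sections over `U`. -/
def parallelSections (r : ℕ) (y : M → Quadric n r) (U : Set M) :
    Submodule ℝ (M → Fin (n + 2) → ℝ) where
  carrier := {ψ | IsParallelOn r y U ψ}
  add_mem' := fun {ψ χ} hψ hχ φ Y hY hs => by
    obtain ⟨h1, h2⟩ := hψ φ Y hY hs
    obtain ⟨k1, k2⟩ := hχ φ Y hY hs
    refine ⟨h1.add k1, fun p hp => ⟨fun v hv => ?_, ?_⟩⟩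
    · rw [Pi.add_apply, toC_add, ip_add_left, (h2 p hp).1 v hv, (k2 p hp).1 v hv, add_zero]
    · rw [toC_comp_add, dc_add _ h1.toC k1.toC hp]
      exact add_mem (h2 p hp).2 (k2 p hp).2
  zero_mem' := fun φ Y _ _ => by
    refine ⟨Sm.const 0, fun p _ => ⟨fun v _ => ?_, ?_⟩⟩
    · rw [Pi.zero_apply, toC_zero, ip_zero_left]
    · have : toC ∘ (0 : M → Fin (n + 2) → ℝ) = fun _ => 0 := funext fun _ => toC_zero
      rw [this, dc_const]
      exact zero_mem _
  smul_mem' := fun a ψ hψ φ Y hY hs => by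
    obtain ⟨h1, h2⟩ := hψ φ Y hY hs
    refine ⟨(Sm.const a).rsmul h1, fun p hp => ⟨fun v hv => ?_, ?_⟩⟩
    · rw [Pi.smul_apply, toC_smul, ip_smul_left, (h2 p hp).1 v hv, mul_zero]
    · rw [toC_comp_smul, dc_const_smul _ _ h1.toC hp]
      exact Submodule.smul_mem _ _ (h2 p hp).2

lemma mem_parallelSections : ψ ∈ parallelSections r y U ↔ IsParallelOn r y U ψ := Iff.rfl

lemma IsCanonicalLift.star_mem (hY : IsCanonicalLift r y φ Y) {p : M} (hp : p ∈ φ.source)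
    {x : Fin (n + 2) → ℂ} (hx : x ∈ confTangent φ Y p) : star x ∈ confTangent φ Y p := by
  rw [confTangent_eq, mem_span_four] at hx ⊢
  obtain ⟨a, b, c, d, rfl⟩ := hx
  refine ⟨star a, star c, star b, star d, ?_⟩
  simp only [star_add, star_smul, hY.canon.real p hp, hY.canon.star_dz hp,
    hY.canon.star_dzb hp, hY.canon.star_W hp]
  abel

/-- It is enough to check in one coordinate that a section is parallel. -/
lemma isParallelOn_of_chart (hY : IsCanonicalLift r y φ Y) (hψ : Sm φ ψ)
    (h : ∀ p ∈ φ.source, toC (ψ p) ∈ perp (r + 1) (confTangent φ Y p) ∧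
      ∂z φ (toC ∘ ψ) p ∈ confTangent φ Y p) : IsParallelOn r y φ.source ψ := by
  intro φ' Y' hY' hs
  refine ⟨Sm.of_source_subset hY.chart hY'.chart hs hψ, fun p hp => ?_⟩
  obtain ⟨h1, h2⟩ := h p (hs hp)
  rw [confTangent_change hY hY' (hs hp) hp]
  refine ⟨h1, ?_⟩
  rw [dc_change hY.chart hY'.chart hs _ hψ.toC hp]
  have h3 : ∂b φ (toC ∘ ψ) p ∈ confTangent φ Y p := by
    rw [← star_neg_I, ← star_dc_of_real hψ.toC (fun q _ => star_toC _) _ (hs hp)]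
    exact hY.star_mem (hs hp) h2
  exact add_mem (Submodule.smul_mem _ _ h2) (Submodule.smul_mem _ _ h3)

lemma isParallelOn_univ_iff (hy : IsIsothermicOn r y univ) :
    IsParallelOn r y univ ψ ↔ IsParallelSection r y ψ := by
  constructor
  · intro h
    have hs : ContMDiff 𝓘(ℝ, ℂ) 𝓘(ℝ, Fin (n + 2) → ℝ) ∞ ψ := fun p => by
      obtain ⟨φ, Y, hp, -, hY⟩ := hy p (mem_univ p)
      exact ((contMDiffOn_source_iff hY.1.chart).2 (h φ Y hY.1 (subset_univ _)).1).contMDiffAt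
        (φ.open_source.mem_nhds hp)
    have hnd : ∀ {φ : OpenPartialHomeomorph M ℂ} {Y p}, IsCanonicalLift r y φ Y → p ∈ φ.source →
        NondegOn (r + 1) (confTangent φ Y p) := fun hY hp => by
      rw [confTangent_eq]; exact (hY.canon.gram hp).nondeg
    refine ⟨hs, fun φ Y hY p hp => ((h φ Y hY (subset_univ _)).2 p hp).1, fun φ Y hY p hp => ?_⟩
    rw [normalDz, dz_eq_dc]
    exact normalPart_eq (hnd hY hp) (fun v _ => ip_zero_left _ v)
      (by rw [sub_zero]; exact ((h φ Y hY (subset_univ _)).2 p hp).2)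
  · intro h φ Y hY _
    refine ⟨h.sm hY, fun p hp => ⟨h.normal φ Y hY p hp, ?_⟩⟩
    have h1 := h.parallel φ Y hY p hp
    rw [normalDz, dz_eq_dc, confTangent_eq, (hY.canon.gram hp).normalPart_eq] at h1
    have h2 := sub_npart_mem (s := r + 1) (Y := (toC ∘ Y) p) (A := ∂z φ (toC ∘ Y) p)
      (B := ∂b φ (toC ∘ Y) p) (W := ∂b φ (∂z φ (toC ∘ Y)) p) (∂z φ (toC ∘ ψ) p)
    rwa [h1, sub_zero, ← confTangent_eq] at h2

/-- The inner product of parallel sections is locally constant. -/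
lemma IsParallelOn.eventually_ip (hy : IsIsothermicOn r y univ) (hU : IsOpen U)
    (hψ : IsParallelOn r y U ψ) (hχ : IsParallelOn r y U χ) {p : M} (hp : p ∈ U) :
    ∀ᶠ q in nhds p, ip (r + 1) (ψ q) (χ q) = ip (r + 1) (ψ p) (χ p) := by
  obtain ⟨φ, Y, hpφ, hs, hY⟩ := hy.exists_adapted hU hp
  obtain ⟨h1, h2⟩ := hψ φ Y hY.1 hs
  obtain ⟨k1, k2⟩ := hχ φ Y hY.1 hs
  have hz : ∀ q ∈ φ.source, ∂z φ (fun q => ip (r + 1) ((toC ∘ ψ) q) ((toC ∘ χ) q)) q = 0 :=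
    fun q hq => by
      rw [dc_ip _ _ h1.toC k1.toC hq, ip_comm, Function.comp_apply, Function.comp_apply,
        (h2 q hq).1 _ (k2 q hq).2, (k2 q hq).1 _ (h2 q hq).2, add_zero]
  have hsm := h1.toC.ip (r + 1) k1.toC
  have hreal : ∀ q ∈ φ.source, star (ip (r + 1) ((toC ∘ ψ) q) ((toC ∘ χ) q)) =
      ip (r + 1) ((toC ∘ ψ) q) ((toC ∘ χ) q) := fun q _ => by
    rw [star_ip, Function.comp_apply, Function.comp_apply, star_toC, star_toC]
  have := eventually_const_of_fderiv_eq_zero hsm (fun q hq => ContinuousLinearMap.ext fun v => by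
    rw [fderiv_eq_dc, hz q hq, ← star_neg_I, ← star_dc_of_real_fun hsm hreal _ hq, hz q hq]
    simp) hpφ
  filter_upwards [this] with q hq
  simp only [Function.comp_apply, ip_toC] at hq
  exact_mod_cast hq

end ParallelOn

/-! ### Local existence of parallel sections. -/

section LocalExistence

variable {M : Type*} [TopologicalSpace M] [ChartedSpace ℂ M] [IsManifold 𝓘(ℝ, ℂ) ∞ M] {n r : ℕ}
variable {φ : OpenPartialHomeomorph M ℂ} {y : M → Quadric n r} {Y : M → Fin (n + 2) → ℝ}

lemma toC_re (x : Fin (n + 2) → ℂ) : toC (fun i => (x i).re) = (1 / 2 : ℂ) • (x + star x) := by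
  funext i
  have : ((x i).re : ℂ) = (x i + star (x i)) / 2 := by
    rw [Complex.star_def, Complex.add_conj]; push_cast; ring
  simp only [toC, this, Pi.smul_apply, Pi.add_apply, Pi.star_apply, smul_eq_mul]
  ring

/-- The flat system is solved over ℂ. Since V ⊗ ℂ is closed under conjugation, the real part of a
solution is again parallel. -/
lemma isParallelOn_re (hY : IsCanonicalLift r y φ Y) {F : M → Fin (n + 2) → ℂ} (hF : Sm φ F)
    (h1 : ∀ p ∈ φ.source, F p ∈ perp (r + 1) (confTangent φ Y p))
    (h2 : ∀ p ∈ φ.source, ∂z φ F p ∈ confTangent φ Y p)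
    (h3 : ∀ p ∈ φ.source, ∂b φ F p ∈ confTangent φ Y p) :
    IsParallelOn r y φ.source fun p i => (F p i).re := by
  have e : toC ∘ (fun p i => (F p i).re) = fun p => (1 / 2 : ℂ) • (F p + star (F p)) :=
    funext fun p => toC_re (F p)
  refine isParallelOn_of_chart hY (Sm.pi fun i => (hF.apply i).re) fun p hp => ⟨?_, ?_⟩
  · have : toC (fun i => (F p i).re) ∈ perp (r + 1) (confTangent φ Y p) := fun v hv => by
      have k : ip (r + 1) (star (F p)) v = 0 := by
        rw [← star_star v, ← star_ip, h1 p hp _ (hY.star_mem hp hv), star_zero]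
      rw [toC_re, ip_smul_left, ip_add_left, h1 p hp v hv, k, add_zero, mul_zero]
    exact this
  · rw [e, dc_const_smul _ _ (hF.add hF.starVec) hp, dc_add _ hF hF.starVec hp,
      dc_starVec _ hF hp, star_neg_I]
    exact Submodule.smul_mem _ _ (add_mem (h2 p hp) (hY.star_mem hp (h3 p hp)))

/-- Every normal vector extends to a parallel section near its base point. -/
theorem exists_isParallelOn (hy : IsIsothermicOn r y univ) (p₀ : M) :
    ∃ U, IsOpen U ∧ p₀ ∈ U ∧ ∀ x ∈ normalSpace r y p₀, ∃ ψ, IsParallelOn r y U ψ ∧ ψ p₀ = x := by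
  obtain ⟨φ, Y, hp₀, -, hY⟩ := hy p₀ (mem_univ p₀)
  have hX := hY.1.canon
  have hκ := (isAdapted_iff.1 hY).2
  set X := toC ∘ Y with hXdef
  let e := Complex.equivRealProdCLM
  -- The coordinate is translated so that p₀ sits at the origin of ℝ².
  let ι : ℝ × ℝ → ℂ := fun w => φ p₀ + e.symm w
  have hι : ContDiff ℝ ∞ ι := contDiff_const.add e.symm.contDiff
  have dι : ∀ w, HasFDerivAt ι (e.symm : ℝ × ℝ →L[ℝ] ℂ) w := fun w =>
    e.symm.hasFDerivAt.const_add _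
  let R : ((Fin (n + 2) → ℂ) →L[ℂ] Fin (n + 2) → ℂ) →L[ℝ]
      ((Fin (n + 2) → ℂ) →L[ℝ] Fin (n + 2) → ℂ) :=
    ContinuousLinearMap.restrictScalarsL ℂ (Fin (n + 2) → ℂ) (Fin (n + 2) → ℂ) ℝ ℝ
  set N := nproj (r + 1) φ X with hN
  let P : ℝ × ℝ → (Fin (n + 2) → ℂ) →L[ℝ] Fin (n + 2) → ℂ := fun w => R (N (φ.symm (ι w)))
  let Ω : Set (ℝ × ℝ) := ι ⁻¹' φ.target
  have hΩ : IsOpen Ω := φ.open_target.preimage hι.continuous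
  have ι0 : ι (0, 0) = φ p₀ := by simp [ι]
  have h0 : (0, 0) ∈ Ω := by
    change ι (0, 0) ∈ φ.target
    rw [ι0]; exact φ.map_source hp₀
  have sN : Sm φ N := hX.sm_nproj
  have hP : ContDiffOn ℝ ∞ P Ω :=
    R.contDiff.comp_contDiffOn 
      (ContDiffOn.comp (g := N ∘ φ.symm) (f := ι) (t := φ.target) sN hι.contDiffOn fun w hw => hw)
  have mem : ∀ {w}, w ∈ Ω → φ.symm (ι w) ∈ φ.source := fun hw => φ.map_target hw
  have hfix : ∀ {w} (_ : w ∈ Ω) {x}, P w x = x ↔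
      x ∈ perp (r + 1) (confTangent φ Y (φ.symm (ι w))) := fun {w} hw {x} => by
    rw [confTangent_eq]
    constructor
    · intro h
      rw [← h]
      exact (hX.gram (mem hw)).npart_mem_perp x
    · intro h
      exact npart_of_mem_perp h
  have hidem : ∀ w ∈ Ω, ∀ x, P w (P w x) = P w x := fun w hw x => by
    rw [hfix hw, confTangent_eq]
    exact (hX.gram (mem hw)).npart_mem_perp x
  have dP : ∀ {w} (_ : w ∈ Ω) v x, fderiv ℝ P w v x =
      e.symm v • ∂z φ N (φ.symm (ι w)) x + star (e.symm v) • ∂b φ N (φ.symm (ι w)) x :=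
    fun {w} hw v x => by
      have h1 := sN.hasFDerivAt (mem hw)
      rw [φ.right_inv hw] at h1
      have h2 := (R.hasFDerivAt.comp w (h1.comp w (dι w))).fderiv
      have h3 : fderiv ℝ P w = fderiv ℝ (R ∘ (N ∘ φ.symm) ∘ ι) w := rfl
      rw [h3, h2]
      have h4 := congrArg (fun L : (Fin (n + 2) → ℂ) →L[ℂ] Fin (n + 2) → ℂ => L x)
        (fderiv_eq_dc (φ := φ) (F := N) (φ.symm (ι w)) (e.symm v))
      rw [φ.right_inv hw] at h4
      exact h4
  have comm : ∀ {w} (_ : w ∈ Ω) {x}, P w x = x →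
      ∂z φ N (φ.symm (ι w)) (∂b φ N (φ.symm (ι w)) x) =
        ∂b φ N (φ.symm (ι w)) (∂z φ N (φ.symm (ι w)) x) := fun {w} hw {x} hx => by
    refine hX.dc_nproj_comm (mem hw) ?_ (by rw [← confTangent_eq]; exact (hfix hw).1 hx)
    rw [nproj_apply, hX.npart_dzz (mem hw), ← hopf_eq hX (mem hw)]
    exact hκ _ (mem hw)
  -- The two real partial derivatives are combinations of ∂z and ∂z̄, so their commutation on normal
  -- vectors reduces to the Ricci equation.
  have hflat : ∀ w ∈ Ω, ∀ x, P w x = x → fderiv ℝ P w (1, 0) (fderiv ℝ P w (0, 1) x) =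
      fderiv ℝ P w (0, 1) (fderiv ℝ P w (1, 0) x) := fun w hw x hx => by
    simp only [dP hw, map_add, map_smul, comm hw hx]
    module
  obtain ⟨U₀, hU₀, h0U, hUΩ, key⟩ := exists_parallel_of_flat hΩ h0 hP hidem hflat
  let j : M → ℝ × ℝ := fun q => e (φ q - φ p₀)
  have ιj : ∀ q, ι (j q) = φ q := fun q => by simp [ι, j]
  have jι : ∀ w, e (ι w - φ p₀) = w := fun w => by simp [ι]
  have hj : ContinuousOn j φ.source :=
    e.continuous.comp_continuousOn (φ.continuousOn.sub continuousOn_const)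
  have hUo : IsOpen (φ.source ∩ j ⁻¹' U₀) := hj.isOpen_inter_preimage φ.open_source hU₀
  have hj0 : j p₀ = (0, 0) := by simp [j]; rfl
  set φ₁ := φ.restr (φ.source ∩ j ⁻¹' U₀) with hφ₁
  have hsrc : φ₁.source = φ.source ∩ j ⁻¹' U₀ := by
    rw [hφ₁, φ.restr_source' _ hUo, ← inter_assoc, inter_self]
  refine ⟨φ₁.source, φ₁.open_source, ?_, fun x hx => ?_⟩
  · rw [hsrc]
    exact ⟨hp₀, by rw [mem_preimage, hj0]; exact h0U⟩
  obtain ⟨ψ, hψ0, hψs, hψm, hψd⟩ := key (toC x) ((hfix h0).2 (by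
    rw [ι0, φ.left_inv hp₀]
    exact (mem_normalSpace_iff hY.1 hp₀).1 hx))
  have hY₁ : IsCanonicalLift r y φ₁ Y := hY.1.restr hUo
  have sF : Sm φ₁ fun q => ψ (j q) := by
    have h1 : ContDiffOn ℝ ∞ (fun z => ψ (e (z - φ p₀))) φ₁.target := by
      refine hψs.comp ((e.contDiff.comp (contDiff_id.sub contDiff_const)).contDiffOn)
        fun z hz => ?_
      have h2 := φ₁.map_target hz
      rw [hsrc] at h2
      have h3 : j (φ₁.symm z) = e (z - φ p₀) := by
        change e (φ₁ (φ₁.symm z) - _) = _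
        rw [φ₁.right_inv hz]
      rw [← h3]
      exact h2.2
    refine h1.congr fun z hz => ?_
    change ψ (e (φ₁ (φ₁.symm z) - _)) = _
    rw [φ₁.right_inv hz]
  have hder : ∀ q ∈ φ₁.source, ∀ v : ℂ, fderiv ℝ ((fun q => ψ (j q)) ∘ φ₁.symm) (φ₁ q) v =
      v • ∂z φ N q (ψ (j q)) + star v • ∂b φ N q (ψ (j q)) := fun q hq v => by
    have hq' := hq
    rw [hsrc] at hq'
    have h1 : (fun q => ψ (j q)) ∘ φ₁.symm =ᶠ[nhds (φ₁ q)] fun z => ψ (e (z - φ p₀)) := by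
      filter_upwards [φ₁.open_target.mem_nhds (φ₁.map_source hq)] with z hz
      change ψ (e (φ₁ (φ₁.symm z) - _)) = _
      rw [φ₁.right_inv hz]
    have h2 : DifferentiableAt ℝ ψ (e (φ₁ q - φ p₀)) :=
      (hψs.contDiffAt (hU₀.mem_nhds hq'.2)).differentiableAt (by simp)
    have h3 : HasFDerivAt (fun z : ℂ => e (z - φ p₀)) (e : ℂ →L[ℝ] ℝ × ℝ) (φ₁ q) :=
      e.hasFDerivAt.comp (φ₁ q) ((hasFDerivAt_id _).sub_const _)
    have h5 := HasFDerivAt.comp (g := ψ) (f := fun z : ℂ => e (z - φ p₀)) (φ₁ q) h2.hasFDerivAt h3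
    have h6 : (fun z => ψ (e (z - φ p₀))) = ψ ∘ fun z : ℂ => e (z - φ p₀) := rfl
    rw [h1.fderiv_eq, h6, h5.fderiv]
    have h4 := hψd (j q) hq'.2 (e v)
    rw [dP (hUΩ hq'.2), ιj, φ.left_inv hq'.1, e.symm_apply_apply] at h4
    exact h4
  have hmem : ∀ q ∈ φ₁.source, ψ (j q) ∈ perp (r + 1) (confTangent φ Y q) := fun q hq => by
    rw [hsrc] at hq
    have := (hfix (hUΩ hq.2)).1 (hψm _ hq.2)
    rwa [ιj, φ.left_inv hq.1] at this
  have hdz : ∀ q ∈ φ₁.source, ∂z φ₁ (fun q => ψ (j q)) q = ∂z φ N q (ψ (j q)) := fun q hq => by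
    rw [dc, hder q hq, hder q hq]
    simp only [star_one, star_I]
    match_scalars
    · linear_combination (-1 / 2 : ℂ) * Complex.I_sq
    · linear_combination (1 / 2 : ℂ) * Complex.I_sq
  have hdb : ∀ q ∈ φ₁.source, ∂b φ₁ (fun q => ψ (j q)) q = ∂b φ N q (ψ (j q)) := fun q hq => by
    rw [dc, hder q hq, hder q hq]
    simp only [star_one, star_I]
    match_scalars
    · linear_combination (1 / 2 : ℂ) * Complex.I_sq
    · linear_combination (-1 / 2 : ℂ) * Complex.I_sq
  have hs : φ₁.source ⊆ φ.source := by rw [hsrc]; exact inter_subset_left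
  refine ⟨fun q i => (ψ (j q) i).re, isParallelOn_re hY₁ sF hmem (fun q hq => ?_)
    (fun q hq => ?_), ?_⟩
  · have h1 := hmem q hq
    rw [confTangent_eq] at h1
    have h2 : confTangent φ₁ Y q = confTangent φ Y q := rfl
    rw [hdz q hq, hX.dz_nproj (hs hq) h1, h2, confTangent_eq, ← hXdef]
    exact add_mem (Submodule.smul_mem _ _ (Submodule.subset_span (by simp)))
      (Submodule.smul_mem _ _ (Submodule.subset_span (by simp)))
  · have h1 := hmem q hq
    rw [confTangent_eq] at h1
    have h2 : confTangent φ₁ Y q = confTangent φ Y q := rfl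
    rw [hdb q hq, hX.dzb_nproj (hs hq) h1, h2, confTangent_eq, ← hXdef]
    exact add_mem (Submodule.smul_mem _ _ (Submodule.subset_span (by simp)))
      (Submodule.smul_mem _ _ (Submodule.subset_span (by simp)))
  · funext i
    simp only [hj0, hψ0]
    exact Complex.ofReal_re _

end LocalExistence

end

/-! ### Witt extension by reflections. -/

section Witt

variable {m s : ℕ}

lemma ip_sum_left {ι : Type*} (t : Finset ι) (f : ι → Fin m → ℝ) (x : Fin m → ℝ) :
    ip s (∑ i ∈ t, f i) x = ∑ i ∈ t, ip s (f i) x := by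
  simp only [ip, Finset.sum_apply, Finset.mul_sum, Finset.sum_mul]
  exact Finset.sum_comm

lemma ip_sum_right {ι : Type*} (t : Finset ι) (f : ι → Fin m → ℝ) (x : Fin m → ℝ) :
    ip s x (∑ i ∈ t, f i) = ∑ i ∈ t, ip s x (f i) := by
  simp only [ip_comm s x, ip_sum_left]

lemma ip_single_right (x : Fin m → ℝ) (j : Fin m) :
    ip s x (Pi.single j 1) = (if (j : ℕ) + s < m then 1 else -1) * x j := by
  rw [ip, Finset.sum_eq_single j]
  · simp
  · intro b _ hb; simp [hb]
  · simp

/-- The reflection in the hyperplane orthogonal to `u`. -/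
def reflection (s : ℕ) (u : Fin m → ℝ) (hu : ip s u u ≠ 0) : (Fin m → ℝ) ≃ₗ[ℝ] Fin m → ℝ :=
  LinearEquiv.ofInvolutive
    { toFun := fun x => x - (2 * ip s x u / ip s u u) • u
      map_add' := fun x y => by
        simp only [ip_add_left, mul_add, add_div]; module
      map_smul' := fun a x => by
        simp only [ip_smul_left, RingHom.id_apply, mul_left_comm 2 a, mul_div_assoc]; module }
    fun x => by
      simp only [LinearMap.coe_mk, AddHom.coe_mk, ip_sub_left, ip_smul_left]
      match_scalars
      · ring
      · field_simp; ring

lemma reflection_apply {u : Fin m → ℝ} (hu : ip s u u ≠ 0) (x : Fin m → ℝ) :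
    reflection s u hu x = x - (2 * ip s x u / ip s u u) • u := rfl

lemma ip_reflection {u : Fin m → ℝ} (hu : ip s u u ≠ 0) (x y : Fin m → ℝ) :
    ip s (reflection s u hu x) (reflection s u hu y) = ip s x y := by
  simp only [reflection_apply, ip_sub_left, ip_sub_right, ip_smul_left, ip_smul_right,
    ip_comm s u y]
  field_simp
  ring

lemma reflection_of_perp {u x : Fin m → ℝ} (hu : ip s u u ≠ 0) (h : ip s x u = 0) :
    reflection s u hu x = x := by
  rw [reflection_apply, h]; simp

/-- Vectors of the same nonzero square length are related by an isometry that fixes their common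
orthogonal complement. -/
lemma exists_isometry_map_eq {v e : Fin m → ℝ} (h : ip s v v = ip s e e) (h0 : ip s e e ≠ 0) :
    ∃ T : (Fin m → ℝ) ≃ₗ[ℝ] Fin m → ℝ, (∀ x y, ip s (T x) (T y) = ip s x y) ∧ T v = e ∧
      ∀ x, ip s x v = 0 → ip s x e = 0 → T x = x := by
  by_cases h1 : ip s (v - e) (v - e) = 0
  -- The parallelogram law gives ⟨v+e, v+e⟩ + ⟨v-e, v-e⟩ = 4⟨e, e⟩ ≠ 0, so v + e is not null when v
  -- - e is. Its reflection sends v to -e, and the reflection in e corrects the sign.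
  · have h2 : ip s (v + e) (v + e) ≠ 0 := by
      have h3 : ip s (v + e) (v + e) = 4 * ip s e e - ip s (v - e) (v - e) := by
        simp only [ip_add_left, ip_add_right, ip_sub_left, ip_sub_right, h]; ring
      rw [h3, h1]
      simpa using h0
    refine ⟨(reflection s (v + e) h2).trans (reflection s e h0), fun x y => ?_, ?_,
      fun x hv he => ?_⟩
    · rw [LinearEquiv.trans_apply, LinearEquiv.trans_apply, ip_reflection, ip_reflection]
    · have h3 : reflection s (v + e) h2 v = -e := by
        have h4 : 2 * ip s v (v + e) / ip s (v + e) (v + e) = 1 := by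
          rw [div_eq_one_iff_eq h2]
          simp only [ip_add_left, ip_add_right, h, ip_comm s e v]; ring
        rw [reflection_apply, h4]; module
      rw [LinearEquiv.trans_apply, h3, map_neg, reflection_apply, mul_div_assoc, div_self h0]
      module
    · rw [LinearEquiv.trans_apply, reflection_of_perp h2 (by rw [ip_add_right, hv, he, add_zero]),
        reflection_of_perp h0 he]
  · refine ⟨reflection s (v - e) h1, ip_reflection h1, ?_, fun x hv he =>
      reflection_of_perp h1 (by rw [ip_sub_right, hv, he, sub_zero])⟩
    have h4 : 2 * ip s v (v - e) / ip s (v - e) (v - e) = 1 := by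
      rw [div_eq_one_iff_eq h1]
      simp only [ip_sub_left, ip_sub_right, h, ip_comm s e v]; ring
    rw [reflection_apply, h4]; module

/-- Orthogonal systems with the same nonzero square lengths are related by an isometry. -/
lemma exists_isometry_map_system : ∀ {k : ℕ} (v e : Fin k → Fin m → ℝ),
    (∀ i j, ip s (v i) (v j) = ip s (e i) (e j)) → (∀ i j, i ≠ j → ip s (e i) (e j) = 0) →
    (∀ i, ip s (e i) (e i) ≠ 0) →
    ∃ T : (Fin m → ℝ) ≃ₗ[ℝ] Fin m → ℝ, (∀ x y, ip s (T x) (T y) = ip s x y) ∧ ∀ i, T (v i) = e i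
  | 0, _, _, _, _, _ => ⟨LinearEquiv.refl ℝ _, fun _ _ => rfl, fun i => i.elim0⟩
  | k + 1, v, e, h1, h2, h3 => by
    obtain ⟨T, hT, hTv⟩ := exists_isometry_map_system (fun i => v (Fin.castSucc i))
      (fun i => e (Fin.castSucc i)) (fun i j => h1 _ _)
      (fun i j hij => h2 _ _ fun h => hij (Fin.castSucc_injective k h)) fun i => h3 _
    obtain ⟨T', hT', hTv', hfix⟩ := exists_isometry_map_eq (v := T (v (Fin.last k)))
      (by rw [hT, h1]) (h3 (Fin.last k))
    refine ⟨T.trans T', fun x y => ?_, fun i => ?_⟩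
    · rw [LinearEquiv.trans_apply, LinearEquiv.trans_apply, hT', hT]
    · rw [LinearEquiv.trans_apply]
      refine Fin.lastCases hTv' (fun i => ?_) i
      have h4 : ip s (e (Fin.castSucc i)) (e (Fin.last k)) = 0 :=
        h2 _ _ (Fin.castSucc_lt_last i).ne
      -- The vectors already in place are orthogonal to both the last e and the image of the last v,
      -- so the new isometry fixes them.
      rw [hTv, hfix _ (by rw [← hTv, hT, h1, h4]) h4]

/-- The inclusion of `ℝ ^ k` into `ℝ ^ (k + 4)`, omitting three coordinates at the beginning and
one at the end. -/
def shiftCoord (k : ℕ) : (Fin k → ℝ) →ₗ[ℝ] Fin (k + 2 + 2) → ℝ where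
  toFun a j := if h : 3 ≤ (j : ℕ) ∧ (j : ℕ) < k + 3 then a ⟨j - 3, by omega⟩ else 0
  map_add' a b := by
    funext j
    simp only [Pi.add_apply]
    split_ifs <;> simp
  map_smul' c a := by
    funext j
    simp only [Pi.smul_apply, RingHom.id_apply]
    split_ifs <;> simp

lemma shiftCoord_of_not {k : ℕ} (a : Fin k → ℝ) {j : Fin (k + 2 + 2)}
    (h : ¬ (3 ≤ (j : ℕ) ∧ (j : ℕ) < k + 3)) : shiftCoord k a j = 0 := dif_neg h

/-- Negative coordinates are counted from the end, and exactly one coordinate at the end is omitted;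
hence the index falls from r + 1 to r. -/
lemma ip_shiftCoord {k r : ℕ} (a b : Fin k → ℝ) :
    ip (r + 1) (shiftCoord k a) (shiftCoord k b) = ip r a b := by
  rw [ip, Fin.sum_univ_succ, Fin.sum_univ_succ, Fin.sum_univ_succ, Fin.sum_univ_castSucc]
  have e : ∀ (c : Fin k → ℝ) (i : Fin k), shiftCoord k c i.castSucc.succ.succ.succ = c i :=
    fun c i => by simp [shiftCoord]
  have e0 : shiftCoord k a 0 = 0 := shiftCoord_of_not a (by simp)
  have e1 : shiftCoord k a (Fin.succ 0) = 0 := shiftCoord_of_not a (by simp)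
  have e2 : shiftCoord k a (Fin.succ 0).succ = 0 :=
    shiftCoord_of_not a (by rw [Fin.val_succ, Fin.val_succ, Fin.val_zero]; omega)
  have e3 : shiftCoord k a (Fin.last k).succ.succ.succ = 0 := shiftCoord_of_not a (by simp)
  rw [e0, e1, e2, e3]
  simp only [e, mul_zero, zero_mul, zero_add, add_zero]
  refine Finset.sum_congr rfl fun i _ => ?_
  have : ((i.castSucc.succ.succ.succ : Fin (k + 2 + 2)) : ℕ) + (r + 1) < k + 2 + 2 ↔
      (i : ℕ) + r < k := by
    simp only [Fin.val_succ, Fin.val_castSucc]; omega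
  simp only [this]

lemma exists_shiftCoord_eq {k : ℕ} {x : Fin (k + 2 + 2) → ℝ}
    (hx : ∀ j : Fin (k + 2 + 2), ¬ (3 ≤ (j : ℕ) ∧ (j : ℕ) < k + 3) → x j = 0) :
    ∃ a, shiftCoord k a = x := by
  refine ⟨fun i => x ⟨i + 3, by omega⟩, funext fun j => ?_⟩
  by_cases h : 3 ≤ (j : ℕ) ∧ (j : ℕ) < k + 3
  · simp only [shiftCoord, LinearMap.coe_mk, AddHom.coe_mk, dif_pos h]
    congr 1
    ext
    simp only
    omega
  · rw [hx j h]
    simp [shiftCoord, h]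

/-- The orthogonal complement of an orthonormal system of signature `(3, 1)`. -/
lemma exists_isometry_perp {n k r : ℕ} (hn : n = k + 2) (hr : r ≤ k)
    (v : Fin 4 → Fin (n + 2) → ℝ) (h : ∀ i j, ip (r + 1) (v i) (v j) =
      if i = j then (if i = 3 then -1 else 1) else 0) :
    ∃ L : (Fin k → ℝ) →ₗ[ℝ] Fin (n + 2) → ℝ, (∀ a b, ip (r + 1) (L a) (L b) = ip r a b) ∧
      ∀ x, (∀ i, ip (r + 1) x (v i) = 0) ↔ ∃ a, L a = x := by
  subst hn
  -- Model vectors of signature (3, 1): the first three coordinates are positive because r ≤ k, and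
  -- the last is negative.
  let idx : Fin 4 → Fin (k + 2 + 2) := ![⟨0, by omega⟩, ⟨1, by omega⟩, ⟨2, by omega⟩,
    ⟨k + 3, by omega⟩]
  let e : Fin 4 → Fin (k + 2 + 2) → ℝ := fun i => Pi.single (idx i) 1
  have hidx : ∀ i, ¬ (3 ≤ (idx i : ℕ) ∧ (idx i : ℕ) < k + 3) := by
    intro i; fin_cases i <;> simp [idx]
  have hidx' : ∀ j : Fin (k + 2 + 2), ¬ (3 ≤ (j : ℕ) ∧ (j : ℕ) < k + 3) → ∃ i, idx i = j := by
    intro j hj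
    have hj' := j.2
    have : (j : ℕ) = 0 ∨ (j : ℕ) = 1 ∨ (j : ℕ) = 2 ∨ (j : ℕ) = k + 3 := by omega
    rcases this with h | h | h | h
    exacts [⟨0, Fin.ext h.symm⟩, ⟨1, Fin.ext h.symm⟩, ⟨2, Fin.ext h.symm⟩, ⟨3, Fin.ext h.symm⟩]
  have hsign : ∀ i, (if (idx i : ℕ) + (r + 1) < k + 2 + 2 then (1 : ℝ) else -1) =
      if i = 3 then -1 else 1 := by
    intro i
    fin_cases i
    · rw [if_pos (by simp [idx]; omega)]; rfl
    · rw [if_pos (by simp [idx]; omega)]; rfl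
    · rw [if_pos (by simp [idx]; omega)]; rfl
    · rw [if_neg (by simp [idx]; omega)]; rfl
  have hinj : Function.Injective idx := by
    intro i j hij
    have := congrArg Fin.val hij
    fin_cases i <;> fin_cases j <;> simp [idx] at this ⊢
  have he : ∀ i x, ip (r + 1) x (e i) = (if i = 3 then -1 else 1) * x (idx i) := fun i x => by
    rw [ip_single_right, hsign]
  have hee : ∀ i j, ip (r + 1) (e i) (e j) = if i = j then (if i = 3 then -1 else 1) else 0 := by
    intro i j
    rw [he]
    by_cases hij : i = j
    · subst hij; simp [e]
    · have : e i (idx j) = 0 := Pi.single_eq_of_ne (fun h => hij (hinj h).symm) _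
      rw [if_neg hij, this, mul_zero]
  obtain ⟨T, hT, hTv⟩ := exists_isometry_map_system v e (fun i j => by rw [h, hee])
    (fun i j hij => by rw [hee, if_neg hij]) (fun i => by rw [hee, if_pos rfl]; split_ifs <;> simp)
  refine ⟨T.symm.toLinearMap ∘ₗ shiftCoord k, fun a b => ?_, fun x => ?_⟩
  · rw [← ip_shiftCoord a b, ← hT]
    simp
  · have hx : ∀ i, ip (r + 1) x (v i) = 0 ↔ T x (idx i) = 0 := fun i => by
      rw [← hT, hTv, he, mul_eq_zero]
      refine or_iff_right ?_
      split_ifs <;> simp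
    simp only [hx]
    constructor
    · intro h0
      obtain ⟨a, ha⟩ := exists_shiftCoord_eq (x := T x) fun j hj => by
        obtain ⟨i, rfl⟩ := hidx' j hj
        exact h0 i
      exact ⟨a, by simp [ha]⟩
    · rintro ⟨a, rfl⟩ i
      rw [LinearMap.comp_apply, LinearEquiv.coe_coe, LinearEquiv.apply_symm_apply,
        shiftCoord_of_not a (hidx i)]

end Witt

section

local notation "∂z" => dc (-Complex.I)
local notation "∂b" => dc Complex.I

/-! ### Isometric frames of parallel sections and uniqueness. -/

section Frames

variable {M : Type*} [TopologicalSpace M] [ChartedSpace ℂ M] [IsManifold 𝓘(ℝ, ℂ) ∞ M] {n r : ℕ}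
variable {φ : OpenPartialHomeomorph M ℂ} {y : M → Quadric n r} {Y : M → Fin (n + 2) → ℝ}
variable {U V : Set M} {ψ χ : M → Fin (n + 2) → ℝ}

/-- The conformal tangent space has an orthonormal basis of signature `(3, 1)`. -/
lemma Canon.exists_orthonormal {m s : ℕ} {φ : OpenPartialHomeomorph M ℂ} {X : M → Fin m → ℂ}
    (h : Canon s φ X) {p : M} (hp : p ∈ φ.source) :
    ∃ v : Fin 4 → Fin m → ℝ,
      (∀ i j, ip s (v i) (v j) = if i = j then (if i = 3 then -1 else 1) else 0) ∧
      ∀ x : Fin m → ℝ, (∀ i, ip s x (v i) = 0) ↔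
        toC x ∈ perp s (Submodule.span ℂ {X p, ∂z φ X p, ∂b φ X p, ∂b φ (∂z φ X) p}) := by
  have G := h.gram hp
  have sA := h.star_dz hp
  have sB := h.star_dzb hp
  have sW := h.star_W hp
  have sX := h.real p hp
  generalize X p = X₀ at *
  generalize ∂z φ X p = A at *
  generalize ∂b φ X p = B at *
  generalize ∂b φ (∂z φ X) p = W at *
  obtain ⟨w, hw⟩ : ∃ w, ip s W W = w := ⟨_, rfl⟩
  have sw : star w = w := by rw [← hw, star_ip, sW]
  -- The vector N = W + wX is null with ⟨X, N⟩ = -1/2, and u consists of 2 Re X_z, -2 Im X_z, X - N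
  -- and X + N.
  let u : Fin 4 → Fin m → ℂ := ![A + B, Complex.I • A - Complex.I • B, X₀ - W - w • X₀,
    X₀ + W + w • X₀]
  have su : ∀ i, star (u i) = u i := by
    intro i
    fin_cases i <;>
      simp only [u, Fin.zero_eta, Fin.mk_one, Fin.reduceFinMk, Matrix.cons_val_zero,
        Matrix.cons_val_one, Matrix.cons_val, star_add, star_sub, star_smul, sA, sB, sW, sX, sw,
        star_I] <;> module
  have hu : ∀ i, toC (fun j => (u i j).re) = u i := fun i => (eq_toC_of_star (su i)).symm
  have gram : ∀ i j, ip s (u i) (u j) = if i = j then (if i = 3 then -1 else 1) else 0 := by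
    intro i j
    fin_cases i <;> fin_cases j <;>
      simp [u, ip_add_left, ip_add_right, ip_sub_left, ip_sub_right, ip_smul_left, ip_smul_right,
        G.YY, G.YA, G.YB, G.YW, G.AA, G.BB, G.AB, G.AW, G.BW, ip_comm s A X₀, ip_comm s B X₀,
        ip_comm s W X₀, ip_comm s B A, ip_comm s W A, ip_comm s W B, hw] <;>
      ring_nf <;> simp
  refine ⟨fun i j => (u i j).re, fun i j => ?_, fun x => ?_⟩
  · have := gram i j
    rw [← hu i, ← hu j, ip_toC] at this
    apply Complex.ofReal_injective
    rw [this]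
    split_ifs <;> simp
  · have e : ∀ i, ip s x (fun j => (u i j).re) = 0 ↔ ip s (toC x) (u i) = 0 := fun i => by
      rw [← hu i, ip_toC, hu i]; norm_cast
    simp only [e, mem_perp_four]
    constructor
    · intro h0
      have h1 := h0 0
      have h2 := h0 1
      have h3 := h0 2
      have h4 := h0 3
      simp only [u, Matrix.cons_val_zero, Matrix.cons_val_one, Matrix.cons_val, ip_add_right,
        ip_sub_right, ip_smul_right] at h1 h2 h3 h4
      have h5 : ip s (toC x) X₀ = 0 := by linear_combination (1 / 2 : ℂ) * (h3 + h4)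
      rw [h5] at h3
      refine ⟨h5, ?_, ?_, by linear_combination -h3⟩
      · linear_combination (1 / 2 : ℂ) * h1 - (Complex.I / 2) * h2 +
          (1 / 2) * (ip s (toC x) A - ip s (toC x) B) * Complex.I_sq
      · linear_combination (1 / 2 : ℂ) * h1 + (Complex.I / 2) * h2 -
          (1 / 2) * (ip s (toC x) A - ip s (toC x) B) * Complex.I_sq
    · rintro ⟨h1, h2, h3, h4⟩ i
      fin_cases i <;> simp [u, ip_add_right, ip_sub_right, ip_smul_right, h1, h2, h3, h4]

/-- The conformal normal space is isometric to `ℝ ^ (n - 2)` with the form of index `r`. -/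
lemma exists_isometry_normalSpace (hnr : r + 2 ≤ n) (hy : IsIsothermicOn r y univ) (p : M) :
    ∃ L : (Fin (n - 2) → ℝ) →ₗ[ℝ] Fin (n + 2) → ℝ,
      (∀ a b, ip (r + 1) (L a) (L b) = ip r a b) ∧ ∀ x, x ∈ normalSpace r y p ↔ ∃ a, L a = x := by
  obtain ⟨φ, Y, hp, -, hY⟩ := hy p (mem_univ p)
  obtain ⟨v, hv, hx⟩ := hY.1.canon.exists_orthonormal hp
  obtain ⟨L, hL, hL'⟩ := exists_isometry_perp (n := n) (k := n - 2) (r := r) (by omega) (by omega)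
    v hv
  exact ⟨L, hL, fun x => by rw [mem_normalSpace_iff hY.1 hp, confTangent_eq, ← hx, hL']⟩

lemma injective_of_isometry {k m s s' : ℕ} {L : (Fin k → ℝ) →ₗ[ℝ] Fin m → ℝ}
    (h : ∀ a b, ip s (L a) (L b) = ip s' a b) : Function.Injective L := by
  rw [injective_iff_map_eq_zero]
  intro a ha
  exact ip_nondegenerate s' a fun b => by rw [← h, ha, ip_zero_left]

lemma IsParallelOn.mem_normalSpace (hy : IsIsothermicOn r y univ) (hU : IsOpen U)
    (hψ : IsParallelOn r y U ψ) {p : M} (hp : p ∈ U) : ψ p ∈ normalSpace r y p := by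
  obtain ⟨φ, Y, hpφ, hs, hY⟩ := hy.exists_adapted hU hp
  exact (mem_normalSpace_iff hY.1 hpφ).2 ((hψ φ Y hY.1 hs).2 p hpφ).1

/-- `Φ` is an isometric frame of parallel sections over `U`. -/
structure IsParallelFrame (r : ℕ) (y : M → Quadric n r) (U : Set M)
    (Φ : (Fin (n - 2) → ℝ) →ₗ[ℝ] M → Fin (n + 2) → ℝ) : Prop where
  isOpen : IsOpen U
  parallel : ∀ a, IsParallelOn r y U (Φ a)
  ip_eq : ∀ p ∈ U, ∀ a b, ip (r + 1) (Φ a p) (Φ b p) = ip r a b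

/-- Extend a basis of one normal space by parallel sections. The finitely many inner products are
locally constant, so a common neighbourhood keeps the frame isometric. -/
lemma exists_parallelFrame (hnr : r + 2 ≤ n) (hy : IsIsothermicOn r y univ) (p : M) :
    ∃ U Φ, p ∈ U ∧ IsParallelFrame r y U Φ := by
  obtain ⟨L, hL, hL'⟩ := exists_isometry_normalSpace hnr hy p
  obtain ⟨U, hU, hp, hex⟩ := exists_isParallelOn hy p
  choose ψ hψ hψp using fun i : Fin (n - 2) => hex (L (Pi.single i 1)) ((hL' _).2 ⟨_, rfl⟩)
  have hev : ∀ᶠ q in nhds p, q ∈ U ∧ ∀ i j, ip (r + 1) (ψ i q) (ψ j q) =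
      ip (r + 1) (ψ i p) (ψ j p) :=
    (hU.eventually_mem hp).and (Filter.eventually_all.2 fun i => Filter.eventually_all.2 fun j =>
      (hψ i).eventually_ip hy hU (hψ j) hp)
  obtain ⟨V, hV, hVo, hpV⟩ := eventually_nhds_iff.1 hev
  have happ : ∀ a q, Fintype.linearCombination ℝ ψ a q = ∑ i, a i • ψ i q := fun a q => by
    rw [Fintype.linearCombination_apply, Finset.sum_apply]; rfl
  refine ⟨V, Fintype.linearCombination ℝ ψ, hpV, hVo, fun a => ?_, fun q hq a b => ?_⟩
  · rw [Fintype.linearCombination_apply]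
    exact mem_parallelSections.1 (Submodule.sum_mem _ fun i _ => Submodule.smul_mem _ _
      ((hψ i).mono fun q hq => (hV q hq).1))
  · have h1 : ∀ c : Fin (n - 2) → ℝ, ∑ i, c i • ψ i p = L c := fun c => by
      conv_rhs => rw [pi_eq_sum_univ' c, map_sum]
      exact Finset.sum_congr rfl fun i _ => by rw [hψp, map_smul]
    rw [happ, happ, ← hL, ← h1, ← h1]
    simp only [ip_sum_left, ip_sum_right, ip_smul_left, ip_smul_right, (hV q hq).2]

namespace IsParallelFrame

variable {Φ : (Fin (n - 2) → ℝ) →ₗ[ℝ] M → Fin (n + 2) → ℝ} (h : IsParallelFrame r y U Φ)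
include h

lemma injective {p : M} (hp : p ∈ U) {a b : Fin (n - 2) → ℝ} (hab : Φ a p = Φ b p) : a = b :=
  injective_of_isometry (L := LinearMap.proj p ∘ₗ Φ) (h.ip_eq p hp) hab

/-- The frame maps injectively into a space of the same dimension n - 2. -/
lemma exists_eq (hnr : r + 2 ≤ n) (hy : IsIsothermicOn r y univ) {p : M} (hp : p ∈ U)
    {x : Fin (n + 2) → ℝ} (hx : x ∈ normalSpace r y p) : ∃ a, Φ a p = x := by
  obtain ⟨L, hL, hL'⟩ := exists_isometry_normalSpace hnr hy p
  have e1 : normalSpace r y p = LinearMap.range L := by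
    ext x; rw [hL', LinearMap.mem_range]
  have e2 : LinearMap.range (LinearMap.proj p ∘ₗ Φ) = LinearMap.range L := by
    refine Submodule.eq_of_le_of_finrank_eq ?_ ?_
    · rw [← e1]
      rintro _ ⟨a, rfl⟩
      exact (h.parallel a).mem_normalSpace hy h.isOpen hp
    · rw [LinearMap.finrank_range_of_inj (injective_of_isometry (h.ip_eq p hp)),
        LinearMap.finrank_range_of_inj (injective_of_isometry hL)]
  rw [e1, ← e2] at hx
  exact hx

/-- Parallel sections are locally constant combinations of the frame. -/
lemma eventually_eq (hnr : r + 2 ≤ n) (hy : IsIsothermicOn r y univ) (hV : IsOpen V)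
    (hψ : IsParallelOn r y V ψ) {p : M} (hp : p ∈ U) (hpV : p ∈ V) {a : Fin (n - 2) → ℝ}
    (ha : Φ a p = ψ p) : ∀ᶠ q in nhds p, Φ a q = ψ q := by
  have hW : IsOpen (U ∩ V) := h.isOpen.inter hV
  have hχ : IsParallelOn r y (U ∩ V) (Φ a - ψ) := mem_parallelSections.1
    (Submodule.sub_mem _ ((h.parallel a).mono inter_subset_left) (hψ.mono inter_subset_right))
  -- The difference vanishes at p and its products with the frame are locally constant, hence zero
  -- nearby; there the frame spans a nondegenerate space containing the difference.
  have hev := Filter.eventually_all.2 fun i : Fin (n - 2) => hχ.eventually_ip hy hW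
    ((h.parallel (Pi.single i 1)).mono inter_subset_left) ⟨hp, hpV⟩
  filter_upwards [hev, hW.mem_nhds ⟨hp, hpV⟩] with q hq hqW
  obtain ⟨b, hb⟩ := h.exists_eq hnr hy hqW.1 (hχ.mem_normalSpace hy hW hqW)
  have hb0 : b = 0 := by
    funext i
    have h1 := hq i
    rw [Pi.sub_apply, Pi.sub_apply, ha, sub_self, ip_zero_left, ← Pi.sub_apply (Φ a) ψ, ← hb,
      h.ip_eq q hqW.1, ip_single_right] at h1
    exact (mul_eq_zero.1 h1).resolve_left (by split_ifs <;> simp)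
  rw [hb0, map_zero] at hb
  exact sub_eq_zero.1 hb.symm

end IsParallelFrame

/-- Parallel sections are determined by their value at one point. -/
lemma IsParallelSection.eq_of_apply_eq [ConnectedSpace M] (hnr : r + 2 ≤ n)
    (hy : IsIsothermicOn r y univ) (hψ : IsParallelSection r y ψ) (hχ : IsParallelSection r y χ)
    {p : M} (hp : ψ p = χ p) : ψ = χ := by
  rw [← isParallelOn_univ_iff hy] at hψ hχ
  have hev : ∀ q, ψ q = χ q → ∀ᶠ q' in nhds q, ψ q' = χ q' := fun q hq => by
    obtain ⟨U, Φ, hqU, h⟩ := exists_parallelFrame hnr hy q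
    obtain ⟨a, ha⟩ := h.exists_eq hnr hy hqU (hψ.mem_normalSpace hy isOpen_univ (mem_univ q))
    filter_upwards [h.eventually_eq hnr hy isOpen_univ hψ hqU (mem_univ q) ha,
      h.eventually_eq hnr hy isOpen_univ hχ hqU (mem_univ q) (ha.trans hq)] with q' h1 h2
    rw [← h1, h2]
  have hc : Continuous ψ ∧ Continuous χ := by
    have := (isParallelOn_univ_iff hy).1 hψ
    have := (isParallelOn_univ_iff hy).1 hχ
    exact ⟨((isParallelOn_univ_iff hy).1 hψ).smooth.continuous, this.smooth.continuous⟩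
  have hclopen : IsClopen {q | ψ q = χ q} :=
    ⟨isClosed_eq hc.1 hc.2, isOpen_iff_mem_nhds.2 fun q hq => hev q hq⟩
  have := hclopen.eq_univ ⟨p, hp⟩
  exact funext fun q => (this ▸ mem_univ q : q ∈ {q | ψ q = χ q})

end Frames

end

/-! ### Continuation of local frames over a simply connected space. -/

section Monodromy

/-- Over a simply connected space, a locally constant sheaf that is given by local frames `f` has
global sections. -/
lemma exists_section_of_frames {B F G : Type*} [TopologicalSpace B] [SimplyConnectedSpace B]
    [LocallyPathConnectedSpace B] {U : B → Set B} (hU : ∀ i, IsOpen (U i)) (hmem : ∀ i, i ∈ U i)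
    {f : B → F → B → G} (hinj : ∀ {i b v w}, b ∈ U i → f i v b = f i w b → v = w)
    (hsurj : ∀ {i j b}, b ∈ U i → b ∈ U j → ∀ v, ∃ w, f j w b = f i v b)
    (hloc : ∀ {i j b v w}, b ∈ U i → b ∈ U j → f i v b = f j w b →
      ∀ᶠ b' in nhds b, f i v b' = f j w b') (b₀ : B) (v₀ : F) :
    ∃ s : B → G, s b₀ = f b₀ v₀ b₀ ∧ ∀ b, ∃ v, ∀ᶠ b' in nhds b, s b' = f b v b' := by
  classical
  -- With discrete fibres the bundle glued from the frames is a covering, and continuity means local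
  -- constancy.
  let _ : TopologicalSpace F := ⊥
  have : DiscreteTopology F := ⟨rfl⟩
  let cc : B → B → B → F → F := fun i j b v =>
    if h : b ∈ U i ∧ b ∈ U j then (hsurj h.1 h.2 v).choose else v
  have hcc : ∀ {i j b}, b ∈ U i → b ∈ U j → ∀ v, f j (cc i j b v) b = f i v b :=
    fun {i j b} hi hj v => by
      have : cc i j b v = (hsurj hi hj v).choose := dif_pos ⟨hi, hj⟩
      rw [this]
      exact (hsurj hi hj v).choose_spec
  let Z : FiberBundleCore B B F :=
    { baseSet := U
      isOpen_baseSet := hU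
      indexAt := id
      mem_baseSet_at := hmem
      coordChange := cc
      coordChange_self := fun i b hb v => hinj hb (hcc hb hb v)
      continuousOn_coordChange := fun i j => by
        rintro ⟨b, v⟩ ⟨⟨hi, hj⟩, -⟩
        refine ContinuousAt.continuousWithinAt ?_
        have h1 := hloc hj hi (hcc hi hj v)
        have h2 : ∀ᶠ p : B × F in nhds (b, v), cc i j p.1 p.2 = cc i j b v := by
          rw [nhds_prod_eq, nhds_discrete F, Filter.prod_pure, Filter.eventually_map]
          filter_upwards [h1, (hU i).mem_nhds hi, (hU j).mem_nhds hj] with q hq hqi hqj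
          exact hinj hqj ((hcc hqi hqj v).trans hq.symm)
        exact (continuousAt_const (y := cc i j b v)).congr (h2.mono fun _ h => h.symm)
      coordChange_comp := fun i j k b hb v => hinj hb.2 (by
        rw [hcc hb.1.2 hb.2, hcc hb.1.1 hb.1.2, hcc hb.1.1 hb.2]) }
  have cov : IsCoveringMap Z.proj :=
    IsFiberBundle.isCoveringMap fun b => ⟨Z.localTrivAt b, hmem b⟩
  -- A lift of the identity map to the covering is a global section with the prescribed value at b₀.
  obtain ⟨σ, ⟨hσ0, hσ⟩, -⟩ := cov.existsUnique_continuousMap_lifts (ContinuousMap.id B) b₀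
    (⟨b₀, v₀⟩ : Z.TotalSpace) rfl
  have hσ1 : ∀ b, (σ b).1 = b := fun b => congrFun hσ b
  let c : B → F := fun b => (σ b).2
  have hc : ∀ b, ∀ᶠ q in nhds b, cc q b q (c q) = cc b b b (c b) := fun b => by
    have h1 : ContinuousAt (fun q => (Z.localTriv b (σ q)).2) b := by
      refine continuous_snd.continuousAt.comp (ContinuousAt.comp (g := Z.localTriv b)
        ((Z.localTriv b).continuousAt ?_) σ.continuous.continuousAt)
      change (σ b).1 ∈ U b
      rw [hσ1]; exact hmem b
    have h2 : ∀ q, (Z.localTriv b (σ q)).2 = cc q b q (c q) := fun q => by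
      change cc (σ q).1 b (σ q).1 (c q) = _
      rw [hσ1]
    simp only [h2] at h1
    have := h1.eventually (isOpen_discrete ({cc b b b (c b)} : Set F) |>.eventually_mem rfl)
    exact this
  refine ⟨fun b => f b (c b) b, ?_, fun b => ⟨cc b b b (c b), ?_⟩⟩
  · change f b₀ (σ b₀).2 b₀ = _
    rw [hσ0]
  · filter_upwards [hc b, (hU b).mem_nhds (hmem b)] with q hq hqb
    rw [← hq, hcc (hmem q) hqb]

end Monodromy

/-! ### Global parallel sections and the moduli of polar transforms. -/

section Moduli

variable {M : Type*} [TopologicalSpace M] [ChartedSpace ℂ M] [IsManifold 𝓘(ℝ, ℂ) ∞ M] {n r : ℕ}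
variable {φ : OpenPartialHomeomorph M ℂ} {y : M → Quadric n r} {Y : M → Fin (n + 2) → ℝ}
variable {U V : Set M} {ψ χ : M → Fin (n + 2) → ℝ} {c : ℝ}

lemma IsParallelOn.congr_eventually (h : ∀ p ∈ U, ∃ χ V, IsOpen V ∧ p ∈ V ∧ IsParallelOn r y V χ ∧
    ∀ᶠ q in nhds p, ψ q = χ q) : IsParallelOn r y U ψ := by
  refine isParallelOn_of_local fun p hp => ?_
  obtain ⟨χ, V, hV, hpV, hχ, hev⟩ := h p hp
  obtain ⟨W, hW, hWo, hpW⟩ := eventually_nhds_iff.1 (hev.and (hV.eventually_mem hpV))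
  refine ⟨W, hWo, hpW, fun φ Y hY hs => ?_⟩
  obtain ⟨h1, h2⟩ := hχ φ Y hY fun q hq => (hW q (hs hq)).2
  have e : ∀ q ∈ φ.source, ψ q = χ q := fun q hq => (hW q (hs hq)).1
  refine ⟨h1.congr e, fun q hq => ?_⟩
  have e2 := dc_congr (-Complex.I) (F := toC ∘ ψ) (G := toC ∘ χ)
    (fun _ hq => congrArg toC (e _ hq)) hq
  rw [e q hq, e2]
  exact h2 q hq

/-- On a simply connected surface, every normal vector extends to a parallel section. -/
theorem exists_isParallelSection [SimplyConnectedSpace M] (hnr : r + 2 ≤ n)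
    (hy : IsIsothermicOn r y univ) (p : M) {x : Fin (n + 2) → ℝ} (hx : x ∈ normalSpace r y p) :
    ∃ ψ, IsParallelSection r y ψ ∧ ψ p = x := by
  have : LocallyPathConnectedSpace M := ChartedSpace.locallyPathConnectedSpace ℂ M
  choose U Φ hmem h using fun q => exists_parallelFrame hnr hy q
  obtain ⟨v₀, hv₀⟩ := (h p).exists_eq hnr hy (hmem p) hx
  obtain ⟨s, hs0, hs⟩ := exists_section_of_frames (fun q => (h q).isOpen) hmem
    (f := fun i v b => Φ i v b) (fun hb => (h _).injective hb)
    (fun hi hj v => (h _).exists_eq hnr hy hj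
      (((h _).parallel v).mem_normalSpace hy (h _).isOpen hi))
    (fun hi hj hb => (h _).eventually_eq hnr hy (h _).isOpen ((h _).parallel _) hi hj hb) p v₀
  refine ⟨s, (isParallelOn_univ_iff hy).1 (IsParallelOn.congr_eventually fun q _ => ?_),
    hs0.trans hv₀⟩
  obtain ⟨v, hv⟩ := hs q
  exact ⟨Φ q v, U q, (h q).isOpen, hmem q, (h q).parallel v, hv⟩

/-- The inner product of parallel sections is constant. -/
lemma IsParallelSection.ip_eq [ConnectedSpace M] (hy : IsIsothermicOn r y univ)
    (hψ : IsParallelSection r y ψ) (hχ : IsParallelSection r y χ) (p q : M) :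
    ip (r + 1) (ψ p) (χ p) = ip (r + 1) (ψ q) (χ q) := by
  rw [← isParallelOn_univ_iff hy] at hψ hχ
  have : IsLocallyConstant fun q => ip (r + 1) (ψ q) (χ q) :=
    (IsLocallyConstant.iff_eventually_eq _).2 fun q =>
      hψ.eventually_ip hy isOpen_univ hχ (mem_univ q)
  exact this.apply_eq_of_preconnectedSpace p q

/-- A parallel section with a zero coincides with the zero section, so a nonzero one vanishes
nowhere. -/
lemma IsParallelSection.isPolar [ConnectedSpace M] (hnr : r + 2 ≤ n)
    (hy : IsIsothermicOn r y univ) (hψ : IsParallelSection r y ψ) (h0 : ψ ≠ 0) {p : M}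
    (hp : ip (r + 1) (ψ p) (ψ p) = c) : IsPolar r y c ψ where
  section_ := hψ
  length := fun q => (hψ.ip_eq hy hψ q p).trans hp
  ne_zero := fun _ hq => h0 (hψ.eq_of_apply_eq hnr hy
    ((isParallelOn_univ_iff hy).1 (mem_parallelSections.1 (zero_mem _))) hq)

/-- Two parallel sections induce the same metric if and only if they agree up to sign. -/
theorem IsParallelSection.inducedMetric_eq_iff [ConnectedSpace M] (hnr : r + 2 ≤ n)
    (hy : IsIsothermicOn r y univ) (hfull : IsFull r y) (hψ : IsParallelSection r y ψ)
    (hχ : IsParallelSection r y χ) :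
    (∀ p v w, inducedMetric (r + 1) ψ p v w = inducedMetric (r + 1) χ p v w) ↔
      (χ = ψ ∨ χ = -ψ) := by
  constructor
  · intro h
    have zero : ∀ {ξ : M → Fin (n + 2) → ℝ}, IsParallelSection r y ξ →
        (∃ φ Y, IsAdapted r y φ Y ∧ φ.source.Nonempty ∧ ∀ q ∈ φ.source, hFun r φ Y ξ q = 0) →
        ξ = 0 := fun {ξ} hξ => by
      rintro ⟨φ, Y, hY, ⟨p, hp⟩, h0⟩
      exact hξ.eq_of_apply_eq hnr hy
        ((isParallelOn_univ_iff hy).1 (mem_parallelSections.1 (zero_mem _)))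
        (hξ.eq_zero_of_hFun hfull hY h0 hp)
    have add : IsParallelSection r y (χ + ψ) := (isParallelOn_univ_iff hy).1
      (mem_parallelSections.1 (add_mem (mem_parallelSections.2 ((isParallelOn_univ_iff hy).2 hχ))
        (mem_parallelSections.2 ((isParallelOn_univ_iff hy).2 hψ))))
    have sub : IsParallelSection r y (χ - ψ) := (isParallelOn_univ_iff hy).1
      (mem_parallelSections.1 (sub_mem (mem_parallelSections.2 ((isParallelOn_univ_iff hy).2 hχ))
        (mem_parallelSections.2 ((isParallelOn_univ_iff hy).2 hψ))))
    have hadd : ∀ (φ : OpenPartialHomeomorph M ℂ) Y q,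
        hFun r φ Y (χ + ψ) q = hFun r φ Y χ q + hFun r φ Y ψ q := fun φ Y q => by
      simp only [hFun, Pi.add_apply, toC_add, ip_add_left]
    have hsub : ∀ (φ : OpenPartialHomeomorph M ℂ) Y q,
        hFun r φ Y (χ - ψ) q = hFun r φ Y χ q - hFun r φ Y ψ q := fun φ Y q => by
      simp only [hFun, Pi.sub_apply, toC_sub, ip_sub_left]
    -- The metrics are 4⟨ψ, κ⟩²|dz|² and 4⟨χ, κ⟩²|dz|², and the difference of the squares factors.
    have hsq : ∀ φ Y, IsAdapted r y φ Y → ∀ q ∈ φ.source,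
        hFun r φ Y (χ - ψ) q * hFun r φ Y (χ + ψ) q = 0 := fun φ Y hY q hq => by
      obtain ⟨v, hv⟩ := (mfderiv_chart_bijective hY.1.chart hq).2 (1 : ℂ)
      have h1 := h q v v
      rw [inducedMetric, inducedMetric, mfderiv_eq_fderiv_chart hY.1.chart hq (hψ.sm hY.1),
        mfderiv_eq_fderiv_chart hY.1.chart hq (hχ.sm hY.1), hv] at h1
      have h2 := (hψ.ip_fderiv_self hY hq 1).symm.trans (h1.trans (hχ.ip_fderiv_self hY hq 1))
      rw [hadd, hsub, hFun_eq_re hψ hY hq, hFun_eq_re hχ hY hq]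
      norm_cast
      rw [norm_one] at h2
      linear_combination (-1 / 4 : ℝ) * h2
    obtain ⟨p⟩ : Nonempty M := inferInstance
    obtain ⟨φ, Y, hp, -, hY⟩ := hy p (mem_univ p)
    by_cases hz : ∀ q ∈ φ.source, hFun r φ Y (χ - ψ) q = 0
    · exact Or.inl (sub_eq_zero.1 (zero sub ⟨φ, Y, hY, ⟨p, hp⟩, hz⟩))
    -- Where the first factor is nonzero it stays so on a neighbourhood, and there the second one
    -- vanishes identically.
    · push Not at hz
      obtain ⟨q, hq, hq0⟩ := hz
      have hc := (sub.localPolar hY).smh.continuousOn.continuousAt (φ.open_source.mem_nhds hq)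
      obtain ⟨W, hW, hWo, hqW⟩ := eventually_nhds_iff.1 (hc.eventually_ne hq0)
      refine Or.inr (eq_neg_of_add_eq_zero_left (zero add ⟨φ.restr W, Y, hY.restr hWo,
        ⟨q, ?_⟩, fun q' hq' => ?_⟩))
      · rw [φ.restr_source' W hWo]; exact ⟨hq, hqW⟩
      · rw [φ.restr_source' W hWo] at hq'
        exact (mul_eq_zero.1 (hsq φ Y hY q' hq'.1)).resolve_left (hW q' hq'.2)
  · rintro (rfl | rfl) p v w
    · rfl
    · have e : ∀ v : TangentSpace 𝓘(ℝ, ℂ) p,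
          (mfderiv 𝓘(ℝ, ℂ) 𝓘(ℝ, Fin (n + 2) → ℝ) (-ψ) p v : Fin (n + 2) → ℝ) =
          -(mfderiv 𝓘(ℝ, ℂ) 𝓘(ℝ, Fin (n + 2) → ℝ) ψ p v : Fin (n + 2) → ℝ) := fun v => by
        rw [mfderiv_neg]; rfl
      have h1 : ∀ a b : Fin (n + 2) → ℝ, ip (r + 1) a b = ip (r + 1) (-a) (-b) := fun a b => by
        rw [ip_neg_left, ip_neg_right, neg_neg]
      rw [inducedMetric, inducedMetric, e, e]
      exact h1 _ _

/-- On a simply connected surface, the parallel sections form a space isometric to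
`ℝ ^ (n - 2)` with the form of index `r`. -/
theorem exists_isometry_parallelSections [SimplyConnectedSpace M] (hnr : r + 2 ≤ n)
    (hy : IsIsothermicOn r y univ) :
    ∃ Φ : (Fin (n - 2) → ℝ) →ₗ[ℝ] M → Fin (n + 2) → ℝ,
      BijOn Φ univ {ψ | IsParallelSection r y ψ} ∧
      ∀ a b p, ip (r + 1) (Φ a p) (Φ b p) = ip r a b := by
  obtain ⟨p⟩ : Nonempty M := inferInstance
  obtain ⟨L, hL, hL'⟩ := exists_isometry_normalSpace hnr hy p
  -- Evaluation at the base point p determines a parallel section; linearity and isometry of Ψ are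
  -- thereby inherited from L.
  choose Ψ hΨ hΨp using fun a => exists_isParallelSection hnr hy p ((hL' (L a)).2 ⟨a, rfl⟩)
  have mem : ∀ {ξ}, IsParallelSection r y ξ ↔ ξ ∈ parallelSections r y univ :=
    (isParallelOn_univ_iff hy).symm
  let Φ : (Fin (n - 2) → ℝ) →ₗ[ℝ] M → Fin (n + 2) → ℝ :=
    { toFun := Ψ
      map_add' := fun a b => (hΨ _).eq_of_apply_eq hnr hy
        (mem.2 (add_mem (mem.1 (hΨ a)) (mem.1 (hΨ b)))) (p := p) (by
          rw [Pi.add_apply, hΨp, hΨp, hΨp, map_add])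
      map_smul' := fun t a => (hΨ _).eq_of_apply_eq hnr hy
        (mem.2 (Submodule.smul_mem _ t (mem.1 (hΨ a)))) (p := p) (by
          rw [Pi.smul_apply, hΨp, hΨp, map_smul]; rfl) }
  refine ⟨Φ, ⟨fun a _ => hΨ a, fun a _ b _ hab => ?_, fun ψ hψ => ?_⟩, fun a b q => ?_⟩
  · refine injective_of_isometry hL ?_
    rw [← hΨp a, ← hΨp b]
    exact congrFun hab p
  · have h1 := ((isParallelOn_univ_iff hy).2 hψ).mem_normalSpace hy isOpen_univ (mem_univ p)
    obtain ⟨a, ha⟩ := (hL' _).1 h1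
    exact ⟨a, mem_univ a, (hΨ a).eq_of_apply_eq hnr hy hψ ((hΨp a).trans ha)⟩
  · change ip (r + 1) (Ψ a q) (Ψ b q) = _
    rw [(hΨ a).ip_eq hy (hΨ b) q p, hΨp, hΨp, hL]

/-- The moduli of polar transforms. -/
theorem exists_moduli [SimplyConnectedSpace M] (hnr : r + 2 ≤ n) (hy : IsIsothermicOn r y univ)
    (hfull : IsFull r y) :
    ∃ Φ : (Fin (n - 2) → ℝ) →ₗ[ℝ] (M → Fin (n + 2) → ℝ),
      BijOn Φ univ {ψ | IsParallelSection r y ψ} ∧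
      (∀ a b p, ip (r + 1) (Φ a p) (Φ b p) = ip r a b) ∧
      ∀ c : ℝ, BijOn Φ (quadricSet (n - 2) r c) {ψ | IsPolar r y c ψ} ∧
        ∃ e : Quotient (signSetoid (n - 2) r c) ≃ Quotient (isometrySetoid r y c),
          ∀ (x : quadricSet (n - 2) r c) (h : IsPolar r y c (Φ x)),
            e (Quotient.mk _ x) = Quotient.mk _ ⟨Φ x, h⟩ := by
  obtain ⟨Φ, hΦ, hip⟩ := exists_isometry_parallelSections hnr hy
  refine ⟨Φ, hΦ, hip, fun c => ?_⟩
  obtain ⟨p⟩ : Nonempty M := inferInstance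
  have hinj : Function.Injective Φ := injOn_univ.1 hΦ.injOn
  have hbij : BijOn Φ (quadricSet (n - 2) r c) {ψ | IsPolar r y c ψ} := by
    refine ⟨fun a ha => (hΦ.mapsTo (mem_univ a)).isPolar hnr hy ?_ ((hip a a p).trans ha.2),
      hinj.injOn, fun ψ hψ => ?_⟩
    · rw [← map_zero Φ]
      exact hinj.ne ha.1
    · obtain ⟨a, -, rfl⟩ := hΦ.surjOn hψ.section_
      refine ⟨a, ⟨fun h0 => hψ.ne_zero p ?_, (hip a a p).symm.trans (hψ.length p)⟩, rfl⟩
      rw [h0, map_zero]; rfl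
  let e : quadricSet (n - 2) r c ≃ {ψ // IsPolar r y c ψ} := hbij.equiv Φ
  refine ⟨hbij, Quotient.congr e fun a b => ?_, fun x h => rfl⟩
  have h1 := (hΦ.mapsTo (mem_univ a.1)).inducedMetric_eq_iff hnr hy hfull
    (hΦ.mapsTo (mem_univ b.1))
  -- Injectivity of Φ turns the sign ambiguity of sections into the sign ambiguity of vectors.
  rw [← map_neg, hinj.eq_iff, hinj.eq_iff] at h1
  exact h1.symm

end Moduli

end Polar

end


theorem mainTheorem1 {M : Type*} [TopologicalSpace M] [ChartedSpace ℂ M]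
    [IsManifold 𝓘(ℝ, ℂ) ∞ M] [T2Space M] [SecondCountableTopology M] [ConnectedSpace M]
    (n r : ℕ) (hnr : r + 2 ≤ n) (y : M → Quadric n r)
    (hy : IsIsothermicOn r y univ) (hfull : IsFull r y) :
    -- the individual polar transforms
    (∀ (c : ℝ) (ψ : M → Fin (n + 2) → ℝ) (hψ : IsPolar r y c ψ),
      IsOpen (immersionSet ψ) ∧ Dense (immersionSet ψ) ∧
      -- isothermic, with the same adapted coordinates
      IsIsothermicFormOn (r + 1) c ψ (immersionSet ψ) ∧
      (∀ φ Y, IsAdapted r y φ Y → φ.source ⊆ immersionSet ψ →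
        IsAdaptedForm (r + 1) c ψ φ ∧
        -- the null parallel minimal section, a lift of `y` that is dual to `ψ`
        (∀ p ∈ φ.source, ip (r + 1) (toC (ψ p)) (hopf r φ Y p) ≠ 0) ∧
        IsLiftOn r y φ.source (polarLift r φ Y ψ) ∧
        (∀ p ∈ φ.source, ip (r + 1) (polarLift r φ Y ψ p) (polarLift r φ Y ψ p) = 0) ∧
        IsParallelIsoperimetric (r + 1) c φ ψ (polarLift r φ Y ψ) 0 ∧
        IsDual φ (polarLift r φ Y ψ) ψ) ∧
      -- the conformal surface defined by `ψ`, its metric, and its Willmore functional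
      (∀ hc : c = 0, SharesAdapted y ψ (hψ.conf0 hc) (immersionSet ψ) ∧
        (CompactSpace M → immersionSet ψ = univ →
          ∃ w, HasWillmore r y w ∧ HasWillmore r (hψ.conf0 hc) w)) ∧
      (∀ hc : 0 < c, SharesAdapted y ψ (hψ.confPos hc) (immersionSet ψ) ∧
        (CompactSpace M → immersionSet ψ = univ →
          ∃ w, HasWillmore r y w ∧ HasWillmore (r + 1) (hψ.confPos hc) w)) ∧
      (∀ hc : c < 0, SharesAdapted y ψ (hψ.confNeg hc hnr) (immersionSet ψ) ∧
        (CompactSpace M → immersionSet ψ = univ →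
          ∃ w, HasWillmore r y w ∧ HasWillmore r (hψ.confNeg hc hnr) w))) ∧
    -- isometric polar surfaces
    (∀ (c : ℝ) (ψ₁ ψ₂ : M → Fin (n + 2) → ℝ), IsPolar r y c ψ₁ → IsPolar r y c ψ₂ →
      ((∀ p v w, inducedMetric (r + 1) ψ₁ p v w = inducedMetric (r + 1) ψ₂ p v w) ↔
        (ψ₂ = ψ₁ ∨ ψ₂ = -ψ₁))) ∧
    -- the moduli space
    (SimplyConnectedSpace M →
      ∃ Φ : (Fin (n - 2) → ℝ) →ₗ[ℝ] (M → Fin (n + 2) → ℝ),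
        BijOn Φ univ {ψ | IsParallelSection r y ψ} ∧
        (∀ a b p, ip (r + 1) (Φ a p) (Φ b p) = ip r a b) ∧
        ∀ c : ℝ, BijOn Φ (quadricSet (n - 2) r c) {ψ | IsPolar r y c ψ} ∧
          ∃ e : Quotient (signSetoid (n - 2) r c) ≃ Quotient (isometrySetoid r y c),
            ∀ (x : quadricSet (n - 2) r c) (h : IsPolar r y c (Φ x)),
              e (Quotient.mk _ x) = Quotient.mk _ ⟨Φ x, h⟩) := by
  refine ⟨fun c ψ hψ => ?_, fun c ψ₁ ψ₂ h₁ h₂ =>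
    h₁.section_.inducedMetric_eq_iff hnr hy hfull h₂.section_, fun _ => exists_moduli hnr hy hfull⟩
  have hopen := isOpen_immersionSet hy hψ.section_
  refine ⟨hopen, dense_immersionSet hy hfull hψ.section_ hψ.ne_zero,
    ⟨fun p _ _ => hψ.length p, fun p hp => ?_⟩, fun φ Y hY hS => ?_, fun hc => ?_, fun hc => ?_,
    fun hc => ?_⟩
  · obtain ⟨φ, Y, h1, h2, h3⟩ := hy.exists_adapted hopen hp
    exact ⟨φ, h1, h2, hψ.isAdaptedForm h3 h2⟩
  · exact ⟨hψ.isAdaptedForm hY hS, fun p hp => hψ.hFun_ne_zero hY hS hp, hψ.isLiftOn hY hS,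
      fun p hp => (hψ.isLiftOn hY hS).null hp, hψ.isParallelIsoperimetric hY hS, hψ.isDual hY hS⟩
  · exact ⟨(hψ.model0 hc).sharesAdapted hψ hy, fun _ => (hψ.model0 hc).exists_willmore hψ hy⟩
  · exact ⟨(hψ.modelPos hc).sharesAdapted hψ hy, fun _ => (hψ.modelPos hc).exists_willmore hψ hy⟩
  · exact ⟨(hψ.modelNeg hc hnr).sharesAdapted hψ hy,
      fun _ => (hψ.modelNeg hc hnr).exists_willmore hψ hy⟩
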